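/- Let $L,T>0$, let $\rho,\alpha,\lambda,\mu,\rho_1,K,\gamma,b,\rho_3,\delta,\kappa>0$ and $\beta\in\mathbb R\setminus\{0\}$. Write $(\cdot,\cdot)$ and $\|\cdot\|$ for the inner product and the norm of $L^2(0,L)$. Let $(u,\varphi,\psi,w)$, with $u,\varphi,w\in C([0,T];H^1_0(0,L))\cap C^1([0,T];L^2(0,L))$ and $\psi\in C([0,T];H^1_0(0,L))$, be a weak solution on $(0,L)\times(0,T)$ of $$\begin{cases}\rho u_{tt}-\alpha u_{xx}-\lambda(\varphi-u)+\mu u_t=0,\\ \rho_1\varphi_{tt}-K(\varphi_x+\psi)_x+\lambda(\varphi-u)+\gamma\varphi_t+\beta w_{xt}=0,\\ -b\psi_{xx}+K(\varphi_x+\psi)=0,\\ \rho_3w_{tt}-\delta w_{xx}+\beta\varphi_{xt}-\kappa w_{xxt}=0,\end{cases}$$ with homogeneous Dirichlet conditions for $u,\varphi,\psi,w$ at $x=0$ and $x=L$, and with the initial conditions $u(0)=u_0$, $u_t(0)=u_1$, $\varphi(0)=\varphi_0$, $\varphi_t(0)=\varphi_1$, $\psi(0)=\psi_0$, $w(0)=w_0$,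 $w_t(0)=w_1$, where all the data lie in $H^1_0(0,L)$. Put $\xi=u_t$, $\Phi=\varphi_t$, $\vartheta=w_t$. For integers $M,N\ge1$ let $h=L/M$, $x_i=ih$, $\Delta t=T/N$, $t_n=n\Delta t$. Let $S_h$ be the space of all $v_h\in H^1_0(0,L)$ that are affine on every $[x_i,x_{i+1}]$, $0\le i<M$, and let $P_h:H^1_0(0,L)\to S_h$ be the projection given by $((P_h\eta-\eta)_x,\chi_{hx})=0$ for all $\chi_h\in S_h$. The fully discrete solution starts from $u_h^0=P_hu_0$, $\xi_h^0=P_hu_1$, $\varphi_h^0=P_h\varphi_0$, $\Phi_h^0=P_h\varphi_1$, $\psi_h^0=P_h\psi_0$, $w_h^0=P_hw_0$, $\vartheta_h^0=P_hw_1$, and consists, for $n=1,\dots,N$, of $\xi_h^n,\Phi_h^n,\psi_h^n,\vartheta_h^n\in S_h$ and $$u_h^n=u_h^{n-1}+\Delta t\,\xi_h^n,\qquad \varphi_h^n=\varphi_h^{n-1}+\Delta t\,\Phi_h^n,\qquad w_h^n=w_h^{n-1}+\Delta t\,\vartheta_h^n$$ such that for all $\bar u_h,\bar\varphi_h,\bar\psi_h,\bar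 w_h\in S_h$ $$\begin{cases}\frac{\rho}{\Delta t}(\xi_h^n-\xi_h^{n-1},\bar u_h)+\alpha(u^n_{hx},\bar u_{hx})-\lambda(\varphi_h^n-u_h^n,\bar u_h)+\mu(\xi_h^n,\bar u_h)=0,\\ \frac{\rho_1}{\Delta t}(\Phi_h^n-\Phi_h^{n-1},\bar\varphi_h)+K(\varphi^n_{hx}+\psi_h^n,\bar\varphi_{hx})+\lambda(\varphi_h^n-u_h^n,\bar\varphi_h)+\gamma(\Phi_h^n,\bar\varphi_h)+\beta(\vartheta^n_{hx},\bar\varphi_h)=0,\\ b(\psi^n_{hx},\bar\psi_{hx})+K(\varphi^n_{hx}+\psi_h^n,\bar\psi_h)=0,\\ \frac{\rho_3}{\Delta t}(\vartheta_h^n-\vartheta_h^{n-1},\bar w_h)+\delta(w^n_{hx},\bar w_{hx})+\beta(\Phi^n_{hx},\bar w_h)+\kappa(\vartheta^n_{hx},\bar w_{hx})=0.\end{cases}$$ Theorem (a priori error estimate). Suppose that $u,\varphi,w\in H^3(0,T;L^2(0,L))\cap H^2(0,T;H^1(0,L))\cap W^{1,\infty}(0,T;H^2(0,L))$ and $\psi\in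 H^1(0,T;H^2(0,L))$. Then there is a constant $C>0$, independent of $h$ and $\Delta t$ (that is, of $M$ and $N$) and of $n$, such that for all $M,N\ge1$ and all $n=0,\dots,N$ $$\begin{aligned}&\|\xi_h^n-\xi(t_n)\|^2+\|u^n_{hx}-u_x(t_n)\|^2+\|\varphi_h^n-u_h^n-(\varphi(t_n)-u(t_n))\|^2+\|\Phi_h^n-\Phi(t_n)\|^2\\&+\|\varphi^n_{hx}+\psi_h^n-(\varphi_x(t_n)+\psi(t_n))\|^2+\|\psi^n_{hx}-\psi_x(t_n)\|^2+\|\vartheta_h^n-\vartheta(t_n)\|^2+\|w^n_{hx}-w_x(t_n)\|^2\le C\,(h^2+(\Delta t)^2).\end{aligned}$$ -/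

import Mathlib

open MeasureTheory Set
open scoped ContDiff ENNReal

noncomputable section

namespace ShearBeam

/-! ### Lebesgue and Sobolev spaces on the interval `(0, L)` -/

/-- Lebesgue measure on the open interval `(0, L)`. -/
abbrev vol (L : ℝ) : Measure ℝ := volume.restrict (Ioo 0 L)

/-- The real Hilbert space `L²(0, L)`; its inner product and norm are the `(·,·)` and `‖·‖` of the
weak formulations. -/
abbrev L2 (L : ℝ) : Type := Lp ℝ 2 (vol L)

/-- `ζ ∈ C_c^∞(a, b)`. -/
structure IsTestFunction (a b : ℝ) (ζ : ℝ → ℝ) : Prop where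
  smooth : ContDiff ℝ ∞ ζ
  compact : HasCompactSupport ζ
  support : tsupport ζ ⊆ Ioo a b

/-- `g ∈ L²(0, L)` is the weak derivative of `f ∈ L²(0, L)`. -/
def IsWeakDeriv {L : ℝ} (f g : L2 L) : Prop :=
  ∀ ζ : ℝ → ℝ, IsTestFunction 0 L ζ →
    ∫ x, f x * deriv ζ x ∂(vol L) = - ∫ x, g x * ζ x ∂(vol L)

theorem memLp_of_continuous_compact {L : ℝ} {ζ : ℝ → ℝ} (hc : Continuous ζ)
    (hs : HasCompactSupport ζ) : MemLp ζ 2 (vol L) :=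
  hc.memLp_of_hasCompactSupport hs

theorem integral_mul_eq_inner {L : ℝ} (f : L2 L) {ζ : ℝ → ℝ} (hζ : MemLp ζ 2 (vol L)) :
    ∫ x, f x * ζ x ∂(vol L) = inner ℝ (hζ.toLp ζ) f := by
  rw [L2.inner_def]
  refine integral_congr_ae ?_
  filter_upwards [hζ.coeFn_toLp] with x hx
  simp [hx]

theorem isWeakDeriv_iff_inner {L : ℝ} (f g : L2 L) :
    IsWeakDeriv f g ↔ ∀ (ζ : ℝ → ℝ) (_ : IsTestFunction 0 L ζ)
      (h₀ : MemLp ζ 2 (vol L)) (h₁ : MemLp (deriv ζ) 2 (vol L)),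
      inner ℝ (h₁.toLp (deriv ζ)) f + inner ℝ (h₀.toLp ζ) g = 0 := by
  constructor
  · intro H ζ hζ h₀ h₁
    have h := H ζ hζ
    rw [integral_mul_eq_inner f h₁, integral_mul_eq_inner g h₀] at h
    linarith
  · intro H ζ hζ
    have h₀ : MemLp ζ 2 (vol L) := memLp_of_continuous_compact hζ.smooth.continuous hζ.compact
    have h₁ : MemLp (deriv ζ) 2 (vol L) :=
      memLp_of_continuous_compact (hζ.smooth.continuous_deriv (by simp)) hζ.compact.deriv
    have h := H ζ hζ h₀ h₁
    rw [integral_mul_eq_inner f h₁, integral_mul_eq_inner g h₀]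
    linarith

/-- The graph of the weak derivative in `L²(0, L) × L²(0, L)`. -/
def H1Submodule (L : ℝ) : Submodule ℝ (WithLp 2 (L2 L × L2 L)) where
  carrier := {v | IsWeakDeriv v.fst v.snd}
  zero_mem' := by
    simp only [mem_ofPred_eq, isWeakDeriv_iff_inner]
    intro ζ _ h₀ h₁
    simp
  add_mem' := by
    intro v w hv hw
    simp only [mem_ofPred_eq, isWeakDeriv_iff_inner] at *
    intro ζ hζ h₀ h₁
    have := hv ζ hζ h₀ h₁
    have := hw ζ hζ h₀ h₁
    simp only [WithLp.add_fst, WithLp.add_snd, inner_add_right]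
    linarith
  smul_mem' := by
    intro c v hv
    simp only [mem_ofPred_eq, isWeakDeriv_iff_inner] at *
    intro ζ hζ h₀ h₁
    have := hv ζ hζ h₀ h₁
    simp only [WithLp.smul_fst, WithLp.smul_snd, inner_smul_right]
    linear_combination c * this

/-- The Sobolev space `H¹(0, L)`: an element is a function of `L²(0, L)` together with its weak
derivative in `L²(0, L)`, and the norm is `‖v‖² = ‖v‖²_{L²} + ‖v_x‖²_{L²}`. -/
abbrev H1 (L : ℝ) : Type := ↥(H1Submodule L)

/-- The function in `L²(0, L)` underlying an element of `H¹(0, L)`. -/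
def fn {L : ℝ} (v : H1 L) : L2 L := v.1.fst

/-- The weak derivative `v_x ∈ L²(0, L)` of `v ∈ H¹(0, L)`. -/
def dx {L : ℝ} (v : H1 L) : L2 L := v.1.snd

/-- The pairs `(v, g) ∈ H¹(0, L) × L²(0, L)` such that `g` is the weak derivative of `v_x`. -/
def H2Submodule (L : ℝ) : Submodule ℝ (WithLp 2 (H1 L × L2 L)) where
  carrier := {v | IsWeakDeriv (dx v.fst) v.snd}
  zero_mem' := by
    simp only [mem_ofPred_eq, isWeakDeriv_iff_inner]
    intro ζ _ h₀ h₁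
    simp [dx]
  add_mem' := by
    intro v w hv hw
    simp only [mem_ofPred_eq, isWeakDeriv_iff_inner, dx] at *
    intro ζ hζ h₀ h₁
    have := hv ζ hζ h₀ h₁
    have := hw ζ hζ h₀ h₁
    simp only [WithLp.add_fst, WithLp.add_snd, Submodule.coe_add, inner_add_right]
    linarith
  smul_mem' := by
    intro c v hv
    simp only [mem_ofPred_eq, isWeakDeriv_iff_inner, dx] at *
    intro ζ hζ h₀ h₁
    have := hv ζ hζ h₀ h₁
    simp only [WithLp.smul_fst, WithLp.smul_snd, Submodule.coe_smul, inner_smul_right]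
    linear_combination c * this

/-- The Sobolev space `H²(0, L)`: an element is a `v ∈ H¹(0, L)` together with the weak derivative
`v_xx ∈ L²(0, L)` of `v_x`, and the norm is `‖v‖² = ‖v‖²_{H¹} + ‖v_xx‖²_{L²}`. -/
abbrev H2 (L : ℝ) : Type := ↥(H2Submodule L)

/-- The embedding `H²(0, L) ⊂ H¹(0, L)`. -/
def H2.toH1 {L : ℝ} (v : H2 L) : H1 L := v.1.fst

theorem continuous_dx {L : ℝ} : Continuous (dx (L := L)) :=
  (WithLp.continuous_snd 2 (L2 L) (L2 L)).comp continuous_subtype_val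

instance instCompleteSpaceH1 (L : ℝ) : CompleteSpace (H1 L) := by
  have hcl : IsClosed ((H1Submodule L : Submodule ℝ (WithLp 2 (L2 L × L2 L))) :
      Set (WithLp 2 (L2 L × L2 L))) := by
    have : ((H1Submodule L : Submodule ℝ (WithLp 2 (L2 L × L2 L))) :
        Set (WithLp 2 (L2 L × L2 L))) = {v | IsWeakDeriv v.fst v.snd} := rfl
    rw [this]
    simp only [isWeakDeriv_iff_inner, ofPred_forall]
    refine isClosed_iInter fun ζ => isClosed_iInter fun _ => isClosed_iInter fun h₀ =>
      isClosed_iInter fun h₁ => isClosed_eq ?_ continuous_const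
    exact (continuous_const.inner (WithLp.continuous_fst 2 (L2 L) (L2 L))).add
      (continuous_const.inner (WithLp.continuous_snd 2 (L2 L) (L2 L)))
  exact hcl.completeSpace_coe

instance instCompleteSpaceH2 (L : ℝ) : CompleteSpace (H2 L) := by
  have hcl : IsClosed ((H2Submodule L : Submodule ℝ (WithLp 2 (H1 L × L2 L))) :
      Set (WithLp 2 (H1 L × L2 L))) := by
    have : ((H2Submodule L : Submodule ℝ (WithLp 2 (H1 L × L2 L))) :
        Set (WithLp 2 (H1 L × L2 L))) = {v | IsWeakDeriv (dx v.fst) v.snd} := rfl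
    rw [this]
    simp only [isWeakDeriv_iff_inner, ofPred_forall]
    refine isClosed_iInter fun ζ => isClosed_iInter fun _ => isClosed_iInter fun h₀ =>
      isClosed_iInter fun h₁ => isClosed_eq ?_ continuous_const
    exact (continuous_const.inner
      (continuous_dx.comp (WithLp.continuous_fst 2 (H1 L) (L2 L)))).add
      (continuous_const.inner (WithLp.continuous_snd 2 (H1 L) (L2 L)))
  exact hcl.completeSpace_coe

/-- The elements of `H¹(0, L)` whose continuous representative on `[0, L]` vanishes at `0` and at
`L`. -/
def H10Submodule (L : ℝ) : Submodule ℝ (H1 L) where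
  carrier := {v | ∃ F : ℝ → ℝ, ContinuousOn F (Icc 0 L) ∧ (∀ᵐ x ∂(vol L), fn v x = F x) ∧
    F 0 = 0 ∧ F L = 0}
  zero_mem' := by
    refine ⟨fun _ => 0, continuousOn_const, ?_, rfl, rfl⟩
    filter_upwards [Lp.coeFn_zero ℝ 2 (vol L)] with x hx
    exact hx
  add_mem' := by
    rintro v w ⟨F, hF, hvF, hF0, hFL⟩ ⟨G, hG, hwG, hG0, hGL⟩
    refine ⟨fun x => F x + G x, hF.add hG, ?_, by simp [hF0, hG0], by simp [hFL, hGL]⟩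
    filter_upwards [hvF, hwG, Lp.coeFn_add (fn v) (fn w)] with x h1 h2 h3
    rw [← h1, ← h2]
    exact h3
  smul_mem' := by
    rintro c v ⟨F, hF, hvF, hF0, hFL⟩
    refine ⟨fun x => c * F x, continuousOn_const.mul hF, ?_, by simp [hF0], by simp [hFL]⟩
    filter_upwards [hvF, Lp.coeFn_smul c (fn v)] with x h1 h3
    rw [← h1]
    exact h3

/-- The Sobolev space `H¹₀(0, L)`, with the norm of `H¹(0, L)`. -/
abbrev H10 (L : ℝ) : Type := ↥(H10Submodule L)

/-- The Bochner–Sobolev space `W^{k,p}(0, T; B)`: `d j` is the `j`-th weak time derivative of `f`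
and lies in `L^p(0, T; B)` for every `j ≤ k`. For `p = 2` this is `H^k(0, T; B)`. -/
def MemTimeSobolev {B : Type*} [NormedAddCommGroup B] [NormedSpace ℝ B]
    (T : ℝ) (k : ℕ) (p : ℝ≥0∞) (f : ℝ → B) : Prop :=
  ∃ d : ℕ → ℝ → B, d 0 = f ∧
    (∀ j ≤ k, MemLp (d j) p (volume.restrict (Ioo 0 T))) ∧
    ∀ j < k, ∀ ζ : ℝ → ℝ, IsTestFunction 0 T ζ →
      ∫ t in Ioo 0 T, deriv ζ t • d j t = - ∫ t in Ioo 0 T, ζ t • d (j + 1) t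

/-- `f ∈ W^{k,p}(0, T; H²(0, L))`, for a curve `f` in `H¹(0, L)`. -/
def MemTimeSobolevH2 {L : ℝ} (T : ℝ) (k : ℕ) (p : ℝ≥0∞) (f : ℝ → H1 L) : Prop :=
  ∃ g : ℝ → H2 L, (∀ᵐ t ∂(volume.restrict (Ioo 0 T)), (g t).toH1 = f t) ∧
    MemTimeSobolev T k p g

/-- `f ∈ H³(0,T;L²(0,L)) ∩ H²(0,T;H¹(0,L)) ∩ W^{1,∞}(0,T;H²(0,L))`. -/
structure IsRegularCurve {L : ℝ} (T : ℝ) (f : ℝ → H10 L) : Prop where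
  h3L2 : MemTimeSobolev T 3 2 (fun t => fn (f t : H1 L))
  h2H1 : MemTimeSobolev T 2 2 (fun t => (f t : H1 L))
  w1H2 : MemTimeSobolevH2 T 1 ∞ (fun t => (f t : H1 L))

/-! ### The continuous problem -/

/-- The coefficients of the system; `lam` stands for `λ`. -/
structure Coeffs where
  (ρ α lam μ ρ₁ K γ β b ρ₃ δ κ : ℝ)

/-- All coefficients are positive, except that `β` may be any non-zero number. -/
structure Coeffs.Admissible (c : Coeffs) : Prop where
  ρ_pos : 0 < c.ρ
  α_pos : 0 < c.α
  lam_pos : 0 < c.lam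
  μ_pos : 0 < c.μ
  ρ₁_pos : 0 < c.ρ₁
  K_pos : 0 < c.K
  γ_pos : 0 < c.γ
  β_ne : c.β ≠ 0
  b_pos : 0 < c.b
  ρ₃_pos : 0 < c.ρ₃
  δ_pos : 0 < c.δ
  κ_pos : 0 < c.κ

/-- The initial data `u₀, u₁, φ₀, φ₁, ψ₀, w₀, w₁`. -/
structure InitialData (L : ℝ) where
  (u₀ u₁ φ₀ φ₁ ψ₀ w₀ w₁ : H10 L)

/-- `f ∈ C([0,T], H¹₀(0,L)) ∩ C¹([0,T], L²(0,L))`, with time derivative `g = f_t`. -/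
structure IsC1Curve {L : ℝ} (T : ℝ) (f : ℝ → H10 L) (g : ℝ → L2 L) : Prop where
  cont : ContinuousOn f (Icc 0 T)
  hasDeriv : ∀ t ∈ Icc 0 T, HasDerivWithinAt (fun s => fn (f s : H1 L)) (g t) (Icc 0 T) t
  cont_deriv : ContinuousOn g (Icc 0 T)

/-- `(u, φ, ψ, w)` is a weak solution on `[0, T]`, with velocities `ξ = u_t`, `Φ = φ_t`,
`ϑ = w_t`, of
`ρ u_tt - α u_xx - λ(φ - u) + μ u_t = 0`,
`ρ₁ φ_tt - K(φ_x + ψ)_x + λ(φ - u) + γ φ_t + β w_xt = 0`,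
`-b ψ_xx + K(φ_x + ψ) = 0`,
`ρ₃ w_tt - δ w_xx + β φ_xt - κ w_xxt = 0`
with homogeneous Dirichlet conditions and the initial data `I`. Each equation is tested with
`v ∈ H¹₀(0, L)` and integrated by parts in `x`, and the terms that carry a time derivative of
`u_t, φ_t, w_t, φ_x` or `w_x` are written as one derivative `d/dt` of a scalar function. -/
structure IsWeakSolution {L : ℝ} (c : Coeffs) (T : ℝ) (I : InitialData L)
    (u φ ψ w : ℝ → H10 L) (ξ Φ ϑ : ℝ → L2 L) : Prop where
  curve_u : IsC1Curve T u ξ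
  curve_φ : IsC1Curve T φ Φ
  curve_ψ : ContinuousOn ψ (Icc 0 T)
  curve_w : IsC1Curve T w ϑ
  eq_u : ∀ v : H10 L, ∀ t ∈ Icc 0 T,
    HasDerivWithinAt (fun s => c.ρ * inner ℝ (ξ s) (fn v.1))
      (-(c.α * inner ℝ (dx (u t).1) (dx v.1)
        - c.lam * inner ℝ (fn (φ t).1 - fn (u t).1) (fn v.1)
        + c.μ * inner ℝ (ξ t) (fn v.1))) (Icc 0 T) t
  eq_φ : ∀ v : H10 L, ∀ t ∈ Icc 0 T,
    HasDerivWithinAt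
      (fun s => c.ρ₁ * inner ℝ (Φ s) (fn v.1) + c.β * inner ℝ (dx (w s).1) (fn v.1))
      (-(c.K * inner ℝ (dx (φ t).1 + fn (ψ t).1) (dx v.1)
        + c.lam * inner ℝ (fn (φ t).1 - fn (u t).1) (fn v.1)
        + c.γ * inner ℝ (Φ t) (fn v.1))) (Icc 0 T) t
  eq_ψ : ∀ v : H10 L, ∀ t ∈ Icc 0 T,
    c.b * inner ℝ (dx (ψ t).1) (dx v.1)
      + c.K * inner ℝ (dx (φ t).1 + fn (ψ t).1) (fn v.1) = 0
  eq_w : ∀ v : H10 L, ∀ t ∈ Icc 0 T,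
    HasDerivWithinAt
      (fun s => c.ρ₃ * inner ℝ (ϑ s) (fn v.1) + c.β * inner ℝ (dx (φ s).1) (fn v.1)
        + c.κ * inner ℝ (dx (w s).1) (dx v.1))
      (-(c.δ * inner ℝ (dx (w t).1) (dx v.1))) (Icc 0 T) t
  init_u : u 0 = I.u₀
  init_ξ : ξ 0 = fn I.u₁.1
  init_φ : φ 0 = I.φ₀
  init_Φ : Φ 0 = fn I.φ₁.1
  init_ψ : ψ 0 = I.ψ₀
  init_w : w 0 = I.w₀
  init_ϑ : ϑ 0 = fn I.w₁.1

/-! ### The fully discrete problem -/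

/-- `v ∈ S_h`: `v ∈ H¹₀(0, L)` is affine on each cell `(x_i, x_{i+1})` of the uniform partition
`x_i = i h`, `h = L / M`, of `[0, L]` into `M` cells. -/
def InFE {L : ℝ} (M : ℕ) (v : H10 L) : Prop :=
  ∀ i < M, ∃ p q : ℝ,
    ∀ᵐ x ∂(volume.restrict (Ioo (i * (L / M)) ((i + 1) * (L / M)))), fn v.1 x = p + q * x

/-- `p = P_h η`: `p ∈ S_h` and `((p - η)_x, χ_x) = 0` for all `χ ∈ S_h`. -/
def IsProj {L : ℝ} (M : ℕ) (η p : H10 L) : Prop :=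
  InFE M p ∧ ∀ χ : H10 L, InFE M χ → inner ℝ (dx (p - η).1) (dx χ.1) = 0

/-- `(u_h^n, φ_h^n, ψ_h^n, w_h^n)`, with the discrete velocities `ξ_h^n, Φ_h^n, ϑ_h^n`, for
`n = 0, …, N`, is the solution of the backward Euler finite element scheme with `M` cells, step
`τ = Δt` and initial data `I`. -/
structure IsDiscreteSolution {L : ℝ} (c : Coeffs) (I : InitialData L) (M N : ℕ) (τ : ℝ)
    (u φ ψ w ξ Φ ϑ : ℕ → H10 L) : Prop where
  init_u : IsProj M I.u₀ (u 0)
  init_ξ : IsProj M I.u₁ (ξ 0)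
  init_φ : IsProj M I.φ₀ (φ 0)
  init_Φ : IsProj M I.φ₁ (Φ 0)
  init_ψ : IsProj M I.ψ₀ (ψ 0)
  init_w : IsProj M I.w₀ (w 0)
  init_ϑ : IsProj M I.w₁ (ϑ 0)
  mem_ξ : ∀ n < N, InFE M (ξ (n + 1))
  mem_Φ : ∀ n < N, InFE M (Φ (n + 1))
  mem_ψ : ∀ n < N, InFE M (ψ (n + 1))
  mem_ϑ : ∀ n < N, InFE M (ϑ (n + 1))
  step_u : ∀ n < N, u (n + 1) = u n + τ • ξ (n + 1)
  step_φ : ∀ n < N, φ (n + 1) = φ n + τ • Φ (n + 1)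
  step_w : ∀ n < N, w (n + 1) = w n + τ • ϑ (n + 1)
  eq_u : ∀ n < N, ∀ v : H10 L, InFE M v →
    c.ρ / τ * inner ℝ (fn (ξ (n + 1)).1 - fn (ξ n).1) (fn v.1)
      + c.α * inner ℝ (dx (u (n + 1)).1) (dx v.1)
      - c.lam * inner ℝ (fn (φ (n + 1)).1 - fn (u (n + 1)).1) (fn v.1)
      + c.μ * inner ℝ (fn (ξ (n + 1)).1) (fn v.1) = 0
  eq_φ : ∀ n < N, ∀ v : H10 L, InFE M v →
    c.ρ₁ / τ * inner ℝ (fn (Φ (n + 1)).1 - fn (Φ n).1) (fn v.1)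
      + c.K * inner ℝ (dx (φ (n + 1)).1 + fn (ψ (n + 1)).1) (dx v.1)
      + c.lam * inner ℝ (fn (φ (n + 1)).1 - fn (u (n + 1)).1) (fn v.1)
      + c.γ * inner ℝ (fn (Φ (n + 1)).1) (fn v.1)
      + c.β * inner ℝ (dx (ϑ (n + 1)).1) (fn v.1) = 0
  eq_ψ : ∀ n < N, ∀ v : H10 L, InFE M v →
    c.b * inner ℝ (dx (ψ (n + 1)).1) (dx v.1)
      + c.K * inner ℝ (dx (φ (n + 1)).1 + fn (ψ (n + 1)).1) (fn v.1) = 0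
  eq_w : ∀ n < N, ∀ v : H10 L, InFE M v →
    c.ρ₃ / τ * inner ℝ (fn (ϑ (n + 1)).1 - fn (ϑ n).1) (fn v.1)
      + c.δ * inner ℝ (dx (w (n + 1)).1) (dx v.1)
      + c.β * inner ℝ (dx (Φ (n + 1)).1) (fn v.1)
      + c.κ * inner ℝ (dx (ϑ (n + 1)).1) (dx v.1) = 0

/-- The squared error at one time level between discrete values `(uh, φh, ψh, wh, ξh, Φh, ϑh)` and
exact values `(u, φ, ψ, w, ξ, Φ, ϑ)`, the exact velocities being elements of `L²(0, L)`. -/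
def sqError {L : ℝ} (uh φh ψh wh ξh Φh ϑh : H10 L) (u φ ψ w : H10 L) (ξ Φ ϑ : L2 L) : ℝ :=
  ‖fn ξh.1 - ξ‖ ^ 2 + ‖dx uh.1 - dx u.1‖ ^ 2
    + ‖fn φh.1 - fn uh.1 - (fn φ.1 - fn u.1)‖ ^ 2
    + ‖fn Φh.1 - Φ‖ ^ 2
    + ‖dx φh.1 + fn ψh.1 - (dx φ.1 + fn ψ.1)‖ ^ 2
    + ‖dx ψh.1 - dx ψ.1‖ ^ 2
    + ‖fn ϑh.1 - ϑ‖ ^ 2 + ‖dx wh.1 - dx w.1‖ ^ 2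

end ShearBeam

end

open ShearBeam

/-! Split every error as (discrete value − Ritz projection) + (Ritz projection − exact value). In
one dimension the Ritz projection is the L² projection of `η_x` onto functions constant on each
cell, and it interpolates `η` at the nodes. Hence `‖P_h η − η‖ ≤ h ‖η_x‖` and `‖(P_h η − η)_x‖ ≤ h
‖η_xx‖`, which controls the second part.

In time, a single `m ∈ L²(0,T)` dominates the increments of `u, φ, ψ, w` in H² and those of the
velocities in H¹ (`exists_isSmoothSolution`). On a step of length `τ`, with `a = ∫ m` over the step,
the weak equations have the form `G' = −F` with `G` scalar, so replacing `G'` by the backward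
difference quotient costs only the oscillation of `F`. Integrating by parts in `x`, that oscillation
is at most a constant times `a ‖v‖`. Together with the projection errors, the residuals have size `s
= a + h a / τ + h`, and Cauchy–Schwarz gives `∑ τ s² ≤ C (h² + τ²)` (`sum_stepSize_sq_le`).

For the first part (discrete − Ritz), test the three evolution equations with the discrete velocity
errors and the `ψ` equation with the increment of its error (`energy_step_le`). The two `β` terms
cancel, and the dampings `μ, γ, κ` absorb the residuals. The `ψ` equation has no damping, so its
residual `R` is summed by parts: `K (R, e_ψ)` joins the energy as a perturbation of size at most
`E/2 + C h²`, and only increments of `R` remain, of order `h a ≤ τ s`. The defect of the difference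
quotient is charged to the old time level, so no smallness of `τ` is needed in the Gronwall argument
(`energy_le_exp`). The initial energy is zero because the scheme starts from Ritz projections. -/

noncomputable section

namespace ShearBeam

/-! ### Weak derivatives on an interval and primitives. -/

section Primitives

variable {B : Type*} [NormedAddCommGroup B] [NormedSpace ℝ B] [CompleteSpace B]

/-- Fubini on the triangle `0 < s < t < T`. It replaces integration by parts where neither factor is
differentiable in the classical sense. -/
theorem integral_smul_primitive {T : ℝ} {p : ℝ → ℝ} {q : ℝ → B}
    (hp : IntegrableOn p (Ioo 0 T)) (hq : IntegrableOn q (Ioo 0 T)) :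
    ∫ t in Ioo 0 T, p t • (∫ s in (0 : ℝ)..t, q s)
      = ∫ s in Ioo 0 T, (∫ t in s..T, p t) • q s := by
  have hint : Integrable (fun z : ℝ × ℝ => {z : ℝ × ℝ | z.2 < z.1}.indicator
      (fun z => p z.1 • q z.2) z)
      ((volume.restrict (Ioo 0 T)).prod (volume.restrict (Ioo 0 T))) :=
    (hp.smul_prod hq).indicator (measurableSet_lt measurable_snd measurable_fst)
  have hswap := integral_integral_swap
    (f := fun t s => {z : ℝ × ℝ | z.2 < z.1}.indicator (fun z => p z.1 • q z.2) (t, s)) hint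
  calc _ = ∫ t in Ioo 0 T, ∫ s in Ioo 0 T,
        {z : ℝ × ℝ | z.2 < z.1}.indicator (fun z => p z.1 • q z.2) (t, s) := by
        refine setIntegral_congr_fun measurableSet_Ioo fun t ht => ?_
        have : (fun s => {z : ℝ × ℝ | z.2 < z.1}.indicator (fun z => p z.1 • q z.2) (t, s))
            = (Iio t).indicator (fun s => p t • q s) := by
          ext s; simp [indicator]
        simp only [this]
        rw [setIntegral_indicator measurableSet_Iio, Ioo_inter_Iio, min_eq_right ht.2.le,
          integral_smul, intervalIntegral.integral_of_le ht.1.le, integral_Ioc_eq_integral_Ioo]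
    _ = _ := hswap
    _ = _ := by
        refine setIntegral_congr_fun measurableSet_Ioo fun s hs => ?_
        have : (fun t => {z : ℝ × ℝ | z.2 < z.1}.indicator (fun z => p z.1 • q z.2) (t, s))
            = (Ioi s).indicator (fun t => p t • q s) := by
          ext t; simp [indicator]
        simp only [this]
        rw [setIntegral_indicator measurableSet_Ioi, Ioo_inter_Ioi, max_eq_right hs.1.le,
          integral_smul_const, intervalIntegral.integral_of_le hs.2.le,
          integral_Ioc_eq_integral_Ioo]

theorem IsTestFunction.eq_zero_of_le {T : ℝ} {ζ : ℝ → ℝ} (hζ : IsTestFunction 0 T ζ) {x : ℝ}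
    (hx : x ≤ 0 ∨ T ≤ x) : ζ x = 0 := by
  refine image_eq_zero_of_notMem_tsupport fun h => ?_
  have := hζ.support h
  rcases hx with hx | hx
  · exact absurd this.1 (not_lt.2 hx)
  · exact absurd this.2 (not_lt.2 hx)

theorem IsTestFunction.integral_deriv {T : ℝ} {ζ : ℝ → ℝ} (hζ : IsTestFunction 0 T ζ) (s : ℝ) :
    ∫ t in s..T, deriv ζ t = -ζ s := by
  rw [intervalIntegral.integral_deriv_eq_sub'  _ rfl
    (fun x _ => (hζ.smooth.differentiable (by simp)).differentiableAt)
    (hζ.smooth.continuous_deriv (by simp)).continuousOn, hζ.eq_zero_of_le (Or.inr le_rfl)]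
  simp

theorem IsTestFunction.integral_deriv_smul_primitive {T : ℝ} {ζ : ℝ → ℝ}
    (hζ : IsTestFunction 0 T ζ) {q : ℝ → B} (hq : IntegrableOn q (Ioo 0 T)) :
    ∫ t in Ioo 0 T, deriv ζ t • (∫ s in (0 : ℝ)..t, q s) = -∫ s in Ioo 0 T, ζ s • q s := by
  have hd : Continuous (deriv ζ) := hζ.smooth.continuous_deriv (by simp)
  rw [integral_smul_primitive ((hd.integrableOn_Icc (a := 0) (b := T)).mono_set Ioo_subset_Icc_self)
    hq, ← integral_neg]
  simp [hζ.integral_deriv]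

theorem exists_isTestFunction_integral_eq_one {T : ℝ} (hT : 0 < T) :
    ∃ η, IsTestFunction 0 T η ∧ ∫ t in Ioo 0 T, η t = 1 := by
  let f : ContDiffBump (T / 2 : ℝ) := ⟨T / 8, T / 4, by positivity, by linarith⟩
  have hsub : Metric.closedBall (T / 2) (T / 4) ⊆ Ioo 0 T := by
    rw [Real.closedBall_eq_Icc]
    exact Icc_subset_Ioo (by linarith) (by linarith)
  have hts : tsupport (f.normed volume) ⊆ Ioo 0 T := by
    rw [f.tsupport_normed_eq]; exact hsub
  refine ⟨f.normed volume, ⟨f.contDiff_normed, f.hasCompactSupport_normed, hts⟩, ?_⟩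
  rw [setIntegral_eq_integral_of_forall_compl_eq_zero, f.integral_normed]
  intro x hx
  exact image_eq_zero_of_notMem_tsupport fun h => hx (hts h)

/-- Zero mean makes the primitive vanish to the right of the support as well as to its left, so it
is again compactly supported. Thus the test functions of mean zero are exactly derivatives of test
functions, which is what the du Bois-Reymond lemma needs. -/
theorem isTestFunction_primitive {T : ℝ} {ζ : ℝ → ℝ} (hT : 0 < T) (hζ : IsTestFunction 0 T ζ)
    (h0 : ∫ t in Ioo 0 T, ζ t = 0) :
    IsTestFunction 0 T (fun t => ∫ s in (0 : ℝ)..t, ζ s) ∧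
      deriv (fun t => ∫ s in (0 : ℝ)..t, ζ s) = ζ := by
  have hder : ∀ t, HasDerivAt (fun t => ∫ s in (0 : ℝ)..t, ζ s) (ζ t) t := fun t =>
    intervalIntegral.integral_hasDerivAt_right (hζ.smooth.continuous.intervalIntegrable _ _)
      (hζ.smooth.continuous.stronglyMeasurableAtFilter _ _) hζ.smooth.continuous.continuousAt
  have hd : deriv (fun t => ∫ s in (0 : ℝ)..t, ζ s) = ζ := funext fun t => (hder t).deriv
  have hsm : ContDiff ℝ ∞ (fun t => ∫ s in (0 : ℝ)..t, ζ s) := by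
    rw [contDiff_infty_iff_deriv, hd]
    exact ⟨fun t => (hder t).differentiableAt, hζ.smooth⟩
  have hint : ∀ a b : ℝ, IntervalIntegrable ζ volume a b :=
    fun a b => hζ.smooth.continuous.intervalIntegrable a b
  -- A compact interval strictly inside `(0, T)` off which `ζ` vanishes: the hull of the support, or
  -- the midpoint if the support is empty.
  obtain ⟨a, b, ha, hb, hab⟩ : ∃ a b : ℝ, 0 < a ∧ b < T ∧ ∀ x, x ∉ Icc a b → ζ x = 0 := by
    rcases (tsupport ζ).eq_empty_or_nonempty with he | hne
    · refine ⟨T / 2, T / 2, by linarith, by linarith, fun x _ => ?_⟩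
      exact image_eq_zero_of_notMem_tsupport (by simp [he])
    · have hc : IsCompact (tsupport ζ) := hζ.compact
      refine ⟨sInf (tsupport ζ), sSup (tsupport ζ), (hζ.support (hc.sInf_mem hne)).1,
        (hζ.support (hc.sSup_mem hne)).2, fun x hx => ?_⟩
      exact image_eq_zero_of_notMem_tsupport fun h =>
        hx ⟨csInf_le hc.bddBelow h, le_csSup hc.bddAbove h⟩
  have hT0 : ∫ s in (0 : ℝ)..T, ζ s = 0 := by
    rw [intervalIntegral.integral_of_le hT.le, integral_Ioc_eq_integral_Ioo, h0]
  have hzero : ∀ x, x ∉ Icc a b → ∫ s in (0 : ℝ)..x, ζ s = 0 := by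
    intro x hx
    rcases not_and_or.1 hx with h | h
    · push Not at h
      rw [intervalIntegral.integral_congr (g := fun _ => (0 : ℝ)), intervalIntegral.integral_zero]
      intro y hy
      refine hab y fun h' => ?_
      rcases mem_uIcc.1 hy with hy | hy <;> linarith [h'.1, hy.1, hy.2]
    · push Not at h
      rw [← intervalIntegral.integral_add_adjacent_intervals (hint 0 T) (hint T x), hT0, zero_add,
        intervalIntegral.integral_congr (g := fun _ => (0 : ℝ)), intervalIntegral.integral_zero]
      intro y hy
      refine hab y fun h' => ?_
      rcases mem_uIcc.1 hy with hy | hy <;> linarith [h'.2, hy.1, hy.2]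
  have hts : tsupport (fun t => ∫ s in (0 : ℝ)..t, ζ s) ⊆ Icc a b :=
    closure_minimal (fun x hx => by_contra fun h => hx (hzero x h)) isClosed_Icc
  exact ⟨⟨hsm, HasCompactSupport.of_support_subset_isCompact isCompact_Icc
    ((subset_tsupport _).trans hts), hts.trans (Icc_subset_Ioo ha hb)⟩, hd⟩

theorem ae_eq_zero_of_forall_isTestFunction {T : ℝ} {f : ℝ → B}
    (hf : IntegrableOn f (Ioo 0 T))
    (h : ∀ ζ, IsTestFunction 0 T ζ → ∫ t in Ioo 0 T, ζ t • f t = 0) :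
    ∀ᵐ t ∂(volume.restrict (Ioo 0 T)), f t = 0 := by
  rw [ae_restrict_iff' measurableSet_Ioo]
  refine isOpen_Ioo.ae_eq_zero_of_integral_contDiff_smul_eq_zero hf.locallyIntegrableOn ?_
  intro g hg hc hs
  rw [← h g ⟨hg, hc, hs⟩, setIntegral_eq_integral_of_forall_compl_eq_zero]
  intro x hx
  rw [image_eq_zero_of_notMem_tsupport fun h => hx (hs h), zero_smul]

theorem integrableOn_continuous_smul {E : Type*} [NormedAddCommGroup E] [NormedSpace ℝ E] {T : ℝ}
    {ζ : ℝ → ℝ} (hc : Continuous ζ) {f : ℝ → E}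
    (hf : IntegrableOn f (Ioo 0 T)) : IntegrableOn (fun t => ζ t • f t) (Ioo 0 T) := by
  obtain ⟨C, hC⟩ := isCompact_Icc.exists_bound_of_continuousOn
    (hc.continuousOn (s := Icc 0 T))
  exact Integrable.bdd_smul hf C hc.aestronglyMeasurable
    ((ae_restrict_iff' measurableSet_Ioo).2
      (Filter.Eventually.of_forall fun x hx => hC x (Ioo_subset_Icc_self hx)))

/-- The lemma of du Bois-Reymond. -/
theorem ae_eq_const_of_forall_integral_deriv_smul_eq_zero {T : ℝ} (hT : 0 < T)
    {f : ℝ → B} (hf : IntegrableOn f (Ioo 0 T))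
    (h : ∀ ζ, IsTestFunction 0 T ζ → ∫ t in Ioo 0 T, deriv ζ t • f t = 0) :
    ∃ c : B, ∀ᵐ t ∂(volume.restrict (Ioo 0 T)), f t = c := by
  obtain ⟨η, hη, hη1⟩ := exists_isTestFunction_integral_eq_one hT
  refine ⟨∫ t in Ioo 0 T, η t • f t, ?_⟩
  set c := ∫ t in Ioo 0 T, η t • f t with hc
  have hcint : IntegrableOn (fun _ : ℝ => c) (Ioo 0 T) := by simp
  have key := ae_eq_zero_of_forall_isTestFunction (hf.sub hcint) (fun χ hχ => ?_)
  · filter_upwards [key] with t ht using sub_eq_zero.1 ht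
  set m := ∫ t in Ioo 0 T, χ t with hm
  have hχi : IntegrableOn χ (Ioo 0 T) :=
    hχ.smooth.continuous.integrableOn_Icc.mono_set Ioo_subset_Icc_self
  have hηi : IntegrableOn η (Ioo 0 T) :=
    hη.smooth.continuous.integrableOn_Icc.mono_set Ioo_subset_Icc_self
  -- Subtracting the multiple `m η` gives `χ` mean zero, so the hypothesis applies to the primitive
  -- of the difference.
  have htest : IsTestFunction 0 T (fun t => χ t - m * η t) := by
    refine ⟨hχ.smooth.sub (contDiff_const.mul hη.smooth),
      hχ.compact.sub (hη.compact.mul_left), ?_⟩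
    refine (tsupport_sub _ _).trans (union_subset hχ.support ?_)
    exact (closure_mono (Function.support_mul_subset_right _ _)).trans hη.support
  have hz : ∫ t in Ioo 0 T, (χ t - m * η t) = 0 := by
    rw [integral_sub hχi (hηi.const_mul m), integral_const_mul, hη1]; simp [hm]
  obtain ⟨h1, h2⟩ := isTestFunction_primitive hT htest hz
  have h3 := h _ h1
  rw [h2] at h3
  have e1 : ∀ t, (χ t - m * η t) • f t = χ t • f t - m • (η t • f t) := fun t => by
    rw [sub_smul, mul_smul]
  simp only [e1] at h3
  rw [integral_sub (integrableOn_continuous_smul hχ.smooth.continuous hf)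
    (Integrable.fun_smul m (integrableOn_continuous_smul hη.smooth.continuous hf)),
    integral_smul, ← hc] at h3
  simp only [Pi.sub_apply, smul_sub]
  rw [integral_sub (integrableOn_continuous_smul hχ.smooth.continuous hf)
    (hχi.smul_const c), integral_smul_const]
  exact h3

theorem ae_eq_const_add_primitive {T : ℝ} (hT : 0 < T)
    {f g : ℝ → B} (hf : IntegrableOn f (Ioo 0 T)) (hg : IntegrableOn g (Ioo 0 T))
    (h : ∀ ζ, IsTestFunction 0 T ζ →
      ∫ t in Ioo 0 T, deriv ζ t • f t = -∫ t in Ioo 0 T, ζ t • g t) :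
    ∃ c : B, ∀ᵐ t ∂(volume.restrict (Ioo 0 T)), f t = c + ∫ s in (0 : ℝ)..t, g s := by
  have hG : IntegrableOn (fun t => ∫ s in (0 : ℝ)..t, g s) (Ioo 0 T) := by
    have : ContinuousOn (fun t => ∫ s in (0 : ℝ)..t, g s) (Icc 0 T) := by
      have := intervalIntegral.continuousOn_primitive_interval (μ := volume) (f := g) (a := 0)
        (b := T) (by rwa [uIcc_of_le hT.le, integrableOn_Icc_iff_integrableOn_Ioo])
      rwa [uIcc_of_le hT.le] at this
    exact (this.integrableOn_Icc).mono_set Ioo_subset_Icc_self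
  obtain ⟨c, hc⟩ := ae_eq_const_of_forall_integral_deriv_smul_eq_zero hT (hf.sub hG)
    (fun ζ hζ => by
      have hd : Continuous (deriv ζ) := hζ.smooth.continuous_deriv (by simp)
      simp only [Pi.sub_apply, smul_sub]
      rw [integral_sub (integrableOn_continuous_smul hd hf)
        (integrableOn_continuous_smul hd hG), h ζ hζ, hζ.integral_deriv_smul_primitive hg,
        sub_self])
  refine ⟨c, ?_⟩
  filter_upwards [hc] with t ht
  rw [← ht]; simp

end Primitives

/-- Cauchy–Schwarz, read off from expanding `∫ (l m − J)² ≥ 0`. -/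
theorem sq_integral_le {m : ℝ → ℝ} {s t : ℝ} (hst : s ≤ t)
    (hm : IntervalIntegrable m volume s t)
    (hm2 : IntervalIntegrable (fun x => m x ^ 2) volume s t) :
    (∫ x in s..t, m x) ^ 2 ≤ (t - s) * ∫ x in s..t, m x ^ 2 := by
  rcases hst.eq_or_lt with rfl | hlt
  · simp
  set J := ∫ x in s..t, m x with hJ
  set l := t - s with hl
  have hl0 : 0 < l := sub_pos.2 hlt
  have h0 : 0 ≤ ∫ x in s..t, (l * m x - J) ^ 2 :=
    intervalIntegral.integral_nonneg hst fun x _ => sq_nonneg _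
  have h1 : ∫ x in s..t, (l * m x - J) ^ 2
      = l ^ 2 * (∫ x in s..t, m x ^ 2) - 2 * l * J * J + J ^ 2 * l := by
    have : ∀ x, (l * m x - J) ^ 2 = l ^ 2 * m x ^ 2 - 2 * l * J * m x + J ^ 2 := fun x => by ring
    simp only [this]
    rw [intervalIntegral.integral_add ((hm2.const_mul _).sub (hm.const_mul _)) (by simp),
      intervalIntegral.integral_sub (hm2.const_mul _) (hm.const_mul _),
      intervalIntegral.integral_const_mul, intervalIntegral.integral_const_mul,
      intervalIntegral.integral_const, smul_eq_mul, ← hJ, ← hl]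
    ring
  rw [h1] at h0
  have : 0 ≤ l * (l * (∫ x in s..t, m x ^ 2) - J ^ 2) := by linarith
  linarith [nonneg_of_mul_nonneg_right this hl0]

/-! ### Integral estimates in `L²(0, L)`. -/

section L2

variable {L : ℝ}

theorem inner_eq_integral (f g : L2 L) : inner ℝ f g = ∫ x in Ioo 0 L, f x * g x := by
  rw [L2.inner_def]
  simp [mul_comm]

theorem norm_sq_eq_integral (f : L2 L) : ‖f‖ ^ 2 = ∫ x in Ioo 0 L, f x ^ 2 := by
  rw [← real_inner_self_eq_norm_sq, inner_eq_integral]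
  simp [sq]

theorem integrableOn_coe (f : L2 L) : IntegrableOn f (Ioo 0 L) :=
  (Lp.memLp f).integrable one_le_two

theorem integrableOn_sq (f : L2 L) : IntegrableOn (fun x => f x ^ 2) (Ioo 0 L) :=
  (Lp.memLp f).integrable_sq

theorem intervalIntegrable_of_Ioo {E : Type*} [NormedAddCommGroup E] {f : ℝ → E} {a b : ℝ}
    (hf : IntegrableOn f (Ioo 0 L)) (ha : 0 ≤ a) (hab : a ≤ b) (hb : b ≤ L) :
    IntervalIntegrable f volume a b := by
  rw [intervalIntegrable_iff_integrableOn_Ioo_of_le hab]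
  exact hf.mono_set (Ioo_subset_Ioo ha hb)

theorem continuousOn_primitive_of_Ioo {E : Type*} [NormedAddCommGroup E] [NormedSpace ℝ E]
    {f : ℝ → E} (hL : 0 ≤ L) (hf : IntegrableOn f (Ioo 0 L)) :
    ContinuousOn (fun x => ∫ s in (0 : ℝ)..x, f s) (Icc 0 L) := by
  have := intervalIntegral.continuousOn_primitive_interval (μ := volume) (f := f) (a := 0)
    (b := L) (by rwa [uIcc_of_le hL, integrableOn_Icc_iff_integrableOn_Ioo])
  rwa [uIcc_of_le hL] at this

theorem integral_Ioo_eq {E : Type*} [NormedAddCommGroup E] [NormedSpace ℝ E] {f : ℝ → E} {a b : ℝ}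
    (hab : a ≤ b) : ∫ x in Ioo a b, f x = ∫ x in a..b, f x := by
  rw [intervalIntegral.integral_of_le hab, integral_Ioc_eq_integral_Ioo]

theorem memLp_primitive (hL : 0 ≤ L) (c : ℝ) (q : L2 L) :
    MemLp (fun x => c + ∫ s in (0 : ℝ)..x, q s) 2 (vol L) := by
  have hc : ContinuousOn (fun x => c + ∫ s in (0 : ℝ)..x, q s) (Icc 0 L) :=
    continuousOn_const.add (continuousOn_primitive_of_Ioo hL (integrableOn_coe q))
  obtain ⟨C, hC⟩ := isCompact_Icc.exists_bound_of_continuousOn hc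
  refine MemLp.of_bound ((hc.mono Ioo_subset_Icc_self).aestronglyMeasurable measurableSet_Ioo) C ?_
  exact (ae_restrict_iff' measurableSet_Ioo).2
    (Filter.Eventually.of_forall fun x hx => hC x (Ioo_subset_Icc_self hx))

/-- If `f(x)` is the integral of `p` over an interval of length at most `h` ending at `x`, then
`‖f‖ ≤ h ‖p‖`. -/
theorem norm_le_of_ae_eq_integral {h : ℝ} (hh : 0 ≤ h) (f p : L2 L) (a : ℝ → ℝ)
    (ha : ∀ x ∈ Ioo 0 L, 0 ≤ a x ∧ x - h ≤ a x ∧ a x ≤ x)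
    (hf : ∀ᵐ x ∂(vol L), f x = ∫ s in (a x)..x, p s) : ‖f‖ ≤ h * ‖p‖ := by
  -- The strip `x − h < y < x`. Cauchy–Schwarz bounds `f(x)²` by `h` times the integral of `p²` over
  -- the slice at `x`. After exchanging the order of integration, each `y` lies in the slices of a
  -- set of `x` of length at most `h`, which yields the second factor `h`.
  have hS : MeasurableSet {z : ℝ × ℝ | z.1 - h < z.2 ∧ z.2 < z.1} := by
    convert (measurableSet_lt (measurable_fst.sub_const h) measurable_snd).inter
      (measurableSet_lt (measurable_snd (α := ℝ) (β := ℝ)) measurable_fst) using 1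
    ext z; simp
  set S := {z : ℝ × ℝ | z.1 - h < z.2 ∧ z.2 < z.1} with hSdef
  have hprod : Integrable (fun z : ℝ × ℝ => S.indicator (fun z => p z.2 ^ 2) z)
      ((volume.restrict (Ioo 0 L)).prod (volume.restrict (Ioo 0 L))) :=
    (Integrable.comp_snd (integrableOn_sq p) _).indicator hS
  have hin : ∀ x, (∫ y in Ioo 0 L, S.indicator (fun z => p z.2 ^ 2) (x, y))
      = ∫ y in Ioo 0 L ∩ Ioo (x - h) x, p y ^ 2 := by
    intro x
    have : (fun y => S.indicator (fun z => p z.2 ^ 2) (x, y))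
        = (Ioo (x - h) x).indicator (fun y => p y ^ 2) := by
      ext y; simp [indicator, hSdef, mem_Ioo]
    rw [this, setIntegral_indicator measurableSet_Ioo]
  have hpt : ∀ᵐ x ∂(vol L), f x ^ 2
      ≤ h * ∫ y in Ioo 0 L, S.indicator (fun z => p z.2 ^ 2) (x, y) := by
    filter_upwards [hf, ae_restrict_mem measurableSet_Ioo] with x hx hxm
    obtain ⟨h0, h1, h2⟩ := ha x hxm
    rw [hx, hin x]
    have hJ : ∫ s in (a x)..x, p s ^ 2 ≤ ∫ y in Ioo 0 L ∩ Ioo (x - h) x, p y ^ 2 := by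
      rw [← integral_Ioo_eq h2]
      refine setIntegral_mono_set ((integrableOn_sq p).mono_set inter_subset_left)
        (Filter.Eventually.of_forall fun y => sq_nonneg _) (LE.le.eventuallyLE ?_)
      exact subset_inter (Ioo_subset_Ioo h0 hxm.2.le) (Ioo_subset_Ioo h1 le_rfl)
    have hJ0 : 0 ≤ ∫ s in (a x)..x, p s ^ 2 :=
      intervalIntegral.integral_nonneg h2 fun y _ => sq_nonneg _
    calc _ ≤ (x - a x) * ∫ s in (a x)..x, p s ^ 2 :=
          sq_integral_le h2 (intervalIntegrable_of_Ioo (integrableOn_coe p) h0 h2 hxm.2.le)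
            (intervalIntegrable_of_Ioo (integrableOn_sq p) h0 h2 hxm.2.le)
      _ ≤ h * ∫ s in (a x)..x, p s ^ 2 := by gcongr; linarith
      _ ≤ _ := by gcongr
  have h1 : ‖f‖ ^ 2 ≤ h * ∫ x in Ioo 0 L, ∫ y in Ioo 0 L,
      S.indicator (fun z => p z.2 ^ 2) (x, y) := by
    rw [norm_sq_eq_integral, ← integral_const_mul]
    exact integral_mono_ae (integrableOn_sq f) (hprod.integral_prod_left.const_mul h) hpt
  rw [integral_integral_swap (f := fun x y => S.indicator (fun z => p z.2 ^ 2) (x, y)) hprod] at h1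
  have h2 : ∫ y in Ioo 0 L, ∫ x in Ioo 0 L, S.indicator (fun z => p z.2 ^ 2) (x, y)
      ≤ ∫ y in Ioo 0 L, p y ^ 2 * h := by
    refine integral_mono hprod.integral_prod_right ((integrableOn_sq p).mul_const h) fun y => ?_
    have : (fun x => S.indicator (fun z => p z.2 ^ 2) (x, y))
        = (Ioo y (y + h)).indicator (fun _ => p y ^ 2) := by
      ext x; simp only [indicator, hSdef, mem_ofPred_eq, mem_Ioo]
      congr 1
      exact propext ⟨fun h => ⟨h.2, by linarith⟩, fun h => ⟨by linarith, h.1⟩⟩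
    simp only [this]
    rw [setIntegral_indicator measurableSet_Ioo, setIntegral_const, smul_eq_mul, mul_comm]
    refine mul_le_mul_of_nonneg_left ?_ (sq_nonneg _)
    calc volume.real (Ioo 0 L ∩ Ioo y (y + h)) ≤ volume.real (Ioo y (y + h)) :=
          measureReal_mono inter_subset_right (by simp)
      _ = h := by simp [hh]
  rw [integral_mul_const, ← norm_sq_eq_integral] at h2
  have h3 : ‖f‖ ^ 2 ≤ (h * ‖p‖) ^ 2 := by nlinarith
  exact le_of_sq_le_sq h3 (by positivity)

end L2

/-! ### `H¹` and `H¹₀` on an interval: boundary values and integration by parts. -/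

section H1

variable {L : ℝ}

theorem dx_add (v w : H1 L) : dx (v + w) = dx v + dx w := rfl
theorem dx_smul (c : ℝ) (v : H1 L) : dx (c • v) = c • dx v := rfl
theorem fn_add (v w : H1 L) : fn (v + w) = fn v + fn w := rfl
theorem fn_smul (c : ℝ) (v : H1 L) : fn (c • v) = c • fn v := rfl

theorem norm_sq_H1 (v : H1 L) : ‖v‖ ^ 2 = ‖fn v‖ ^ 2 + ‖dx v‖ ^ 2 :=
  WithLp.prod_norm_sq_eq_of_L2 v.1

theorem norm_fn_le (v : H1 L) : ‖fn v‖ ≤ ‖v‖ :=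
  le_of_sq_le_sq (by rw [norm_sq_H1]; nlinarith [sq_nonneg ‖dx v‖]) (norm_nonneg _)

theorem norm_dx_le (v : H1 L) : ‖dx v‖ ≤ ‖v‖ :=
  le_of_sq_le_sq (by rw [norm_sq_H1]; nlinarith [sq_nonneg ‖fn v‖]) (norm_nonneg _)

theorem H1_ext {v w : H1 L} (h0 : fn v = fn w) (h1 : dx v = dx w) : v = w :=
  Subtype.ext ((WithLp.equiv 2 _).injective (Prod.ext h0 h1))

theorem IsWeakDeriv.exists_ae_eq_primitive (hL : 0 < L) {f g : L2 L} (h : IsWeakDeriv f g) :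
    ∃ c : ℝ, ∀ᵐ x ∂(vol L), f x = c + ∫ s in (0 : ℝ)..x, g s := by
  refine ae_eq_const_add_primitive hL (integrableOn_coe f) (integrableOn_coe g) fun ζ hζ => ?_
  have := h ζ hζ
  simpa only [smul_eq_mul, mul_comm] using this

theorem exists_H1_of_deriv (hL : 0 < L) (c : ℝ) (q : L2 L) :
    ∃ v : H1 L, dx v = q ∧ ∀ᵐ x ∂(vol L), fn v x = c + ∫ s in (0 : ℝ)..x, q s := by
  have hm := memLp_primitive hL.le c q
  have hae := hm.coeFn_toLp
  refine ⟨⟨WithLp.toLp 2 (hm.toLp _, q), ?_⟩, rfl, hae⟩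
  intro ζ hζ
  have hd : Continuous (deriv ζ) := hζ.smooth.continuous_deriv (by simp)
  have hdi : IntegrableOn (deriv ζ) (Ioo 0 L) :=
    hd.integrableOn_Icc.mono_set Ioo_subset_Icc_self
  have hpi : IntegrableOn (fun x => ∫ s in (0 : ℝ)..x, q s) (Ioo 0 L) :=
    (continuousOn_primitive_of_Ioo hL.le (integrableOn_coe q)).integrableOn_Icc.mono_set
      Ioo_subset_Icc_self
  calc _ = ∫ x in Ioo 0 L, (c * deriv ζ x + deriv ζ x • ∫ s in (0 : ℝ)..x, q s) := by
        refine integral_congr_ae ?_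
        filter_upwards [hae] with x hx
        change (hm.toLp _) x * _ = _
        rw [hx, smul_eq_mul]; ring
    _ = -∫ x in Ioo 0 L, ζ x • q x := by
        rw [integral_add (hdi.const_mul c) (integrableOn_continuous_smul hd hpi),
          integral_const_mul, hζ.integral_deriv_smul_primitive (integrableOn_coe q),
          integral_Ioo_eq hL.le, hζ.integral_deriv, hζ.eq_zero_of_le (Or.inl le_rfl)]
        simp
    _ = _ := by simp only [smul_eq_mul, mul_comm]; rfl

theorem exists_H10_of_deriv (hL : 0 < L) (q : L2 L) (hq : ∫ s in (0 : ℝ)..L, q s = 0) :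
    ∃ v : H10 L, dx v.1 = q := by
  obtain ⟨v, hv, hv'⟩ := exists_H1_of_deriv hL 0 q
  refine ⟨⟨v, _, continuousOn_primitive_of_Ioo hL.le (integrableOn_coe q), ?_, by simp, hq⟩, hv⟩
  simpa using hv'

/-- Two continuous functions that agree almost everywhere on `(0, L)` agree on `[0, L]`. Comparing
the representative with `c + ∫ v_x` at the two end points gives first `c = 0` and then mean zero. -/
theorem H10_ae_eq_and_integral_eq_zero (hL : 0 < L) (v : H10 L) :
    (∀ᵐ x ∂(vol L), fn v.1 x = ∫ s in (0 : ℝ)..x, dx v.1 s) ∧ ∫ s in (0 : ℝ)..L, dx v.1 s = 0 := by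
  obtain ⟨F, hF, hae, hF0, hFL⟩ := v.2
  obtain ⟨c, hc⟩ := IsWeakDeriv.exists_ae_eq_primitive hL v.1.2
  have heq : EqOn F (fun x => c + ∫ s in (0 : ℝ)..x, dx v.1 s) (Icc 0 L) := by
    refine Measure.eqOn_Icc_of_ae_eq volume hL.ne ?_ hF (continuousOn_const.add
      (continuousOn_primitive_of_Ioo hL.le (integrableOn_coe _)))
    rw [← restrict_Ioo_eq_restrict_Icc]
    filter_upwards [hae, hc] with x h1 h2
    rw [← h1]; exact h2
  have h0 := heq (left_mem_Icc.2 hL.le)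
  have h1 := heq (right_mem_Icc.2 hL.le)
  simp only [hF0, hFL, intervalIntegral.integral_same, add_zero] at h0 h1
  subst h0
  refine ⟨?_, by simpa using h1.symm⟩
  filter_upwards [hc] with x hx
  exact hx.trans (zero_add _)

theorem H10_ae_eq (hL : 0 < L) (v : H10 L) :
    ∀ᵐ x ∂(vol L), fn v.1 x = ∫ s in (0 : ℝ)..x, dx v.1 s :=
  (H10_ae_eq_and_integral_eq_zero hL v).1

theorem H10_integral_dx (hL : 0 < L) (v : H10 L) : ∫ s in (0 : ℝ)..L, dx v.1 s = 0 :=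
  (H10_ae_eq_and_integral_eq_zero hL v).2

/-- Integration by parts; the boundary terms vanish when one of the functions is in `H¹₀`. -/
theorem IsWeakDeriv.inner_eq_neg (hL : 0 < L) {f g : L2 L} (h : IsWeakDeriv f g) (w : H10 L) :
    inner ℝ g (fn w.1) = -inner ℝ f (dx w.1) := by
  obtain ⟨c, hc⟩ := h.exists_ae_eq_primitive hL
  set q := dx w.1 with hq
  have hq0 : ∫ s in Ioo 0 L, q s = 0 := by
    rw [integral_Ioo_eq hL.le]; exact H10_integral_dx hL w
  have hfq : IntegrableOn (fun s => f s * q s) (Ioo 0 L) :=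
    (Lp.memLp f).integrable_mul (Lp.memLp q)
  rw [inner_eq_integral, inner_eq_integral]
  calc ∫ x in Ioo 0 L, g x * fn w.1 x
      = ∫ x in Ioo 0 L, g x • ∫ s in (0 : ℝ)..x, q s := by
        refine integral_congr_ae ?_
        filter_upwards [H10_ae_eq hL w] with x hx
        rw [hx, smul_eq_mul]
    _ = ∫ s in Ioo 0 L, (∫ t in s..L, g t) • q s :=
        integral_smul_primitive (integrableOn_coe g) (integrableOn_coe q)
    _ = ∫ s in Ioo 0 L, (((∫ t in (0 : ℝ)..L, g t) + c) * q s - f s * q s) := by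
        refine integral_congr_ae ?_
        filter_upwards [hc, ae_restrict_mem measurableSet_Ioo] with s hs hsm
        have := intervalIntegral.integral_add_adjacent_intervals
          (intervalIntegrable_of_Ioo (integrableOn_coe g) le_rfl hsm.1.le hsm.2.le)
          (intervalIntegrable_of_Ioo (integrableOn_coe g) hsm.1.le hsm.2.le le_rfl)
        rw [hs, smul_eq_mul, ← this]; ring
    _ = _ := by
        rw [integral_sub ((integrableOn_coe q).const_mul _) hfq, integral_const_mul, hq0]; simp

theorem norm_fn_le_mul_norm_dx (hL : 0 < L) (v : H10 L) : ‖fn v.1‖ ≤ L * ‖dx v.1‖ :=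
  norm_le_of_ae_eq_integral hL.le _ _ (fun _ => 0)
    (fun x hx => ⟨le_rfl, by linarith [hx.2], hx.1.le⟩) (H10_ae_eq hL v)

theorem H10_ext (hL : 0 < L) {v w : H10 L} (h : dx v.1 = dx w.1) : v = w := by
  refine Subtype.ext (H1_ext ?_ h)
  refine Lp.ext ?_
  filter_upwards [H10_ae_eq hL v, H10_ae_eq hL w] with x h1 h2
  rw [h1, h2, h]

/-- Zero boundary values amount to integration by parts without boundary terms against all of `H¹`,
a condition that survives differentiation in time. The test function `w = 1` gives `∫ v_x = 0`, so
some `v' ∈ H¹₀` has the same derivative and `v − v'` is a constant `c`. A `w` with `w_x = 1` then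
gives `c L = 0`. -/
theorem mem_H10_of_inner_eq (hL : 0 < L) (v : H1 L)
    (h : ∀ w : H1 L, inner ℝ (dx v) (fn w) + inner ℝ (fn v) (dx w) = 0) :
    v ∈ H10Submodule L := by
  obtain ⟨c, hc⟩ := IsWeakDeriv.exists_ae_eq_primitive hL v.2
  have hI : ∫ s in Ioo 0 L, dx v s = 0 := by
    obtain ⟨w, hw, hw'⟩ := exists_H1_of_deriv hL 1 (0 : L2 L)
    have h1 := h w
    rw [hw, inner_zero_right, add_zero, inner_eq_integral] at h1
    refine Eq.trans ?_ h1
    refine integral_congr_ae ?_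
    have h00 : ∀ x ∈ Ioo 0 L, ∫ s in (0:ℝ)..x, (0 : L2 L) s = 0 := fun x hx => by
      rw [← integral_Ioo_eq hx.1.le]
      refine integral_eq_zero_of_ae ?_
      exact ae_restrict_of_ae_restrict_of_subset (Ioo_subset_Ioo le_rfl hx.2.le)
        (Lp.coeFn_zero ℝ 2 (vol L))
    filter_upwards [hw', ae_restrict_mem measurableSet_Ioo] with x hx hxm
    rw [hx, h00 x hxm]; simp
  obtain ⟨v', hv'⟩ := exists_H10_of_deriv hL (dx v) (by rwa [← integral_Ioo_eq hL.le])
  have hae : ∀ᵐ x ∂(vol L), (fn v - fn v'.1 : L2 L) x = c := by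
    filter_upwards [hc, H10_ae_eq hL v', Lp.coeFn_sub (fn v) (fn v'.1)] with x h1 h2 h3
    rw [h3, Pi.sub_apply, h2, hv']
    change (fn v) x = _ at h1
    rw [h1]; simp [dx]
  have hone : MemLp (fun _ : ℝ => (1 : ℝ)) 2 (vol L) := memLp_const 1
  obtain ⟨w, hw, -⟩ := exists_H1_of_deriv hL 0 (hone.toLp _)
  have h1 := h w
  have h2 := IsWeakDeriv.inner_eq_neg hL w.2 v'
  rw [← hv', real_inner_comm] at h1
  change inner ℝ (dx w) _ = - inner ℝ (fn w) _ at h2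
  have h3 : inner ℝ (fn v - fn v'.1) (dx w) = 0 := by
    rw [inner_sub_left, real_inner_comm (dx w) (fn v'.1), h2]; linarith
  rw [hw, inner_eq_integral] at h3
  have h4 : ∫ x in Ioo 0 L, (fn v - fn v'.1 : L2 L) x * (hone.toLp _ : L2 L) x = c * L := by
    rw [integral_congr_ae (g := fun _ => c)]
    · simp [hL.le, mul_comm]
    · filter_upwards [hae, hone.coeFn_toLp] with x h1 h2
      rw [h1, h2, mul_one]
  rw [h4] at h3
  have hc0 : c = 0 := by
    rcases mul_eq_zero.1 h3 with h | h
    · exact h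
    · exact absurd h hL.ne'
  have : v = v'.1 := by
    refine H1_ext (Lp.ext ?_) hv'.symm
    filter_upwards [hae, Lp.coeFn_sub (fn v) (fn v'.1)] with x h1 h2
    rw [h2, hc0, Pi.sub_apply] at h1
    linarith
  rw [this]; exact v'.2

end H1

/-! ### The finite element space and the Ritz projection. -/

section FiniteElements

variable {L : ℝ} {M : ℕ}

/-- The `i`-th open cell of the uniform partition of `[0, L]` into `M` cells. -/
abbrev cell (L : ℝ) (M i : ℕ) : Set ℝ := Ioo (i * (L / M)) ((i + 1) * (L / M))

theorem cell_bounds (hL : 0 < L) (hM : 0 < M) {i : ℕ} (hi : i < M) :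
    0 ≤ i * (L / M) ∧ (i : ℝ) * (L / M) < (i + 1) * (L / M) ∧ (i + 1) * (L / M) ≤ L := by
  have hM' : (0 : ℝ) < M := by exact_mod_cast hM
  have hh : 0 < L / M := by positivity
  refine ⟨by positivity, by nlinarith, ?_⟩
  have h1 : (i + 1 : ℝ) ≤ M := by exact_mod_cast hi
  calc (i + 1) * (L / M) ≤ M * (L / M) := by gcongr
    _ = L := by field_simp

theorem cell_subset (hL : 0 < L) (hM : 0 < M) {i : ℕ} (hi : i < M) : cell L M i ⊆ Ioo 0 L :=
  Ioo_subset_Ioo (cell_bounds hL hM hi).1 (cell_bounds hL hM hi).2.2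

/-- The left end point of the cell that contains `x`. -/
def leftNode (L : ℝ) (M : ℕ) (x : ℝ) : ℝ := ⌊x / (L / M)⌋₊ * (L / M)

theorem floor_lt (hL : 0 < L) (hM : 0 < M) {x : ℝ} (hx : x ∈ Ioo 0 L) : ⌊x / (L / M)⌋₊ < M := by
  have hM' : (0 : ℝ) < M := by exact_mod_cast hM
  rw [Nat.floor_lt (by have := hx.1; positivity), div_lt_iff₀ (by positivity)]
  have : (M : ℝ) * (L / M) = L := by field_simp
  rw [this]; exact hx.2

theorem leftNode_bounds (hL : 0 < L) (hM : 0 < M) {x : ℝ} (hx : x ∈ Ioo 0 L) :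
    0 ≤ leftNode L M x ∧ x - L / M < leftNode L M x ∧ leftNode L M x ≤ x := by
  have hM' : (0 : ℝ) < M := by exact_mod_cast hM
  have hh : 0 < L / M := by positivity
  have h1 := Nat.floor_le (a := x / (L / M)) (by have := hx.1; positivity)
  have h2 := Nat.lt_floor_add_one (x / (L / M))
  rw [le_div_iff₀ hh] at h1
  rw [div_lt_iff₀ hh] at h2
  refine ⟨by unfold leftNode; positivity, ?_, h1⟩
  unfold leftNode
  linarith

theorem floor_eq_of_mem_cell (hL : 0 < L) (hM : 0 < M) {x : ℝ} {i : ℕ} (hx : x ∈ cell L M i) :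
    ⌊x / (L / M)⌋₊ = i := by
  have hM' : (0 : ℝ) < M := by exact_mod_cast hM
  have hh : 0 < L / M := by positivity
  rw [Nat.floor_eq_iff (div_nonneg (le_trans (by positivity) hx.1.le) hh.le), le_div_iff₀ hh,
    div_lt_iff₀ hh]
  exact ⟨hx.1.le, hx.2⟩

theorem ae_of_forall_cell (hL : 0 < L) (hM : 0 < M) {p : ℝ → Prop}
    (h : ∀ i < M, ∀ᵐ x ∂(volume.restrict (cell L M i)), p x) : ∀ᵐ x ∂(vol L), p x := by
  have hM' : (0 : ℝ) < M := by exact_mod_cast hM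
  refine ae_restrict_of_ae_restrict_of_subset
    (t := ⋃ i ∈ Finset.range M, Ico (i * (L / M)) ((i + 1) * (L / M))) ?_ ?_
  · intro x hx
    simp only [mem_iUnion]
    obtain ⟨-, h1, h2⟩ := leftNode_bounds hL hM hx
    unfold leftNode at h1 h2
    exact ⟨⌊x / (L / M)⌋₊, Finset.mem_range.2 (floor_lt hL hM hx), h2, by linarith⟩
  · rw [ae_restrict_biUnion_finset_iff]
    intro i hi
    rw [← restrict_Ioo_eq_restrict_Ico]
    exact h i (Finset.mem_range.1 hi)

theorem ae_cell_of_ae (hL : 0 < L) (hM : 0 < M) {p : ℝ → Prop} {i : ℕ} (hi : i < M)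
    (h : ∀ᵐ x ∂(vol L), p x) : ∀ᵐ x ∂(volume.restrict (cell L M i)), p x :=
  ae_restrict_of_ae_restrict_of_subset (cell_subset hL hM hi) h

/-- The indicator function of a cell. -/
def cellIndicator (L : ℝ) (M i : ℕ) : L2 L :=
  indicatorConstLp 2 (s := cell L M i) measurableSet_Ioo (measure_ne_top _ _) (1 : ℝ)

/-- The functions that are constant on each cell. -/
def stepSpace (L : ℝ) (M : ℕ) : Submodule ℝ (L2 L) :=
  Submodule.span ℝ (cellIndicator L M '' (Finset.range M : Set ℕ))

instance : FiniteDimensional ℝ (stepSpace L M) :=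
  FiniteDimensional.span_of_finite ℝ ((Finset.range M).finite_toSet.image _)

theorem cellIndicator_mem {i : ℕ} (hi : i < M) : cellIndicator L M i ∈ stepSpace L M :=
  Submodule.subset_span ⟨i, by simpa using hi, rfl⟩

theorem inner_cellIndicator (hL : 0 < L) (hM : 0 < M) {i : ℕ} (hi : i < M) (f : L2 L) :
    inner ℝ (cellIndicator L M i) f = ∫ x in (i * (L / M))..((i + 1) * (L / M)), f x := by
  rw [cellIndicator, L2.inner_indicatorConstLp_one, Measure.restrict_restrict measurableSet_Ioo,
    inter_eq_left.2 (cell_subset hL hM hi), cell, integral_Ioo_eq (cell_bounds hL hM hi).2.1.le]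

theorem exists_const_of_mem_stepSpace (hL : 0 < L) (hM : 0 < M) {f : L2 L}
    (hf : f ∈ stepSpace L M) :
    ∀ i < M, ∃ c : ℝ, ∀ᵐ x ∂(volume.restrict (cell L M i)), f x = c := by
  intro i hi
  induction hf using Submodule.span_induction with
  | mem g hg =>
    obtain ⟨j, hj, rfl⟩ := hg
    refine ⟨if j = i then 1 else 0, ?_⟩
    filter_upwards [ae_cell_of_ae hL hM hi (indicatorConstLp_coeFn (p := 2) (μ := vol L)
      (hs := (measurableSet_Ioo : MeasurableSet (cell L M j))) (hμs := measure_ne_top _ _)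
      (c := (1 : ℝ))), ae_restrict_mem measurableSet_Ioo] with x hx hxi
    refine hx.trans ?_
    by_cases hij : j = i
    · subst hij
      rw [indicator_of_mem hxi, if_pos rfl]
    · rw [indicator_of_notMem, if_neg hij]
      intro hxj
      exact hij ((floor_eq_of_mem_cell hL hM hxj).symm.trans (floor_eq_of_mem_cell hL hM hxi))
  | zero =>
    exact ⟨0, ae_cell_of_ae hL hM hi (Lp.coeFn_zero ℝ 2 (vol L))⟩
  | add f g _ _ hf hg =>
    obtain ⟨a, ha⟩ := hf
    obtain ⟨b, hb⟩ := hg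
    refine ⟨a + b, ?_⟩
    filter_upwards [ha, hb, ae_cell_of_ae hL hM hi (Lp.coeFn_add f g)] with x h1 h2 h3
    rw [h3, Pi.add_apply, h1, h2]
  | smul r f _ hf =>
    obtain ⟨a, ha⟩ := hf
    refine ⟨r * a, ?_⟩
    filter_upwards [ha, ae_cell_of_ae hL hM hi (Lp.coeFn_smul r f)] with x h1 h3
    rw [h3, Pi.smul_apply, h1, smul_eq_mul]

/-- The difference between `f` and its orthogonal projection is constant on each cell and orthogonal
to the indicator of that cell, hence zero. -/
theorem mem_stepSpace_of_const (hL : 0 < L) (hM : 0 < M) {f : L2 L}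
    (hf : ∀ i < M, ∃ c : ℝ, ∀ᵐ x ∂(volume.restrict (cell L M i)), f x = c) :
    f ∈ stepSpace L M := by
  set P := (stepSpace L M).starProjection f with hP
  have hPm : P ∈ stepSpace L M := Submodule.starProjection_apply_mem _ _
  suffices h : f = P by rw [h]; exact hPm
  refine Lp.ext (ae_of_forall_cell hL hM fun i hi => ?_)
  obtain ⟨a, ha⟩ := hf i hi
  obtain ⟨b, hb⟩ := exists_const_of_mem_stepSpace hL hM hPm i hi
  have h0 : inner ℝ (f - P) (cellIndicator L M i) = 0 :=
    Submodule.starProjection_inner_eq_zero _ _ (cellIndicator_mem hi)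
  have hab : ∀ᵐ x ∂(volume.restrict (cell L M i)), (f - P : L2 L) x = a - b := by
    filter_upwards [ha, hb, ae_cell_of_ae hL hM hi (Lp.coeFn_sub f P)] with x h1 h2 h3
    rw [h3, Pi.sub_apply, h1, h2]
  obtain ⟨-, hlt, -⟩ := cell_bounds hL hM hi
  rw [real_inner_comm, inner_cellIndicator hL hM hi, ← integral_Ioo_eq hlt.le,
    integral_congr_ae (g := fun _ => a - b) hab] at h0
  simp only [integral_const, smul_eq_mul, mul_eq_zero, MeasurableSet.univ,
    measureReal_restrict_apply, univ_inter, Real.volume_real_Ioo_of_le hlt.le] at h0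
  have hab' : a = b := by
    rcases h0 with h | h <;> linarith
  filter_upwards [ha, hb] with x h1 h2
  rw [h1, h2, hab']

/-- Through `v ↦ v_x`, the finite element space becomes a finite-dimensional subspace of `L²`, where
the Ritz projection is an orthogonal projection. -/
theorem inFE_iff_dx_mem (hL : 0 < L) (hM : 0 < M) (v : H10 L) :
    InFE M v ↔ dx v.1 ∈ stepSpace L M := by
  have hii := integrableOn_coe (dx v.1)
  constructor
  · intro h
    refine mem_stepSpace_of_const hL hM fun i hi => ?_
    obtain ⟨p, q, hpq⟩ := h i hi
    obtain ⟨h0, hlt, hle⟩ := cell_bounds hL hM hi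
    refine ⟨q, ?_⟩
    have heq : EqOn (fun x => ∫ s in (0 : ℝ)..x, dx v.1 s) (fun x => p + q * x)
        (Icc (i * (L / M)) ((i + 1) * (L / M))) := by
      refine Measure.eqOn_Icc_of_ae_eq volume hlt.ne ?_
        ((continuousOn_primitive_of_Ioo hL.le hii).mono (Icc_subset_Icc h0 hle)) (by fun_prop)
      rw [← restrict_Ioo_eq_restrict_Icc]
      filter_upwards [hpq, ae_cell_of_ae hL hM hi (H10_ae_eq hL v)] with x h1 h2
      rw [← h2, h1]
    -- By Lebesgue differentiation the primitive of `v_x` has derivative `v_x` almost everywhere; on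
    -- the cell this primitive is the affine function, of slope `q`.
    have hd := (intervalIntegrable_of_Ioo hii le_rfl hL.le le_rfl).ae_hasDerivAt_integral
    rw [cell, ae_restrict_iff' measurableSet_Ioo]
    filter_upwards [hd] with x hx hxi
    have h0L : x ∈ uIcc 0 L := by
      rw [uIcc_of_le hL.le]
      exact Ioo_subset_Icc_self (cell_subset hL hM hi hxi)
    have h1 := hx h0L 0 left_mem_uIcc
    have h2 : HasDerivAt (fun x => p + q * x) q x := by
      simpa using ((hasDerivAt_id x).const_mul q).const_add p
    refine h1.unique (h2.congr_of_eventuallyEq ?_)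
    filter_upwards [Ioo_mem_nhds hxi.1 hxi.2] with y hy using heq (Ioo_subset_Icc_self hy)
  · intro h i hi
    obtain ⟨c, hc⟩ := exists_const_of_mem_stepSpace hL hM h i hi
    obtain ⟨h0, hlt, hle⟩ := cell_bounds hL hM hi
    set x0 := i * (L / M) with hx0
    refine ⟨(∫ s in (0 : ℝ)..x0, dx v.1 s) - c * x0, c, ?_⟩
    filter_upwards [ae_cell_of_ae hL hM hi (H10_ae_eq hL v), ae_restrict_mem measurableSet_Ioo]
      with x hx hxi
    rw [hx, ← intervalIntegral.integral_add_adjacent_intervals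
      (intervalIntegrable_of_Ioo hii le_rfl h0 (hlt.le.trans hle))
      (intervalIntegrable_of_Ioo hii h0 hxi.1.le (hxi.2.le.trans hle))]
    have : ∫ s in x0..x, dx v.1 s = ∫ s in x0..x, c := by
      rw [← integral_Ioo_eq hxi.1.le, ← integral_Ioo_eq hxi.1.le]
      exact integral_congr_ae (ae_restrict_of_ae_restrict_of_subset
        (Ioo_subset_Ioo le_rfl hxi.2.le) hc)
    rw [this, intervalIntegral.integral_const, smul_eq_mul]
    ring

/-- Orthogonality to the cell indicators means zero integral over each cell, so the primitive
vanishes at every node. For `r = (η − P_h η)_x` this says that `P_h η` interpolates `η` at the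
nodes. -/
theorem integral_zero_node_eq_zero (hL : 0 < L) (hM : 0 < M) {r : L2 L}
    (hr : ∀ i < M, inner ℝ (cellIndicator L M i) r = 0) {i : ℕ} (hi : i ≤ M) :
    ∫ x in (0 : ℝ)..(i * (L / M)), r x = 0 := by
  induction i with
  | zero => simp
  | succ j ih =>
    obtain ⟨h0, hlt, hle⟩ := cell_bounds hL hM (Nat.lt_of_succ_le hi)
    have hii := integrableOn_coe r
    push_cast
    rw [← intervalIntegral.integral_add_adjacent_intervals
      (intervalIntegrable_of_Ioo hii le_rfl h0 (hlt.le.trans hle))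
      (intervalIntegrable_of_Ioo hii h0 hlt.le hle), ih (Nat.le_of_succ_le hi), zero_add,
      ← inner_cellIndicator hL hM (Nat.lt_of_succ_le hi), hr j (Nat.lt_of_succ_le hi)]

theorem inner_cellIndicator_projection {i : ℕ} (hi : i < M) (q : L2 L) :
    inner ℝ (cellIndicator L M i) (q - (stepSpace L M).starProjection q) = 0 := by
  rw [real_inner_comm]
  exact Submodule.starProjection_inner_eq_zero _ _ (cellIndicator_mem hi)

open Classical in
/-- The Ritz projection onto the finite element space. -/
def ritz (M : ℕ) (η : H10 L) : H10 L :=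
  if h : ∃ v : H10 L, dx v.1 = (stepSpace L M).starProjection (dx η.1) then h.choose else 0

/-- The projection preserves the integral over each cell, hence the zero mean of `η_x`, so the
projected derivative is the derivative of an element of `H¹₀` and the default branch of `ritz` is
never taken. -/
theorem dx_ritz (hL : 0 < L) (hM : 0 < M) (η : H10 L) :
    dx (ritz M η).1 = (stepSpace L M).starProjection (dx η.1) := by
  have h : ∃ v : H10 L, dx v.1 = (stepSpace L M).starProjection (dx η.1) := by
    refine exists_H10_of_deriv hL _ ?_
    have h1 := integral_zero_node_eq_zero hL hM
      (fun i hi => inner_cellIndicator_projection hi (dx η.1)) le_rfl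
    have hM' : (M : ℝ) * (L / M) = L := by
      have : (M : ℝ) ≠ 0 := by exact_mod_cast hM.ne'
      field_simp
    rw [hM', ← integral_Ioo_eq hL.le,
      integral_congr_ae (Lp.coeFn_sub (dx η.1) ((stepSpace L M).starProjection (dx η.1)))] at h1
    simp only [Pi.sub_apply] at h1
    rw [integral_sub (integrableOn_coe _) (integrableOn_coe _), integral_Ioo_eq hL.le,
      integral_Ioo_eq hL.le, H10_integral_dx hL] at h1
    linarith
  unfold ritz
  rw [dif_pos h]
  exact h.choose_spec

theorem inFE_ritz (hL : 0 < L) (hM : 0 < M) (η : H10 L) : InFE M (ritz M η) := by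
  rw [inFE_iff_dx_mem hL hM, dx_ritz hL hM]
  exact Submodule.starProjection_apply_mem _ _

theorem InFE.sub (hL : 0 < L) (hM : 0 < M) {v w : H10 L} (hv : InFE M v) (hw : InFE M w) :
    InFE M (v - w) := by
  rw [inFE_iff_dx_mem hL hM] at *
  exact Submodule.sub_mem _ hv hw

theorem inner_dx_ritz_sub (hL : 0 < L) (hM : 0 < M) (η : H10 L) {χ : H10 L} (hχ : InFE M χ) :
    inner ℝ (dx (ritz M η - η).1) (dx χ.1) = 0 := by
  rw [inFE_iff_dx_mem hL hM] at hχ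
  have h := Submodule.starProjection_inner_eq_zero (dx η.1) _ hχ
  rw [← neg_eq_zero, ← inner_neg_left, neg_sub, ← dx_ritz hL hM] at h
  exact h

theorem IsProj.eq_ritz (hL : 0 < L) (hM : 0 < M) {η p : H10 L} (hp : IsProj M η p) :
    p = ritz M η := by
  refine H10_ext hL ?_
  have hd : InFE M (p - ritz M η) := InFE.sub hL hM hp.1 (inFE_ritz hL hM η)
  have h1 := hp.2 _ hd
  have h2 := inner_dx_ritz_sub hL hM η hd
  have h3 : inner ℝ (dx (p - ritz M η).1) (dx (p - ritz M η).1) = 0 := by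
    have : dx (p - ritz M η).1 = dx (p - η).1 - dx (ritz M η - η).1 := by
      change dx p.1 - dx (ritz M η).1 = (dx p.1 - dx η.1) - (dx (ritz M η).1 - dx η.1)
      abel
    have h4 := congrArg (fun z => inner ℝ z (dx (p - ritz M η).1)) this
    simp only [inner_sub_left, h1, h2, sub_zero] at h4
    exact h4
  exact sub_eq_zero.1 (inner_self_eq_zero.1 h3)

theorem ritz_sub (hL : 0 < L) (hM : 0 < M) (v w : H10 L) :
    ritz M (v - w) = ritz M v - ritz M w := by
  refine H10_ext hL ?_
  change _ = dx (ritz M v).1 - dx (ritz M w).1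
  rw [dx_ritz hL hM, dx_ritz hL hM, dx_ritz hL hM, ← map_sub]
  rfl

theorem ritz_smul (hL : 0 < L) (hM : 0 < M) (r : ℝ) (v : H10 L) :
    ritz M (r • v) = r • ritz M v := by
  refine H10_ext hL ?_
  change _ = r • dx (ritz M v).1
  rw [dx_ritz hL hM, dx_ritz hL hM, ← map_smul]
  rfl

theorem norm_dx_ritz_le (hL : 0 < L) (hM : 0 < M) (η : H10 L) :
    ‖dx (ritz M η).1‖ ≤ ‖dx η.1‖ := by
  rw [dx_ritz hL hM]
  exact Submodule.norm_starProjection_apply_le _ _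

theorem norm_sub_starProjection_le_of_mem {E : Type*} [NormedAddCommGroup E]
    [InnerProductSpace ℝ E] (K : Submodule ℝ E) [K.HasOrthogonalProjection] (q : E) {s : E}
    (hs : s ∈ K) : ‖q - K.starProjection q‖ ≤ ‖q - s‖ := by
  have h := Submodule.starProjection_inner_eq_zero q (K.starProjection q - s)
    (Submodule.sub_mem _ (Submodule.starProjection_apply_mem _ _) hs)
  have h1 : q - s = (q - K.starProjection q) + (K.starProjection q - s) := by abel
  have h2 := norm_add_sq_real (q - K.starProjection q) (K.starProjection q - s)
  rw [← h1, h] at h2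
  exact le_of_sq_le_sq (by nlinarith [sq_nonneg ‖K.starProjection q - s‖]) (norm_nonneg _)

theorem dx_ritz_sub (hL : 0 < L) (hM : 0 < M) (η : H10 L) :
    dx (ritz M η - η).1 = -(dx η.1 - (stepSpace L M).starProjection (dx η.1)) := by
  rw [← dx_ritz hL hM, neg_sub]; rfl

theorem norm_dx_ritz_sub_le (hL : 0 < L) (hM : 0 < M) (η : H10 L) :
    ‖dx (ritz M η - η).1‖ ≤ ‖dx η.1‖ := by
  rw [dx_ritz_sub hL hM, norm_neg]
  simpa using norm_sub_starProjection_le_of_mem (stepSpace L M) (dx η.1) (zero_mem _)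

/-- The error vanishes at the nodes, so at `x` it is the integral of its derivative from the left
node of the cell, over a length at most `h`. -/
theorem norm_fn_ritz_sub_le_mul (hL : 0 < L) (hM : 0 < M) (η : H10 L) :
    ‖fn (ritz M η - η).1‖ ≤ L / M * ‖dx (ritz M η - η).1‖ := by
  have hM' : (0 : ℝ) < M := by exact_mod_cast hM
  refine norm_le_of_ae_eq_integral (by positivity) _ _ (leftNode L M) (fun x hx => ?_) ?_
  · obtain ⟨h0, h1, h2⟩ := leftNode_bounds hL hM hx
    exact ⟨h0, h1.le, h2⟩
  · filter_upwards [H10_ae_eq hL (ritz M η - η), ae_restrict_mem measurableSet_Ioo] with x hx hxm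
    obtain ⟨h0, h1, h2⟩ := leftNode_bounds hL hM hxm
    have hii := integrableOn_coe (dx (ritz M η - η).1)
    have hz : ∫ s in (0 : ℝ)..(leftNode L M x), dx (ritz M η - η).1 s = 0 := by
      refine integral_zero_node_eq_zero hL hM (fun i hi => ?_) (floor_lt hL hM hxm).le
      rw [dx_ritz_sub hL hM, inner_neg_right, inner_cellIndicator_projection hi, neg_zero]
    rw [hx, ← intervalIntegral.integral_add_adjacent_intervals
      (intervalIntegrable_of_Ioo hii le_rfl h0 (h2.trans hxm.2.le))
      (intervalIntegrable_of_Ioo hii h0 h2 hxm.2.le), hz, zero_add]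

theorem norm_fn_ritz_sub_le (hL : 0 < L) (hM : 0 < M) (η : H10 L) :
    ‖fn (ritz M η - η).1‖ ≤ L / M * ‖dx η.1‖ := by
  have hM' : (0 : ℝ) < M := by exact_mod_cast hM
  exact (norm_fn_ritz_sub_le_mul hL hM η).trans
    (mul_le_mul_of_nonneg_left (norm_dx_ritz_sub_le hL hM η) (by positivity))

/-- An orthogonal projection is the best approximation, so it suffices to exhibit one step function
at distance at most `h ‖η_xx‖` from `η_x`. -/
theorem norm_dx_ritz_sub_le_of_isWeakDeriv (hL : 0 < L) (hM : 0 < M) (η : H10 L) {g : L2 L}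
    (hg : IsWeakDeriv (dx η.1) g) : ‖dx (ritz M η - η).1‖ ≤ L / M * ‖g‖ := by
  have hM' : (0 : ℝ) < M := by exact_mod_cast hM
  obtain ⟨c, hc⟩ := hg.exists_ae_eq_primitive hL
  -- The competitor takes on each cell the value of the continuous representative of `η_x` at the
  -- left node. Its distance to `η_x` at `x` is the integral of `g` from that node to `x`.
  let C : ℕ → ℝ := fun i => c + ∫ s in (0 : ℝ)..(i * (L / M)), g s
  have hmeas : Measurable (fun x : ℝ => C ⌊x / (L / M)⌋₊) :=
    (measurable_from_nat (f := C)).comp (Nat.measurable_floor.comp (measurable_id.div_const _))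
  have hmem : MemLp (fun x : ℝ => C ⌊x / (L / M)⌋₊) 2 (vol L) := by
    refine MemLp.of_bound hmeas.aestronglyMeasurable (∑ i ∈ Finset.range M, ‖C i‖) ?_
    filter_upwards [ae_restrict_mem measurableSet_Ioo] with x hx
    exact Finset.single_le_sum (f := fun i => ‖C i‖) (fun i _ => norm_nonneg _)
      (Finset.mem_range.2 (floor_lt hL hM hx))
  have hs : hmem.toLp _ ∈ stepSpace L M := by
    refine mem_stepSpace_of_const hL hM fun i hi => ⟨C i, ?_⟩
    filter_upwards [ae_cell_of_ae hL hM hi hmem.coeFn_toLp, ae_restrict_mem measurableSet_Ioo]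
      with x hx hxi
    rw [hx, floor_eq_of_mem_cell hL hM hxi]
  rw [dx_ritz_sub hL hM, norm_neg]
  refine (norm_sub_starProjection_le_of_mem _ _ hs).trans ?_
  refine norm_le_of_ae_eq_integral (by positivity) _ _ (leftNode L M) (fun x hx => ?_) ?_
  · obtain ⟨h0, h1, h2⟩ := leftNode_bounds hL hM hx
    exact ⟨h0, h1.le, h2⟩
  · filter_upwards [hc, hmem.coeFn_toLp, Lp.coeFn_sub (dx η.1) (hmem.toLp _),
      ae_restrict_mem measurableSet_Ioo] with x h1 h2 h3 hxm
    obtain ⟨h0, -, h4⟩ := leftNode_bounds hL hM hxm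
    rw [h3, Pi.sub_apply, h1, h2, ← intervalIntegral.integral_add_adjacent_intervals
      (intervalIntegrable_of_Ioo (integrableOn_coe g) le_rfl h0 (h4.trans hxm.2.le))
      (intervalIntegrable_of_Ioo (integrableOn_coe g) h0 h4 hxm.2.le)]
    simp only [C, leftNode]
    ring

end FiniteElements

/-! ### Regularity in time: continuous representatives and integrable moduli. -/

section TimeRegularity

/-- The increments of `f` on `[0, T]` are bounded by the integrals of `m`. -/
def HasModulus {B : Type*} [NormedAddCommGroup B] (T : ℝ) (m : ℝ → ℝ) (f : ℝ → B) : Prop :=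
  ∀ s t, 0 ≤ s → s ≤ t → t ≤ T → ‖f t - f s‖ ≤ ∫ r in s..t, m r

/-- A non-negative function in `L²(0, T)`. -/
structure IsWeight (T : ℝ) (m : ℝ → ℝ) : Prop where
  nonneg : ∀ t, 0 ≤ m t
  memLp : MemLp m 2 (volume.restrict (Ioo 0 T))

theorem IsWeight.integrableOn {T : ℝ} {m : ℝ → ℝ} (h : IsWeight T m) :
    IntegrableOn m (Ioo 0 T) := h.memLp.integrable one_le_two

theorem IsWeight.add {T : ℝ} {m m' : ℝ → ℝ} (h : IsWeight T m) (h' : IsWeight T m') :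
    IsWeight T (fun t => m t + m' t) :=
  ⟨fun t => add_nonneg (h.nonneg t) (h'.nonneg t), h.memLp.add h'.memLp⟩

theorem HasModulus.mono {B : Type*} [NormedAddCommGroup B] {T : ℝ} {m m' : ℝ → ℝ} {f : ℝ → B}
    (h : HasModulus T m f) (hm : IsWeight T m) (hm' : IsWeight T m') (hle : ∀ t, m t ≤ m' t) :
    HasModulus T m' f := fun s t h0 hst htT =>
  (h s t h0 hst htT).trans (intervalIntegral.integral_mono hst
    (intervalIntegrable_of_Ioo hm.integrableOn h0 hst htT)
    (intervalIntegrable_of_Ioo hm'.integrableOn h0 hst htT) hle)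

theorem HasModulus.of_norm_sub_le {B B' : Type*} [NormedAddCommGroup B] [NormedAddCommGroup B']
    {T : ℝ} {m : ℝ → ℝ} {f : ℝ → B} {g : ℝ → B'} (h : HasModulus T m f)
    (hg : ∀ s ∈ Icc 0 T, ∀ t ∈ Icc 0 T, ‖g t - g s‖ ≤ ‖f t - f s‖) : HasModulus T m g :=
  fun s t h0 hst htT => (hg s ⟨h0, hst.trans htT⟩ t ⟨h0.trans hst, htT⟩).trans (h s t h0 hst htT)

section Bochner

variable {B : Type*} [NormedAddCommGroup B] [NormedSpace ℝ B] [CompleteSpace B]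

theorem exists_continuous_primitive {T : ℝ} (hT : 0 < T)
    {f g : ℝ → B} (hf : IntegrableOn f (Ioo 0 T)) (hg : IntegrableOn g (Ioo 0 T))
    (h : ∀ ζ, IsTestFunction 0 T ζ →
      ∫ t in Ioo 0 T, deriv ζ t • f t = -∫ t in Ioo 0 T, ζ t • g t) :
    ∃ F : ℝ → B, Continuous F ∧ (∀ᵐ t ∂(volume.restrict (Ioo 0 T)), f t = F t) ∧
      ∀ s t, 0 ≤ s → s ≤ t → t ≤ T → F t - F s = ∫ r in s..t, g r := by
  obtain ⟨c, hc⟩ := ae_eq_const_add_primitive hT hf hg h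
  -- `g` is controlled only on `(0, T)`; its extension by zero has a primitive continuous on the
  -- whole line.
  have hgi : Integrable ((Ioo 0 T).indicator g) := (integrable_indicator_iff measurableSet_Ioo).2 hg
  have hgii : ∀ a b, IntervalIntegrable ((Ioo 0 T).indicator g) volume a b :=
    fun a b => hgi.intervalIntegrable
  have heq : ∀ s t, 0 ≤ s → s ≤ t → t ≤ T →
      ∫ r in s..t, (Ioo 0 T).indicator g r = ∫ r in s..t, g r := by
    intro s t h0 hst htT
    rw [← integral_Ioo_eq hst, ← integral_Ioo_eq hst]
    exact setIntegral_congr_fun measurableSet_Ioo fun x hx =>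
      indicator_of_mem (Ioo_subset_Ioo h0 htT hx) _
  refine ⟨fun t => c + ∫ r in (0 : ℝ)..t, (Ioo 0 T).indicator g r,
    continuous_const.add (intervalIntegral.continuous_primitive hgii 0), ?_, ?_⟩
  · filter_upwards [hc, ae_restrict_mem measurableSet_Ioo] with t ht htm
    rw [ht, heq 0 t le_rfl htm.1.le htm.2.le]
  · intro s t h0 hst htT
    rw [← heq s t h0 hst htT, add_sub_add_left_eq_sub,
      intervalIntegral.integral_interval_sub_left (hgii _ _) (hgii _ _)]

theorem isWeight_norm {E : Type*} [NormedAddCommGroup E] {T : ℝ} {g : ℝ → E}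
    (hg : MemLp g 2 (volume.restrict (Ioo 0 T))) :
    IsWeight T (fun t => ‖g t‖) := ⟨fun _ => norm_nonneg _, hg.norm⟩

theorem hasModulus_of_sub_eq_integral {E : Type*} [NormedAddCommGroup E] [NormedSpace ℝ E] {T : ℝ}
    {F g : ℝ → E}
    (h : ∀ s t, 0 ≤ s → s ≤ t → t ≤ T → F t - F s = ∫ r in s..t, g r) :
    HasModulus T (fun t => ‖g t‖) F := fun s t h0 hst htT => by
  rw [h s t h0 hst htT]
  exact intervalIntegral.norm_integral_le_integral_norm hst

theorem exists_continuous_primitive_of_memLp {T : ℝ} (hT : 0 < T) {k : ℕ} {p : ℝ≥0∞}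
    (hp : 2 ≤ p) {d : ℕ → ℝ → B}
    (hm : ∀ j ≤ k, MemLp (d j) p (volume.restrict (Ioo 0 T)))
    (hd : ∀ j < k, ∀ ζ : ℝ → ℝ, IsTestFunction 0 T ζ →
      ∫ t in Ioo 0 T, deriv ζ t • d j t = - ∫ t in Ioo 0 T, ζ t • d (j + 1) t)
    {j : ℕ} (hj : j < k) :
    ∃ F : ℝ → B, Continuous F ∧ (∀ᵐ t ∂(volume.restrict (Ioo 0 T)), d j t = F t) ∧
      (∀ s t, 0 ≤ s → s ≤ t → t ≤ T → F t - F s = ∫ r in s..t, d (j + 1) r) ∧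
      ∃ m, IsWeight T m ∧ HasModulus T m F := by
  have h1 : ∀ j ≤ k, IntegrableOn (d j) (Ioo 0 T) := fun j hj =>
    (hm j hj).integrable (one_le_two.trans hp)
  obtain ⟨F, hF, hae, hsub⟩ :=
    exists_continuous_primitive hT (h1 j hj.le) (h1 _ hj) (hd j hj)
  exact ⟨F, hF, hae, hsub, _, isWeight_norm ((hm _ hj).mono_exponent hp),
    hasModulus_of_sub_eq_integral hsub⟩

theorem MemTimeSobolev.exists_continuous_hasModulus {T : ℝ} {k : ℕ} {p : ℝ≥0∞} {f : ℝ → B}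
    (h : MemTimeSobolev T k p f) (hT : 0 < T) (hp : 2 ≤ p) (hk : 0 < k) :
    ∃ F : ℝ → B, Continuous F ∧ (∀ᵐ t ∂(volume.restrict (Ioo 0 T)), f t = F t) ∧
      ∃ m, IsWeight T m ∧ HasModulus T m F := by
  obtain ⟨d, rfl, hm, hd⟩ := h
  obtain ⟨F, hF, hae, -, hmod⟩ := exists_continuous_primitive_of_memLp hT hp hm hd hk
  exact ⟨F, hF, hae, hmod⟩

theorem eqOn_Icc_of_ae_eq_Ioo {E : Type*} [NormedAddCommGroup E] {T : ℝ} (hT : 0 < T)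
    {f F : ℝ → E}
    (h : ∀ᵐ t ∂(volume.restrict (Ioo 0 T)), f t = F t) (hf : ContinuousOn f (Icc 0 T))
    (hF : Continuous F) : EqOn f F (Icc 0 T) := by
  refine Measure.eqOn_Icc_of_ae_eq volume hT.ne ?_ hf hF.continuousOn
  rw [← restrict_Ioo_eq_restrict_Icc]
  exact h

theorem hasDerivAt_primitive {G : ℝ → B} (hG : Continuous G) (t : ℝ) :
    HasDerivAt (fun t => ∫ s in (0 : ℝ)..t, G s) (G t) t :=
  intervalIntegral.integral_hasDerivAt_right (hG.intervalIntegrable _ _)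
    (hG.stronglyMeasurableAtFilter _ _) hG.continuousAt

end Bochner

variable {L : ℝ}

/-- The map `v ↦ v` from `H¹(0, L)` to `L²(0, L)`. -/
def fnCLM (L : ℝ) : H1 L →L[ℝ] L2 L :=
  LinearMap.mkContinuous ⟨⟨fn, fn_add⟩, fn_smul⟩ 1 fun v => by simpa using norm_fn_le v

/-- The map `v ↦ v_x` from `H¹(0, L)` to `L²(0, L)`. -/
def dxCLM (L : ℝ) : H1 L →L[ℝ] L2 L :=
  LinearMap.mkContinuous ⟨⟨dx, dx_add⟩, dx_smul⟩ 1 fun v => by simpa using norm_dx_le v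

/-- `v_xx`, for `v ∈ H²(0, L)`. -/
def dxx (v : H2 L) : L2 L := v.1.snd

theorem norm_sq_H2 (v : H2 L) : ‖v‖ ^ 2 = ‖v.toH1‖ ^ 2 + ‖dxx v‖ ^ 2 :=
  WithLp.prod_norm_sq_eq_of_L2 v.1

theorem norm_toH1_le (v : H2 L) : ‖v.toH1‖ ≤ ‖v‖ :=
  le_of_sq_le_sq (by rw [norm_sq_H2]; nlinarith [sq_nonneg ‖dxx v‖]) (norm_nonneg _)

theorem norm_dxx_le (v : H2 L) : ‖dxx v‖ ≤ ‖v‖ :=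
  le_of_sq_le_sq (by rw [norm_sq_H2]; nlinarith [sq_nonneg ‖v.toH1‖]) (norm_nonneg _)

/-- `u` is a bounded curve in `H²(0, L)` with second derivative `uxx`, whose increments are
controlled by `m`. -/
structure IsH2Curve (T A : ℝ) (m : ℝ → ℝ) (u : ℝ → H10 L) (uxx : ℝ → L2 L) : Prop where
  weak : ∀ t ∈ Icc 0 T, IsWeakDeriv (dx (u t).1) (uxx t)
  norm_dx_le : ∀ t ∈ Icc 0 T, ‖dx (u t).1‖ ≤ A
  norm_le : ∀ t ∈ Icc 0 T, ‖uxx t‖ ≤ A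
  modulus : HasModulus T m (fun t => (u t).1)
  modulus_xx : HasModulus T m uxx

/-- `U` is the velocity of `u` in `H¹₀(0, L)`, and its increments are controlled by `m`. -/
structure IsVelocity (T A : ℝ) (m : ℝ → ℝ) (u U : ℝ → H10 L) (ξ : ℝ → L2 L) : Prop where
  fn_eq : ∀ t ∈ Icc 0 T, fn (U t).1 = ξ t
  norm_dx_le : ∀ t ∈ Icc 0 T, ‖dx (U t).1‖ ≤ A
  modulus : HasModulus T m (fun t => (U t).1)
  hasDeriv : ∀ t ∈ Icc 0 T, HasDerivWithinAt (fun s => (u s).1) (U t).1 (Icc 0 T) t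

theorem IsH2Curve.mono {T A A' : ℝ} {m m' : ℝ → ℝ} {u : ℝ → H10 L} {uxx : ℝ → L2 L}
    (h : IsH2Curve T A m u uxx) (hA : A ≤ A') (hm : IsWeight T m) (hm' : IsWeight T m')
    (hle : ∀ t, m t ≤ m' t) : IsH2Curve T A' m' u uxx :=
  ⟨h.weak, fun t ht => (h.norm_dx_le t ht).trans hA, fun t ht => (h.norm_le t ht).trans hA,
    h.modulus.mono hm hm' hle, h.modulus_xx.mono hm hm' hle⟩

theorem IsVelocity.mono {T A A' : ℝ} {m m' : ℝ → ℝ} {u U : ℝ → H10 L} {ξ : ℝ → L2 L}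
    (h : IsVelocity T A m u U ξ) (hA : A ≤ A') (hm : IsWeight T m) (hm' : IsWeight T m')
    (hle : ∀ t, m t ≤ m' t) : IsVelocity T A' m' u U ξ :=
  ⟨h.fn_eq, fun t ht => (h.norm_dx_le t ht).trans hA, h.modulus.mono hm hm' hle, h.hasDeriv⟩

/-- The `H²`-valued curve is given only up to null sets of times. Its continuous representative
agrees with the continuous curve `u` at every `t ∈ [0, T]`, so the second derivative makes sense at
the time levels `t_n`. -/
theorem exists_isH2Curve {T : ℝ} (hT : 0 < T) {u : ℝ → H10 L} (hu : ContinuousOn u (Icc 0 T))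
    {p : ℝ≥0∞} (hp : 2 ≤ p) (h : MemTimeSobolevH2 T 1 p (fun t => (u t : H1 L))) :
    ∃ (A : ℝ) (m : ℝ → ℝ) (uxx : ℝ → L2 L), 0 ≤ A ∧ IsWeight T m ∧ IsH2Curve T A m u uxx := by
  obtain ⟨g, hg, hg'⟩ := h
  obtain ⟨G, hG, hae, m, hmw, hmod⟩ := hg'.exists_continuous_hasModulus hT hp zero_lt_one
  have hcH1 : Continuous (H2.toH1 (L := L)) :=
    (WithLp.continuous_fst 2 (H1 L) (L2 L)).comp continuous_subtype_val
  have heq : EqOn (fun t => (u t).1) (fun t => (G t).toH1) (Icc 0 T) := by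
    refine eqOn_Icc_of_ae_eq_Ioo hT ?_ (continuous_subtype_val.comp_continuousOn hu)
      (hcH1.comp hG)
    filter_upwards [hg, hae] with t h1 h2
    rw [← h2, h1]
  obtain ⟨A, hA⟩ := isCompact_Icc.exists_bound_of_continuousOn (hG.continuousOn (s := Icc 0 T))
  have hA0 : 0 ≤ A := (norm_nonneg _).trans (hA 0 (left_mem_Icc.2 hT.le))
  have hval : ∀ t ∈ Icc 0 T, (u t).1 = (G t).toH1 := heq
  refine ⟨A, m, fun t => dxx (G t), hA0, hmw, ?_, ?_, ?_, ?_, ?_⟩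
  · intro t ht
    rw [hval t ht]
    exact (G t).2
  · intro t ht
    rw [hval t ht]
    exact (ShearBeam.norm_dx_le _).trans ((norm_toH1_le _).trans (hA t ht))
  · exact fun t ht => (norm_dxx_le _).trans (hA t ht)
  · refine hmod.of_norm_sub_le fun s hs t ht => ?_
    rw [hval t ht, hval s hs]
    exact norm_toH1_le (G t - G s)
  · exact hmod.of_norm_sub_le fun s hs t ht => norm_dxx_le (G t - G s)

/-- The first weak time derivative in `H¹` has a continuous representative `G`, and `u` is a
primitive of it; hence `u` is differentiable in `H¹`, not only in `L²`. The velocity must moreover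
lie in `H¹₀` for its Ritz projection to make sense. -/
theorem exists_isVelocity (hL : 0 < L) {T : ℝ} (hT : 0 < T) {u : ℝ → H10 L} {ξ : ℝ → L2 L}
    (hu : IsC1Curve T u ξ) (h : MemTimeSobolev T 2 2 (fun t => (u t : H1 L))) :
    ∃ (A : ℝ) (m : ℝ → ℝ) (U : ℝ → H10 L), 0 ≤ A ∧ IsWeight T m ∧ IsVelocity T A m u U ξ := by
  obtain ⟨d, hd0, hm, hd⟩ := h
  obtain ⟨F, hF, hFae, hFsub, -⟩ :=
    exists_continuous_primitive_of_memLp hT le_rfl hm hd zero_lt_two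
  obtain ⟨G, hG, hGae, -, m, hmw, hmod⟩ :=
    exists_continuous_primitive_of_memLp hT le_rfl hm hd one_lt_two
  rw [hd0] at hFae
  have heqF : EqOn (fun t => (u t).1) F (Icc 0 T) :=
    eqOn_Icc_of_ae_eq_Ioo hT hFae (continuous_subtype_val.comp_continuousOn hu.cont) hF
  have heqG : ∀ t ∈ Icc 0 T, (u t).1 = F 0 + ∫ s in (0 : ℝ)..t, G s := by
    intro t ht
    have h1 := hFsub 0 t le_rfl ht.1 ht.2
    have h2 : ∫ s in (0 : ℝ)..t, d (0 + 1) s = ∫ s in (0 : ℝ)..t, G s := by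
      rw [← integral_Ioo_eq ht.1, ← integral_Ioo_eq ht.1]
      exact integral_congr_ae (ae_restrict_of_ae_restrict_of_subset
        (Ioo_subset_Ioo le_rfl ht.2) hGae)
    rw [← h2, ← h1]
    simpa using heqF ht
  have hder : ∀ t ∈ Icc 0 T, HasDerivWithinAt (fun s => (u s).1) (G t) (Icc 0 T) t := by
    intro t ht
    have h1 : HasDerivAt (fun t => F 0 + ∫ s in (0 : ℝ)..t, G s) (G t) t :=
      (hasDerivAt_primitive hG t).const_add _
    exact h1.hasDerivWithinAt.congr heqG (heqG t ht)
  have huniq : UniqueDiffOn ℝ (Icc 0 T) := uniqueDiffOn_Icc hT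
  -- Integration by parts against a fixed `w ∈ H¹` has no boundary term for each `u(s)`;
  -- differentiating this identity in `s` gives the same for `G t`.
  have hmem : ∀ t ∈ Icc 0 T, G t ∈ H10Submodule L := by
    intro t ht
    refine mem_H10_of_inner_eq hL _ fun w => ?_
    have h1 : HasDerivWithinAt (fun s => inner ℝ (fn w) (dx (u s).1) + inner ℝ (dx w) (fn (u s).1))
        (inner ℝ (fn w) (dx (G t)) + inner ℝ (dx w) (fn (G t))) (Icc 0 T) t :=
      (((innerSL ℝ (fn w)).comp (dxCLM L)).hasFDerivAt.comp_hasDerivWithinAt t (hder t ht)).add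
        (((innerSL ℝ (dx w)).comp (fnCLM L)).hasFDerivAt.comp_hasDerivWithinAt t (hder t ht))
    have h2 : (fun s => inner ℝ (fn w) (dx (u s).1) + inner ℝ (dx w) (fn (u s).1))
        = fun _ => (0 : ℝ) := by
      ext s
      have := IsWeakDeriv.inner_eq_neg hL w.2 (u s)
      change inner ℝ (dx w) _ = -inner ℝ (fn w) _ at this
      rw [this]; ring
    rw [h2] at h1
    have h3 := (huniq t ht).eq_deriv _ h1 (hasDerivWithinAt_const t _ 0)
    rw [real_inner_comm, real_inner_comm (dx w)]
    exact h3
  obtain ⟨A, hA⟩ := isCompact_Icc.exists_bound_of_continuousOn (hG.continuousOn (s := Icc 0 T))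
  have hA0 : 0 ≤ A := (norm_nonneg _).trans (hA 0 (left_mem_Icc.2 hT.le))
  classical
  -- The value outside `[0, T]` is arbitrary.
  let U : ℝ → H10 L := fun t => if ht : t ∈ Icc 0 T then ⟨G t, hmem t ht⟩ else 0
  have hU : ∀ t ∈ Icc 0 T, (U t).1 = G t := fun t ht => by simp only [U, dif_pos ht]
  refine ⟨A, m, U, hA0, hmw, ?_, ?_, ?_, ?_⟩
  · intro t ht
    rw [hU t ht]
    exact (huniq t ht).eq_deriv _
      ((fnCLM L).hasFDerivAt.comp_hasDerivWithinAt t (hder t ht)) (hu.hasDeriv t ht)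
  · intro t ht
    rw [hU t ht]
    exact (norm_dx_le _).trans (hA t ht)
  · refine hmod.of_norm_sub_le fun s hs t ht => ?_
    rw [hU t ht, hU s hs]
  · intro t ht
    rw [hU t ht]
    exact hder t ht

end TimeRegularity

/-! ### Consistency of the backward difference quotient. -/

section Consistency

variable {L : ℝ}

theorem norm_sub_le_integral_of_mem {B : Type*} [NormedAddCommGroup B] {T : ℝ} {m : ℝ → ℝ}
    {f : ℝ → B} (hm : IsWeight T m) (hf : HasModulus T m f) {s₀ s₁ s : ℝ} (h0 : 0 ≤ s₀)
    (h1 : s₁ ≤ T) (hs : s ∈ Icc s₀ s₁) : ‖f s - f s₁‖ ≤ ∫ r in s₀..s₁, m r := by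
  rw [norm_sub_rev]
  refine (hf s s₁ (h0.trans hs.1) hs.2 h1).trans ?_
  have hi := intervalIntegrable_of_Ioo hm.integrableOn h0 hs.1 (hs.2.trans h1)
  have hi' := intervalIntegrable_of_Ioo hm.integrableOn (h0.trans hs.1) hs.2 h1
  rw [← intervalIntegral.integral_add_adjacent_intervals hi hi']
  have := intervalIntegral.integral_nonneg (f := m) (μ := volume) hs.1 fun r _ => hm.nonneg r
  linarith

/-- The mean value inequality for `s ↦ f s − s f'(s₁)`, whose derivative `f' s − f' s₁` is at most
`ε`. -/
theorem norm_sub_sub_smul_le {B : Type*} [NormedAddCommGroup B] [NormedSpace ℝ B] {T ε : ℝ}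
    {f f' : ℝ → B} (hf : ∀ t ∈ Icc 0 T, HasDerivWithinAt f (f' t) (Icc 0 T) t) {s₀ s₁ : ℝ}
    (h0 : 0 ≤ s₀) (h01 : s₀ ≤ s₁) (h1 : s₁ ≤ T) (hε : ∀ s ∈ Icc s₀ s₁, ‖f' s - f' s₁‖ ≤ ε) :
    ‖f s₁ - f s₀ - (s₁ - s₀) • f' s₁‖ ≤ ε * (s₁ - s₀) := by
  have hsub : Icc s₀ s₁ ⊆ Icc 0 T := Icc_subset_Icc h0 h1
  have hd : ∀ s ∈ Icc s₀ s₁,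
      HasDerivWithinAt (fun s => f s - s • f' s₁) (f' s - f' s₁) (Icc s₀ s₁) s := by
    intro s hs
    have h2 : HasDerivWithinAt (fun s : ℝ => s • f' s₁) ((1 : ℝ) • f' s₁) (Icc s₀ s₁) s :=
      (hasDerivWithinAt_id s _).smul_const _
    rw [one_smul] at h2
    exact ((hf s (hsub hs)).mono hsub).sub h2
  have h3 := (convex_Icc s₀ s₁).norm_image_sub_le_of_norm_hasDerivWithin_le hd hε
    (left_mem_Icc.2 h01) (right_mem_Icc.2 h01)
  rw [Real.norm_of_nonneg (sub_nonneg.2 h01)] at h3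
  convert h3 using 2
  rw [sub_smul]; abel

theorem abs_slope_add_le {T ε : ℝ} {G F : ℝ → ℝ}
    (hG : ∀ t ∈ Icc 0 T, HasDerivWithinAt G (-(F t)) (Icc 0 T) t) {s₀ s₁ : ℝ}
    (h0 : 0 ≤ s₀) (h01 : s₀ < s₁) (h1 : s₁ ≤ T) (hε : ∀ s ∈ Icc s₀ s₁, |F s - F s₁| ≤ ε) :
    |(G s₁ - G s₀) / (s₁ - s₀) + F s₁| ≤ ε := by
  have h := norm_sub_sub_smul_le hG h0 h01.le h1 (ε := ε) (fun s hs => by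
    rw [neg_sub_neg, Real.norm_eq_abs, abs_sub_comm]; exact hε s hs)
  have hτ : 0 < s₁ - s₀ := sub_pos.2 h01
  have heq : (G s₁ - G s₀) / (s₁ - s₀) + F s₁
      = (G s₁ - G s₀ - (s₁ - s₀) • -F s₁) / (s₁ - s₀) := by
    rw [smul_eq_mul]; field_simp; ring
  rw [heq, abs_div, abs_of_pos hτ, div_le_iff₀ hτ]
  exact h

theorem abs_inner_le_of_norm_le {H : Type*} [NormedAddCommGroup H] [InnerProductSpace ℝ H]
    {x y : H} {C : ℝ} (hx : ‖x‖ ≤ C) : |inner ℝ x y| ≤ C * ‖y‖ :=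
  (abs_real_inner_le_norm x y).trans (mul_le_mul_of_nonneg_right hx (norm_nonneg y))

/-- The exact solution with the regularity that the error analysis uses: `A` bounds the norms, `m`
controls the increments in time, and `U, V, W` are the velocities as elements of `H¹₀(0, L)`. -/
structure IsSmoothSolution (c : Coeffs) (T A : ℝ) (m : ℝ → ℝ) (I : InitialData L)
    (u φ ψ w U V W : ℝ → H10 L) (uxx φxx ψxx wxx ξ Φ ϑ : ℝ → L2 L) : Prop where
  sol : IsWeakSolution c T I u φ ψ w ξ Φ ϑ
  A_nonneg : 0 ≤ A
  weight : IsWeight T m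
  curve_u : IsH2Curve T A m u uxx
  curve_φ : IsH2Curve T A m φ φxx
  curve_ψ : IsH2Curve T A m ψ ψxx
  curve_w : IsH2Curve T A m w wxx
  vel_u : IsVelocity T A m u U ξ
  vel_φ : IsVelocity T A m φ V Φ
  vel_w : IsVelocity T A m w W ϑ

theorem HasModulus.fn {T : ℝ} {m : ℝ → ℝ} {u : ℝ → H10 L}
    (h : HasModulus T m (fun t => (u t).1)) : HasModulus T m (fun t => fn (u t).1) :=
  h.of_norm_sub_le fun s _ t _ => norm_fn_le ((u t).1 - (u s).1)

theorem HasModulus.dx {T : ℝ} {m : ℝ → ℝ} {u : ℝ → H10 L}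
    (h : HasModulus T m (fun t => (u t).1)) : HasModulus T m (fun t => dx (u t).1) :=
  h.of_norm_sub_le fun s _ t _ => norm_dx_le ((u t).1 - (u s).1)

theorem IsVelocity.modulus_fn {T A : ℝ} {m : ℝ → ℝ} {u U : ℝ → H10 L} {ξ : ℝ → L2 L}
    (h : IsVelocity T A m u U ξ) : HasModulus T m ξ :=
  h.modulus.fn.of_norm_sub_le fun s hs t ht => by rw [h.fn_eq s hs, h.fn_eq t ht]

section Exact

variable {c : Coeffs} {T A : ℝ} {m : ℝ → ℝ} {I : InitialData L}
  {u φ ψ w U V W : ℝ → H10 L} {uxx φxx ψxx wxx ξ Φ ϑ : ℝ → L2 L} {s₀ s₁ : ℝ}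

/-- The time derivative acts on the scalar `ρ (u_t, v)`, so `abs_slope_add_le` leaves only the
oscillation of the other terms over the step. Integrating by parts turns `(u_x, v_x)` into `−(u_xx,
v)`; this is why `‖v‖` and not `‖v_x‖` appears on the right. -/
theorem IsSmoothSolution.consistency_u (hL : 0 < L) (hc : c.Admissible)
    (S : IsSmoothSolution c T A m I u φ ψ w U V W uxx φxx ψxx wxx ξ Φ ϑ)
    (h0 : 0 ≤ s₀) (h01 : s₀ < s₁) (h1 : s₁ ≤ T) (v : H10 L) :
    |c.ρ / (s₁ - s₀) * inner ℝ (fn (U s₁).1 - fn (U s₀).1) (fn v.1)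
      + c.α * inner ℝ (dx (u s₁).1) (dx v.1)
      - c.lam * inner ℝ (fn (φ s₁).1 - fn (u s₁).1) (fn v.1)
      + c.μ * inner ℝ (fn (U s₁).1) (fn v.1)|
      ≤ (c.α + 2 * c.lam + c.μ) * (∫ r in s₀..s₁, m r) * ‖fn v.1‖ := by
  have hs₀ : s₀ ∈ Icc 0 T := ⟨h0, h01.le.trans h1⟩
  have hs₁ : s₁ ∈ Icc 0 T := ⟨h0.trans h01.le, h1⟩
  have key := abs_slope_add_le (S.sol.eq_u v) h0 h01 h1
    (ε := (c.α + 2 * c.lam + c.μ) * (∫ r in s₀..s₁, m r) * ‖fn v.1‖) ?_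
  · rw [S.vel_u.fn_eq _ hs₀, S.vel_u.fn_eq _ hs₁]
    convert key using 2
    rw [inner_sub_left]; ring
  · intro s hs
    have hsT : s ∈ Icc 0 T := Icc_subset_Icc h0 h1 hs
    set a := ∫ r in s₀..s₁, m r
    have e1 := IsWeakDeriv.inner_eq_neg hL (S.curve_u.weak s hsT) v
    have e2 := IsWeakDeriv.inner_eq_neg hL (S.curve_u.weak s₁ hs₁) v
    have b1 := abs_le.1 (abs_inner_le_of_norm_le (y := fn v.1)
      (norm_sub_le_integral_of_mem S.weight S.curve_u.modulus_xx h0 h1 hs))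
    have b2 := abs_le.1 (abs_inner_le_of_norm_le (y := fn v.1)
      (norm_sub_le_integral_of_mem S.weight S.curve_u.modulus.fn h0 h1 hs))
    have b3 := abs_le.1 (abs_inner_le_of_norm_le (y := fn v.1)
      (norm_sub_le_integral_of_mem S.weight S.curve_φ.modulus.fn h0 h1 hs))
    have b4 := abs_le.1 (abs_inner_le_of_norm_le (y := fn v.1)
      (norm_sub_le_integral_of_mem S.weight S.vel_u.modulus_fn h0 h1 hs))
    simp only [inner_sub_left] at b1 b2 b3 b4 ⊢
    have := hc.α_pos
    have := hc.lam_pos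
    have := hc.μ_pos
    rw [abs_le]
    constructor <;> nlinarith

/-- As for `u`. The coupling `β (w_x, v)` sits under the time derivative of the weak form, so it
enters as a difference quotient of `w_x` instead of the velocity. The constant `2 K` comes from
integrating both parts of `(φ_x + ψ, v_x)` by parts. -/
theorem IsSmoothSolution.consistency_φ (hL : 0 < L) (hc : c.Admissible)
    (S : IsSmoothSolution c T A m I u φ ψ w U V W uxx φxx ψxx wxx ξ Φ ϑ)
    (h0 : 0 ≤ s₀) (h01 : s₀ < s₁) (h1 : s₁ ≤ T) (v : H10 L) :
    |c.ρ₁ / (s₁ - s₀) * inner ℝ (fn (V s₁).1 - fn (V s₀).1) (fn v.1)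
      + c.K * inner ℝ (dx (φ s₁).1 + fn (ψ s₁).1) (dx v.1)
      + c.lam * inner ℝ (fn (φ s₁).1 - fn (u s₁).1) (fn v.1)
      + c.γ * inner ℝ (fn (V s₁).1) (fn v.1)
      + c.β * inner ℝ ((s₁ - s₀)⁻¹ • (dx (w s₁).1 - dx (w s₀).1)) (fn v.1)|
      ≤ (2 * c.K + 2 * c.lam + c.γ) * (∫ r in s₀..s₁, m r) * ‖fn v.1‖ := by
  have hs₀ : s₀ ∈ Icc 0 T := ⟨h0, h01.le.trans h1⟩
  have hs₁ : s₁ ∈ Icc 0 T := ⟨h0.trans h01.le, h1⟩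
  have key := abs_slope_add_le (S.sol.eq_φ v) h0 h01 h1
    (ε := (2 * c.K + 2 * c.lam + c.γ) * (∫ r in s₀..s₁, m r) * ‖fn v.1‖) ?_
  · rw [S.vel_φ.fn_eq _ hs₀, S.vel_φ.fn_eq _ hs₁]
    convert key using 2
    simp only [real_inner_smul_left, inner_sub_left]; ring
  · intro s hs
    have hsT : s ∈ Icc 0 T := Icc_subset_Icc h0 h1 hs
    set a := ∫ r in s₀..s₁, m r
    have e1 := IsWeakDeriv.inner_eq_neg hL (S.curve_φ.weak s hsT) v
    have e2 := IsWeakDeriv.inner_eq_neg hL (S.curve_φ.weak s₁ hs₁) v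
    have e3 : inner ℝ (dx (ψ s).1) (fn v.1) = -inner ℝ (fn (ψ s).1) (dx v.1) :=
      IsWeakDeriv.inner_eq_neg hL (ψ s).1.2 v
    have e4 : inner ℝ (dx (ψ s₁).1) (fn v.1) = -inner ℝ (fn (ψ s₁).1) (dx v.1) :=
      IsWeakDeriv.inner_eq_neg hL (ψ s₁).1.2 v
    have b1 := abs_le.1 (abs_inner_le_of_norm_le (y := fn v.1)
      (norm_sub_le_integral_of_mem S.weight S.curve_φ.modulus_xx h0 h1 hs))
    have b2 := abs_le.1 (abs_inner_le_of_norm_le (y := fn v.1)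
      (norm_sub_le_integral_of_mem S.weight S.curve_u.modulus.fn h0 h1 hs))
    have b3 := abs_le.1 (abs_inner_le_of_norm_le (y := fn v.1)
      (norm_sub_le_integral_of_mem S.weight S.curve_φ.modulus.fn h0 h1 hs))
    have b4 := abs_le.1 (abs_inner_le_of_norm_le (y := fn v.1)
      (norm_sub_le_integral_of_mem S.weight S.vel_φ.modulus_fn h0 h1 hs))
    have b5 := abs_le.1 (abs_inner_le_of_norm_le (y := fn v.1)
      (norm_sub_le_integral_of_mem S.weight S.curve_ψ.modulus.dx h0 h1 hs))
    simp only [inner_sub_left, inner_add_left] at b1 b2 b3 b4 b5 ⊢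
    have := hc.K_pos
    have := hc.lam_pos
    have := hc.γ_pos
    rw [abs_le]
    constructor <;> nlinarith

theorem IsSmoothSolution.consistency_w (hL : 0 < L) (hc : c.Admissible)
    (S : IsSmoothSolution c T A m I u φ ψ w U V W uxx φxx ψxx wxx ξ Φ ϑ)
    (h0 : 0 ≤ s₀) (h01 : s₀ < s₁) (h1 : s₁ ≤ T) (v : H10 L) :
    |c.ρ₃ / (s₁ - s₀) * inner ℝ (fn (W s₁).1 - fn (W s₀).1) (fn v.1)
      + c.δ * inner ℝ (dx (w s₁).1) (dx v.1)
      + c.β * inner ℝ ((s₁ - s₀)⁻¹ • (dx (φ s₁).1 - dx (φ s₀).1)) (fn v.1)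
      + c.κ * inner ℝ ((s₁ - s₀)⁻¹ • (dx (w s₁).1 - dx (w s₀).1)) (dx v.1)|
      ≤ c.δ * (∫ r in s₀..s₁, m r) * ‖fn v.1‖ := by
  have hs₀ : s₀ ∈ Icc 0 T := ⟨h0, h01.le.trans h1⟩
  have hs₁ : s₁ ∈ Icc 0 T := ⟨h0.trans h01.le, h1⟩
  have key := abs_slope_add_le (S.sol.eq_w v) h0 h01 h1
    (ε := c.δ * (∫ r in s₀..s₁, m r) * ‖fn v.1‖) ?_
  · rw [S.vel_w.fn_eq _ hs₀, S.vel_w.fn_eq _ hs₁]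
    convert key using 2
    simp only [real_inner_smul_left, inner_sub_left]; ring
  · intro s hs
    have hsT : s ∈ Icc 0 T := Icc_subset_Icc h0 h1 hs
    set a := ∫ r in s₀..s₁, m r
    have e1 := IsWeakDeriv.inner_eq_neg hL (S.curve_w.weak s hsT) v
    have e2 := IsWeakDeriv.inner_eq_neg hL (S.curve_w.weak s₁ hs₁) v
    have b1 := abs_le.1 (abs_inner_le_of_norm_le (y := fn v.1)
      (norm_sub_le_integral_of_mem S.weight S.curve_w.modulus_xx h0 h1 hs))
    simp only [inner_sub_left] at b1 ⊢
    have := hc.δ_pos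
    rw [abs_le]
    constructor <;> nlinarith

end Exact

theorem IsWeakDeriv.sub {f g f' g' : L2 L} (h : IsWeakDeriv f g) (h' : IsWeakDeriv f' g') :
    IsWeakDeriv (f - f') (g - g') := by
  rw [isWeakDeriv_iff_inner] at *
  intro ζ hζ h₀ h₁
  have e := h ζ hζ h₀ h₁
  have e' := h' ζ hζ h₀ h₁
  rw [inner_sub_right, inner_sub_right]
  linarith

theorem sub_inv_smul_eq {H : Type*} [AddCommGroup H] [Module ℝ H] {r : ℝ} (hr : r ≠ 0)
    (x y : H) : x - r⁻¹ • y = (-r⁻¹) • (y - r • x) := by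
  rw [smul_sub, smul_smul, neg_mul, inv_mul_cancel₀ hr, neg_smul, neg_smul, one_smul]
  abel

section Velocities

variable {T A : ℝ} {m : ℝ → ℝ} {u U : ℝ → H10 L} {uxx ξ : ℝ → L2 L} {s₀ s₁ : ℝ} {M : ℕ}

/-- The projected defect of the backward difference quotient as an approximation of the
velocity. -/
def defect (M : ℕ) (u U : ℝ → H10 L) (s₀ s₁ : ℝ) : H10 L :=
  ritz M (U s₁ - (s₁ - s₀)⁻¹ • (u s₁ - u s₀))

theorem norm_dx_velocity_sub_le (hm : IsWeight T m) (hU : IsVelocity T A m u U ξ)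
    (h0 : 0 ≤ s₀) (h01 : s₀ < s₁) (h1 : s₁ ≤ T) :
    ‖dx (U s₁ - (s₁ - s₀)⁻¹ • (u s₁ - u s₀)).1‖ ≤ ∫ r in s₀..s₁, m r := by
  have hτ : 0 < s₁ - s₀ := sub_pos.2 h01
  have h := norm_sub_sub_smul_le hU.hasDeriv h0 h01.le h1
    (fun s hs => norm_sub_le_integral_of_mem hm hU.modulus h0 h1 hs)
  refine (norm_dx_le _).trans ?_
  have heq : ((U s₁ - (s₁ - s₀)⁻¹ • (u s₁ - u s₀) : H10 L) : H1 L)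
      = (-(s₁ - s₀)⁻¹) • ((u s₁).1 - (u s₀).1 - (s₁ - s₀) • (U s₁).1) := by
    exact sub_inv_smul_eq hτ.ne' (U s₁).1 ((u s₁).1 - (u s₀).1)
  rw [heq, norm_smul, norm_neg, Real.norm_of_nonneg (inv_nonneg.2 hτ.le), inv_mul_le_iff₀ hτ,
    mul_comm]
  exact h

theorem norm_dx_defect_le (hL : 0 < L) (hM : 0 < M) (hm : IsWeight T m)
    (hU : IsVelocity T A m u U ξ) (h0 : 0 ≤ s₀) (h01 : s₀ < s₁) (h1 : s₁ ≤ T) :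
    ‖dx (defect M u U s₀ s₁).1‖ ≤ ∫ r in s₀..s₁, m r :=
  (norm_dx_ritz_le hL hM _).trans (norm_dx_velocity_sub_le hm hU h0 h01 h1)

/-- Insert the Ritz projection of the difference quotient `d`. The projection of `W − d` costs `a`.
The projection error of `d` costs `h` times the increment of the second derivative divided by `τ`,
which is the source of the term `h a / τ`. -/
theorem norm_dx_ritz_velocity_sub_le (hL : 0 < L) (hM : 0 < M) (hm : IsWeight T m)
    (hu : IsH2Curve T A m u uxx)
    (hU : IsVelocity T A m u U ξ) (h0 : 0 ≤ s₀) (h01 : s₀ < s₁) (h1 : s₁ ≤ T) :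
    ‖dx (ritz M (U s₁)).1 - (s₁ - s₀)⁻¹ • (dx (u s₁).1 - dx (u s₀).1)‖
      ≤ (∫ r in s₀..s₁, m r) + L / M * (∫ r in s₀..s₁, m r) / (s₁ - s₀) := by
  have hM' : (0 : ℝ) < M := by exact_mod_cast hM
  have hτ : 0 < s₁ - s₀ := sub_pos.2 h01
  have hs₀ : s₀ ∈ Icc 0 T := ⟨h0, h01.le.trans h1⟩
  have hs₁ : s₁ ∈ Icc 0 T := ⟨h0.trans h01.le, h1⟩
  set d : H10 L := (s₁ - s₀)⁻¹ • (u s₁ - u s₀) with hd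
  have hdec : dx (ritz M (U s₁)).1 - (s₁ - s₀)⁻¹ • (dx (u s₁).1 - dx (u s₀).1)
      = dx (ritz M (U s₁ - d)).1 + dx (ritz M d - d).1 := by
    rw [ritz_sub hL hM]
    change _ = (dx (ritz M (U s₁)).1 - dx (ritz M d).1) + (dx (ritz M d).1 - dx d.1)
    rw [sub_add_sub_cancel]
    rfl
  have hwd : IsWeakDeriv (dx (u s₁ - u s₀).1) (uxx s₁ - uxx s₀) :=
    (hu.weak s₁ hs₁).sub (hu.weak s₀ hs₀)
  have hr : dx (ritz M d - d).1 = (s₁ - s₀)⁻¹ • dx (ritz M (u s₁ - u s₀) - (u s₁ - u s₀)).1 := by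
    rw [hd, ritz_smul hL hM]
    exact (smul_sub _ (dx (ritz M (u s₁ - u s₀)).1) (dx (u s₁ - u s₀).1)).symm
  rw [hdec]
  refine (norm_add_le _ _).trans (add_le_add (norm_dx_defect_le hL hM hm hU h0 h01 h1) ?_)
  rw [hr, norm_smul, Real.norm_of_nonneg (inv_nonneg.2 hτ.le), inv_mul_le_iff₀ hτ]
  refine (norm_dx_ritz_sub_le_of_isWeakDeriv hL hM _ hwd).trans ?_
  rw [mul_div_cancel₀ _ hτ.ne']
  refine mul_le_mul_of_nonneg_left ?_ (by positivity)
  rw [norm_sub_rev]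
  exact norm_sub_le_integral_of_mem hm hu.modulus_xx h0 h1 (left_mem_Icc.2 h01.le)

theorem norm_fn_ritz_sub_sub_le (hL : 0 < L) (hM : 0 < M) (hm : IsWeight T m)
    (hU : HasModulus T m (fun t => (U t).1)) (h0 : 0 ≤ s₀) (h01 : s₀ < s₁) (h1 : s₁ ≤ T) :
    ‖fn (ritz M (U s₁)).1 - fn (U s₁).1 - (fn (ritz M (U s₀)).1 - fn (U s₀).1)‖
      ≤ L / M * ∫ r in s₀..s₁, m r := by
  have hM' : (0 : ℝ) < M := by exact_mod_cast hM
  have h := norm_fn_ritz_sub_le hL hM (U s₁ - U s₀)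
  have heq : fn (ritz M (U s₁ - U s₀) - (U s₁ - U s₀)).1
      = fn (ritz M (U s₁)).1 - fn (U s₁).1 - (fn (ritz M (U s₀)).1 - fn (U s₀).1) := by
    rw [ritz_sub hL hM]
    change (fn (ritz M (U s₁)).1 - fn (ritz M (U s₀)).1) - (fn (U s₁).1 - fn (U s₀).1) = _
    abel
  rw [heq] at h
  refine h.trans (mul_le_mul_of_nonneg_left ?_ (by positivity))
  have := norm_sub_le_integral_of_mem hm hU.dx h0 h1 (left_mem_Icc.2 h01.le)
  rw [norm_sub_rev] at this
  exact this

theorem norm_dx_ritz_sub_sub_le (hL : 0 < L) (hM : 0 < M) (hm : IsWeight T m)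
    (hu : IsH2Curve T A m u uxx) (h0 : 0 ≤ s₀) (h01 : s₀ < s₁) (h1 : s₁ ≤ T) :
    ‖dx (ritz M (u s₁)).1 - dx (u s₁).1 - (dx (ritz M (u s₀)).1 - dx (u s₀).1)‖
      ≤ L / M * ∫ r in s₀..s₁, m r := by
  have hM' : (0 : ℝ) < M := by exact_mod_cast hM
  have hs₀ : s₀ ∈ Icc 0 T := ⟨h0, h01.le.trans h1⟩
  have hs₁ : s₁ ∈ Icc 0 T := ⟨h0.trans h01.le, h1⟩
  have hwd : IsWeakDeriv (dx (u s₁ - u s₀).1) (uxx s₁ - uxx s₀) :=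
    (hu.weak s₁ hs₁).sub (hu.weak s₀ hs₀)
  have h := norm_dx_ritz_sub_le_of_isWeakDeriv hL hM _ hwd
  have heq : dx (ritz M (u s₁ - u s₀) - (u s₁ - u s₀)).1
      = dx (ritz M (u s₁)).1 - dx (u s₁).1 - (dx (ritz M (u s₀)).1 - dx (u s₀).1) := by
    rw [ritz_sub hL hM]
    change (dx (ritz M (u s₁)).1 - dx (ritz M (u s₀)).1) - (dx (u s₁).1 - dx (u s₀).1) = _
    abel
  rw [heq] at h
  refine h.trans (mul_le_mul_of_nonneg_left ?_ (by positivity))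
  have := norm_sub_le_integral_of_mem hm hu.modulus_xx h0 h1 (left_mem_Icc.2 h01.le)
  rw [norm_sub_rev] at this
  exact this

end Velocities

end Consistency

/-! ### Equations for the difference between discrete solution and Ritz projection. -/

section Residuals

variable {L : ℝ}

theorem fn_coe_sub (v w : H10 L) : fn (v - w : H10 L).1 = fn v.1 - fn w.1 := rfl
theorem dx_coe_sub (v w : H10 L) : dx (v - w : H10 L).1 = dx v.1 - dx w.1 := rfl
theorem fn_coe_add (v w : H10 L) : fn (v + w : H10 L).1 = fn v.1 + fn w.1 := rfl
theorem dx_coe_add (v w : H10 L) : dx (v + w : H10 L).1 = dx v.1 + dx w.1 := rfl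
theorem fn_coe_smul (r : ℝ) (v : H10 L) : fn (r • v : H10 L).1 = r • fn v.1 := rfl
theorem dx_coe_smul (r : ℝ) (v : H10 L) : dx (r • v : H10 L).1 = r • dx v.1 := rfl

theorem abs_mul_le_mul {k x B : ℝ} (hk : 0 ≤ k) (h : |x| ≤ B) : |k * x| ≤ k * B := by
  rw [abs_mul, abs_of_nonneg hk]; exact mul_le_mul_of_nonneg_left h hk

theorem abs_mul_le_abs_mul (k : ℝ) {x B : ℝ} (h : |x| ≤ B) : |k * x| ≤ |k| * B := by
  rw [abs_mul]; exact mul_le_mul_of_nonneg_left h (abs_nonneg k)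

/-- The size of the residuals on a step of length `τ` with increment bound `a`. -/
def stepSize (h τ a : ℝ) : ℝ := a + h * a / τ + h

/-- A bound for the constants in the residual estimates. -/
def residualConst (c : Coeffs) (A : ℝ) : ℝ :=
  c.ρ + c.ρ₁ + c.ρ₃ + c.α + 4 * c.lam + c.μ + c.γ + 2 * c.K + c.δ + 2 * |c.β| + c.κ
    + (4 * c.lam + c.μ + c.γ + c.K) * A

theorem norm_fn_ritz_sub_le_of_le (hL : 0 < L) {M : ℕ} (hM : 0 < M) {η : H10 L} {A s : ℝ}
    (hA : ‖dx η.1‖ ≤ A) (hs : L / M ≤ s) : ‖fn (ritz M η).1 - fn η.1‖ ≤ s * A := by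
  have hM' : (0 : ℝ) < M := by exact_mod_cast hM
  have hh : 0 < L / M := by positivity
  refine (norm_fn_ritz_sub_le hL hM η).trans ?_
  have := norm_nonneg (dx η.1)
  gcongr
  linarith

variable {c : Coeffs} {T A : ℝ} {m : ℝ → ℝ} {I : InitialData L}
  {u φ ψ w U V W : ℝ → H10 L} {uxx φxx ψxx wxx ξ Φ ϑ : ℝ → L2 L} {s₀ s₁ : ℝ}
  {M N n : ℕ} {uh φh ψh wh ξh Φh ϑh : ℕ → H10 L}

/-- Subtract the consistency estimate from the scheme. The stiffness term of the projection error
vanishes by the definition of the Ritz projection; the mass terms cost `h`, and the difference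
quotient of the projection error of the velocity costs `h a / τ`. -/
theorem residual_u_le (hL : 0 < L) (hM : 0 < M) (hc : c.Admissible)
    (S : IsSmoothSolution c T A m I u φ ψ w U V W uxx φxx ψxx wxx ξ Φ ϑ)
    (D : IsDiscreteSolution c I M N (s₁ - s₀) uh φh ψh wh ξh Φh ϑh) (hn : n < N)
    (h0 : 0 ≤ s₀) (h01 : s₀ < s₁) (h1 : s₁ ≤ T) {v : H10 L} (hv : InFE M v) :
    c.ρ / (s₁ - s₀) * inner ℝ (fn (ξh (n + 1) - ritz M (U s₁)).1 - fn (ξh n - ritz M (U s₀)).1)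
        (fn v.1)
      + c.α * inner ℝ (dx (uh (n + 1) - ritz M (u s₁)).1) (dx v.1)
      - c.lam * inner ℝ (fn (φh (n + 1) - ritz M (φ s₁)).1 - fn (uh (n + 1) - ritz M (u s₁)).1)
        (fn v.1)
      + c.μ * inner ℝ (fn (ξh (n + 1) - ritz M (U s₁)).1) (fn v.1)
      ≤ residualConst c A * (stepSize (L / M) (s₁ - s₀) (∫ r in s₀..s₁, m r) * ‖fn v.1‖) := by
  have hM' : (0 : ℝ) < M := by exact_mod_cast hM
  have hh : 0 < L / M := by positivity
  have hτ : 0 < s₁ - s₀ := sub_pos.2 h01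
  have hs₁ : s₁ ∈ Icc 0 T := ⟨h0.trans h01.le, h1⟩
  have hA := S.A_nonneg
  have ha : 0 ≤ ∫ r in s₀..s₁, m r :=
    intervalIntegral.integral_nonneg h01.le fun r _ => S.weight.nonneg r
  have e1 := D.eq_u n hn v hv
  have e2 := abs_le.1 (S.consistency_u hL hc h0 h01 h1 v)
  have e3 := inner_dx_ritz_sub hL hM (u s₁) hv
  have q1 := abs_inner_le_of_norm_le (y := fn v.1)
    (norm_fn_ritz_sub_sub_le hL hM S.weight S.vel_u.modulus h0 h01 h1)
  set a := ∫ r in s₀..s₁, m r with had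
  set s := stepSize (L / M) (s₁ - s₀) a with hsd
  have hha : 0 ≤ L / M * a / (s₁ - s₀) := by positivity
  have hs1 : L / M ≤ s := by rw [hsd, stepSize]; linarith
  have hs2 : a ≤ s := by rw [hsd, stepSize]; linarith
  have hs3 : L / M * a / (s₁ - s₀) ≤ s := by rw [hsd, stepSize]; linarith
  have hnv := norm_nonneg (fn v.1)
  have := hc.ρ_pos
  have := hc.ρ₁_pos
  have := hc.ρ₃_pos
  have := hc.α_pos
  have := hc.lam_pos
  have := hc.μ_pos
  have := hc.γ_pos
  have := hc.K_pos
  have := hc.δ_pos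
  have := hc.κ_pos
  have := abs_nonneg c.β
  have p1 := abs_le.1 (abs_mul_le_mul (k := c.ρ / (s₁ - s₀)) (by positivity) q1)
  have p2 := abs_le.1 (abs_mul_le_mul hc.lam_pos.le (abs_inner_le_of_norm_le (y := fn v.1)
    (norm_fn_ritz_sub_le_of_le hL hM (S.curve_φ.norm_dx_le s₁ hs₁) hs1)))
  have p3 := abs_le.1 (abs_mul_le_mul hc.lam_pos.le (abs_inner_le_of_norm_le (y := fn v.1)
    (norm_fn_ritz_sub_le_of_le hL hM (S.curve_u.norm_dx_le s₁ hs₁) hs1)))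
  have p4 := abs_le.1 (abs_mul_le_mul hc.μ_pos.le (abs_inner_le_of_norm_le (y := fn v.1)
    (norm_fn_ritz_sub_le_of_le hL hM (S.vel_u.norm_dx_le s₁ hs₁) hs1)))
  have t1 : c.ρ / (s₁ - s₀) * (L / M * a * ‖fn v.1‖) ≤ c.ρ * (s * ‖fn v.1‖) := by
    have : c.ρ / (s₁ - s₀) * (L / M * a * ‖fn v.1‖)
        = c.ρ * ((L / M * a / (s₁ - s₀)) * ‖fn v.1‖) := by ring
    rw [this]; gcongr
  have t2 : (c.α + 2 * c.lam + c.μ) * a * ‖fn v.1‖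
      ≤ (c.α + 2 * c.lam + c.μ) * (s * ‖fn v.1‖) := by
    rw [mul_assoc]; gcongr
  have hz : 0 ≤ s * ‖fn v.1‖ := mul_nonneg (hh.le.trans hs1) hnv
  have hfin : (c.ρ + (c.α + 2 * c.lam + c.μ) + (2 * c.lam + c.μ) * A) * (s * ‖fn v.1‖)
      ≤ residualConst c A * (s * ‖fn v.1‖) := by
    refine mul_le_mul_of_nonneg_right ?_ hz
    have : 0 ≤ (2 * c.lam + c.γ + c.K) * A := by positivity
    rw [residualConst]
    linarith
  refine le_trans ?_ hfin
  simp only [fn_coe_sub, dx_coe_sub, inner_sub_left, mul_sub] at *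
  have e3' : c.α * inner ℝ (dx (ritz M (u s₁)).1) (dx v.1)
      = c.α * inner ℝ (dx (u s₁).1) (dx v.1) := by rw [sub_eq_zero.1 e3]
  linarith

theorem residual_φ_le (hL : 0 < L) (hM : 0 < M) (hc : c.Admissible)
    (S : IsSmoothSolution c T A m I u φ ψ w U V W uxx φxx ψxx wxx ξ Φ ϑ)
    (D : IsDiscreteSolution c I M N (s₁ - s₀) uh φh ψh wh ξh Φh ϑh) (hn : n < N)
    (h0 : 0 ≤ s₀) (h01 : s₀ < s₁) (h1 : s₁ ≤ T) {v : H10 L} (hv : InFE M v) :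
    c.ρ₁ / (s₁ - s₀) * inner ℝ (fn (Φh (n + 1) - ritz M (V s₁)).1 - fn (Φh n - ritz M (V s₀)).1)
        (fn v.1)
      + c.K * inner ℝ (dx (φh (n + 1) - ritz M (φ s₁)).1 + fn (ψh (n + 1) - ritz M (ψ s₁)).1)
        (dx v.1)
      + c.lam * inner ℝ (fn (φh (n + 1) - ritz M (φ s₁)).1 - fn (uh (n + 1) - ritz M (u s₁)).1)
        (fn v.1)
      + c.γ * inner ℝ (fn (Φh (n + 1) - ritz M (V s₁)).1) (fn v.1)
      + c.β * inner ℝ (dx (ϑh (n + 1) - ritz M (W s₁)).1) (fn v.1)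
      ≤ residualConst c A * (stepSize (L / M) (s₁ - s₀) (∫ r in s₀..s₁, m r) * ‖fn v.1‖) := by
  have hM' : (0 : ℝ) < M := by exact_mod_cast hM
  have hh : 0 < L / M := by positivity
  have hτ : 0 < s₁ - s₀ := sub_pos.2 h01
  have hs₁ : s₁ ∈ Icc 0 T := ⟨h0.trans h01.le, h1⟩
  have hA := S.A_nonneg
  have ha : 0 ≤ ∫ r in s₀..s₁, m r :=
    intervalIntegral.integral_nonneg h01.le fun r _ => S.weight.nonneg r
  have e1 := D.eq_φ n hn v hv
  have e2 := abs_le.1 (S.consistency_φ hL hc h0 h01 h1 v)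
  have e3 := inner_dx_ritz_sub hL hM (φ s₁) hv
  -- The projection error of `ψ` is paired with `v_x`. Integration by parts moves the derivative
  -- onto it, where `ψ_xx` gives a factor `h` and only `‖v‖` remains.
  have e4 : inner ℝ (dx (ritz M (ψ s₁) - ψ s₁).1) (fn v.1)
      = -inner ℝ (fn (ritz M (ψ s₁) - ψ s₁).1) (dx v.1) :=
    IsWeakDeriv.inner_eq_neg hL (ritz M (ψ s₁) - ψ s₁).1.2 v
  have q1 := abs_inner_le_of_norm_le (y := fn v.1)
    (norm_fn_ritz_sub_sub_le hL hM S.weight S.vel_φ.modulus h0 h01 h1)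
  have q2 := norm_dx_ritz_velocity_sub_le hL hM S.weight S.curve_w S.vel_w h0 h01 h1
  have q3 := norm_dx_ritz_sub_le_of_isWeakDeriv hL hM (ψ s₁) (S.curve_ψ.weak s₁ hs₁)
  set a := ∫ r in s₀..s₁, m r with had
  set s := stepSize (L / M) (s₁ - s₀) a with hsd
  have hha : 0 ≤ L / M * a / (s₁ - s₀) := by positivity
  have hs1 : L / M ≤ s := by rw [hsd, stepSize]; linarith
  have hs2 : a ≤ s := by rw [hsd, stepSize]; linarith
  have hs3 : L / M * a / (s₁ - s₀) ≤ s := by rw [hsd, stepSize]; linarith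
  have hs4 : a + L / M * a / (s₁ - s₀) ≤ s := by rw [hsd, stepSize]; linarith
  have hnv := norm_nonneg (fn v.1)
  have := hc.ρ_pos
  have := hc.ρ₁_pos
  have := hc.ρ₃_pos
  have := hc.α_pos
  have := hc.lam_pos
  have := hc.μ_pos
  have := hc.γ_pos
  have := hc.K_pos
  have := hc.δ_pos
  have := hc.κ_pos
  have := abs_nonneg c.β
  have q3' : ‖dx (ritz M (ψ s₁) - ψ s₁).1‖ ≤ s * A := q3.trans
    (mul_le_mul hs1 (S.curve_ψ.norm_le s₁ hs₁) (norm_nonneg _) (hh.le.trans hs1))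
  have p1 := abs_le.1 (abs_mul_le_mul (k := c.ρ₁ / (s₁ - s₀)) (by positivity) q1)
  have p2 := abs_le.1 (abs_mul_le_mul hc.lam_pos.le (abs_inner_le_of_norm_le (y := fn v.1)
    (norm_fn_ritz_sub_le_of_le hL hM (S.curve_φ.norm_dx_le s₁ hs₁) hs1)))
  have p3 := abs_le.1 (abs_mul_le_mul hc.lam_pos.le (abs_inner_le_of_norm_le (y := fn v.1)
    (norm_fn_ritz_sub_le_of_le hL hM (S.curve_u.norm_dx_le s₁ hs₁) hs1)))
  have p4 := abs_le.1 (abs_mul_le_mul hc.γ_pos.le (abs_inner_le_of_norm_le (y := fn v.1)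
    (norm_fn_ritz_sub_le_of_le hL hM (S.vel_φ.norm_dx_le s₁ hs₁) hs1)))
  have p5 := abs_le.1 (abs_mul_le_mul hc.K_pos.le (abs_inner_le_of_norm_le (y := fn v.1) q3'))
  have p6 := abs_le.1 (abs_mul_le_abs_mul c.β
    (abs_inner_le_of_norm_le (y := fn v.1) (q2.trans hs4)))
  have t1 : c.ρ₁ / (s₁ - s₀) * (L / M * a * ‖fn v.1‖) ≤ c.ρ₁ * (s * ‖fn v.1‖) := by
    have : c.ρ₁ / (s₁ - s₀) * (L / M * a * ‖fn v.1‖)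
        = c.ρ₁ * ((L / M * a / (s₁ - s₀)) * ‖fn v.1‖) := by ring
    rw [this]; gcongr
  have t2 : (2 * c.K + 2 * c.lam + c.γ) * a * ‖fn v.1‖
      ≤ (2 * c.K + 2 * c.lam + c.γ) * (s * ‖fn v.1‖) := by
    rw [mul_assoc]; gcongr
  have hz : 0 ≤ s * ‖fn v.1‖ := mul_nonneg (hh.le.trans hs1) hnv
  have hfin : (c.ρ₁ + (2 * c.K + 2 * c.lam + c.γ) + (2 * c.lam + c.γ + c.K) * A + |c.β|)
        * (s * ‖fn v.1‖)
      ≤ residualConst c A * (s * ‖fn v.1‖) := by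
    refine mul_le_mul_of_nonneg_right ?_ hz
    have : 0 ≤ (2 * c.lam + c.μ) * A := by positivity
    rw [residualConst]
    linarith
  refine le_trans ?_ hfin
  clear hfin hsd
  clear_value s
  simp only [fn_coe_sub, dx_coe_sub, inner_sub_left, inner_add_left, mul_sub, mul_add] at *
  have e3' : c.K * inner ℝ (dx (ritz M (φ s₁)).1) (dx v.1)
      = c.K * inner ℝ (dx (φ s₁).1) (dx v.1) := by rw [sub_eq_zero.1 e3]
  have e4' := congrArg (fun z => c.K * z) e4
  simp only [mul_sub, mul_neg] at e4'
  linarith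

/-- The projection error of the damping term `κ (w_xt, v_x)` can only be paired with `v_x`, so the
bound is in `‖v_x‖`; the damping itself absorbs it. The other terms are brought to this norm by the
Poincaré inequality, whence the factor `1 + L`. -/
theorem residual_w_le (hL : 0 < L) (hM : 0 < M) (hc : c.Admissible)
    (S : IsSmoothSolution c T A m I u φ ψ w U V W uxx φxx ψxx wxx ξ Φ ϑ)
    (D : IsDiscreteSolution c I M N (s₁ - s₀) uh φh ψh wh ξh Φh ϑh) (hn : n < N)
    (h0 : 0 ≤ s₀) (h01 : s₀ < s₁) (h1 : s₁ ≤ T) {v : H10 L} (hv : InFE M v) :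
    c.ρ₃ / (s₁ - s₀) * inner ℝ (fn (ϑh (n + 1) - ritz M (W s₁)).1 - fn (ϑh n - ritz M (W s₀)).1)
        (fn v.1)
      + c.δ * inner ℝ (dx (wh (n + 1) - ritz M (w s₁)).1) (dx v.1)
      + c.β * inner ℝ (dx (Φh (n + 1) - ritz M (V s₁)).1) (fn v.1)
      + c.κ * inner ℝ (dx (ϑh (n + 1) - ritz M (W s₁)).1) (dx v.1)
      ≤ residualConst c A * (1 + L)
        * (stepSize (L / M) (s₁ - s₀) (∫ r in s₀..s₁, m r) * ‖dx v.1‖) := by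
  have hM' : (0 : ℝ) < M := by exact_mod_cast hM
  have hh : 0 < L / M := by positivity
  have hτ : 0 < s₁ - s₀ := sub_pos.2 h01
  have hA := S.A_nonneg
  have ha : 0 ≤ ∫ r in s₀..s₁, m r :=
    intervalIntegral.integral_nonneg h01.le fun r _ => S.weight.nonneg r
  have e1 := D.eq_w n hn v hv
  have e2 := abs_le.1 (S.consistency_w hL hc h0 h01 h1 v)
  have e3 := inner_dx_ritz_sub hL hM (w s₁) hv
  have q1 := abs_inner_le_of_norm_le (y := fn v.1)
    (norm_fn_ritz_sub_sub_le hL hM S.weight S.vel_w.modulus h0 h01 h1)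
  have q2 := norm_dx_ritz_velocity_sub_le hL hM S.weight S.curve_w S.vel_w h0 h01 h1
  have q3 := norm_dx_ritz_velocity_sub_le hL hM S.weight S.curve_φ S.vel_φ h0 h01 h1
  set a := ∫ r in s₀..s₁, m r with had
  set s := stepSize (L / M) (s₁ - s₀) a with hsd
  have hha : 0 ≤ L / M * a / (s₁ - s₀) := by positivity
  have hs1 : L / M ≤ s := by rw [hsd, stepSize]; linarith
  have hs2 : a ≤ s := by rw [hsd, stepSize]; linarith
  have hs3 : L / M * a / (s₁ - s₀) ≤ s := by rw [hsd, stepSize]; linarith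
  have hs4 : a + L / M * a / (s₁ - s₀) ≤ s := by rw [hsd, stepSize]; linarith
  have hnv := norm_nonneg (fn v.1)
  have hP := norm_fn_le_mul_norm_dx hL v
  have := hc.ρ_pos
  have := hc.ρ₁_pos
  have := hc.ρ₃_pos
  have := hc.α_pos
  have := hc.lam_pos
  have := hc.μ_pos
  have := hc.γ_pos
  have := hc.K_pos
  have := hc.δ_pos
  have := hc.κ_pos
  have := abs_nonneg c.β
  have p1 := abs_le.1 (abs_mul_le_mul (k := c.ρ₃ / (s₁ - s₀)) (by positivity) q1)
  have p2 := abs_le.1 (abs_mul_le_abs_mul c.β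
    (abs_inner_le_of_norm_le (y := fn v.1) (q3.trans hs4)))
  have p3 := abs_le.1 (abs_mul_le_mul hc.κ_pos.le
    (abs_inner_le_of_norm_le (y := dx v.1) (q2.trans hs4)))
  have t1 : c.ρ₃ / (s₁ - s₀) * (L / M * a * ‖fn v.1‖) ≤ c.ρ₃ * (s * ‖fn v.1‖) := by
    have : c.ρ₃ / (s₁ - s₀) * (L / M * a * ‖fn v.1‖)
        = c.ρ₃ * ((L / M * a / (s₁ - s₀)) * ‖fn v.1‖) := by ring
    rw [this]; gcongr
  have t2 : c.δ * a * ‖fn v.1‖ ≤ c.δ * (s * ‖fn v.1‖) := by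
    rw [mul_assoc]; gcongr
  have hs0 : 0 ≤ s := hh.le.trans hs1
  have hz : 0 ≤ s * ‖dx v.1‖ := mul_nonneg hs0 (norm_nonneg _)
  have hR : 0 ≤ (4 * c.lam + c.μ + c.γ + c.K) * A := by positivity
  have hfin : (c.ρ₃ + c.δ + |c.β|) * (s * ‖fn v.1‖) + c.κ * (s * ‖dx v.1‖)
      ≤ residualConst c A * (1 + L) * (s * ‖dx v.1‖) := by
    have r1 : c.ρ₃ + c.δ + |c.β| ≤ residualConst c A := by rw [residualConst]; linarith
    have r2 : c.κ ≤ residualConst c A := by rw [residualConst]; linarith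
    have f1 : (c.ρ₃ + c.δ + |c.β|) * (s * ‖fn v.1‖)
        ≤ residualConst c A * (s * (L * ‖dx v.1‖)) :=
      mul_le_mul r1 (mul_le_mul_of_nonneg_left hP hs0) (by positivity) (by linarith)
    have f2 := mul_le_mul_of_nonneg_right r2 hz
    calc _ ≤ residualConst c A * (s * (L * ‖dx v.1‖)) + residualConst c A * (s * ‖dx v.1‖) :=
          add_le_add f1 f2
      _ = _ := by ring
  refine le_trans ?_ hfin
  clear hfin hsd
  clear_value s
  simp only [fn_coe_sub, dx_coe_sub, inner_sub_left, mul_sub] at *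
  have e3' : c.δ * inner ℝ (dx (ritz M (w s₁)).1) (dx v.1)
      = c.δ * inner ℝ (dx (w s₁).1) (dx v.1) := by rw [sub_eq_zero.1 e3]
  linarith

/-- Kept as an identity: with no damping to absorb this residual, its explicit form is needed for
the summation by parts in time. -/
theorem residual_ψ_eq (hL : 0 < L) (hM : 0 < M)
    (S : IsSmoothSolution c T A m I u φ ψ w U V W uxx φxx ψxx wxx ξ Φ ϑ) {τ : ℝ}
    (D : IsDiscreteSolution c I M N τ uh φh ψh wh ξh Φh ϑh) (hn : n < N)
    (hs₁ : s₁ ∈ Icc 0 T) {v : H10 L} (hv : InFE M v) :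
    c.b * inner ℝ (dx (ψh (n + 1) - ritz M (ψ s₁)).1) (dx v.1)
      + c.K * inner ℝ (dx (φh (n + 1) - ritz M (φ s₁)).1 + fn (ψh (n + 1) - ritz M (ψ s₁)).1)
        (fn v.1)
      = -(c.K * inner ℝ (dx (ritz M (φ s₁)).1 - dx (φ s₁).1 +
        (fn (ritz M (ψ s₁)).1 - fn (ψ s₁).1)) (fn v.1)) := by
  have e1 := D.eq_ψ n hn v hv
  have e2 := S.sol.eq_ψ v s₁ hs₁
  have e3 := inner_dx_ritz_sub hL hM (ψ s₁) hv
  simp only [fn_coe_sub, dx_coe_sub, inner_sub_left, inner_add_left] at *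
  linear_combination e1 - e2 - c.b * e3

/-- The errors obey the recursion of the scheme up to a defect, because the Ritz projection of the
exact velocity is not the difference quotient of the Ritz projections. -/
theorem step_error_eq (hL : 0 < L) (hM : 0 < M) {x y vh : H10 L} {τ : ℝ} {p P : ℝ → H10 L}
    (h01 : s₀ < s₁) (hτ : s₁ - s₀ = τ) (hstep : y = x + τ • vh) :
    (y - ritz M (p s₁)) - (x - ritz M (p s₀))
      = τ • ((vh - ritz M (P s₁)) + defect M p P s₀ s₁) := by
  have hτ0 : τ ≠ 0 := by rw [← hτ]; exact (sub_pos.2 h01).ne'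
  rw [defect, ritz_sub hL hM, ritz_smul hL hM, ritz_sub hL hM, hτ, hstep]
  refine H10_ext hL ?_
  simp only [dx_coe_sub, dx_coe_add, dx_coe_smul, smul_add, smul_sub, smul_smul,
    mul_inv_cancel₀ hτ0, one_smul]
  abel

end Residuals

/-! ### The discrete energy inequality and the Gronwall argument. -/

section Stability

variable {H : Type*} [NormedAddCommGroup H] [InnerProductSpace ℝ H]

/-- Start from `‖z‖²/2 = (z, z − z') + ‖z'‖²/2 − ‖z − z'‖²/2`. In `τ (z, e)` write `z = z' + (z −
z')`: the second part is absorbed by `−‖z − z'‖²/2`, so the growth factor falls on the old value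
`z'` alone. This keeps the estimate valid for every step size up to `T`. -/
theorem half_norm_sq_le_inner {k τ T B : ℝ} (hk : 0 ≤ k) (hτ : 0 ≤ τ) (hT : τ ≤ T)
    {z z' d e : H} (h : z - z' = τ • (d + e)) (he : ‖e‖ ≤ B) :
    k / 2 * ‖z‖ ^ 2 ≤ k * (τ * inner ℝ z d) + (1 + τ) * (k / 2 * ‖z'‖ ^ 2)
      + k / 2 * ((1 + T) * τ * B ^ 2) := by
  have e1 : ‖z - z'‖ ^ 2 = ‖z‖ ^ 2 - 2 * inner ℝ z z' + ‖z'‖ ^ 2 := norm_sub_sq_real z z'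
  have e2 : inner ℝ z (z - z') = τ * inner ℝ z d + τ * inner ℝ z e := by
    rw [h, real_inner_smul_right, inner_add_right]; ring
  have e3 : inner ℝ z (z - z') = ‖z‖ ^ 2 - inner ℝ z z' := by
    rw [inner_sub_right, real_inner_self_eq_norm_sq]
  have e4 : inner ℝ z e = inner ℝ z' e + inner ℝ (z - z') e := by
    rw [inner_sub_left]; ring
  have hB : ‖e‖ ^ 2 ≤ B ^ 2 := by gcongr
  have e5 : inner ℝ z' e ≤ (‖z'‖ ^ 2 + ‖e‖ ^ 2) / 2 := by
    nlinarith [real_inner_le_norm z' e, sq_nonneg (‖z'‖ - ‖e‖)]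
  have e6 : τ * inner ℝ (z - z') e ≤ (‖z - z'‖ ^ 2 + τ ^ 2 * ‖e‖ ^ 2) / 2 := by
    nlinarith [mul_le_mul_of_nonneg_left (real_inner_le_norm (z - z') e) hτ,
      sq_nonneg (‖z - z'‖ - τ * ‖e‖)]
  have e7 : τ * inner ℝ z' e ≤ τ * ((‖z'‖ ^ 2 + ‖e‖ ^ 2) / 2) :=
    mul_le_mul_of_nonneg_left e5 hτ
  have e8 : (τ + τ ^ 2) * ‖e‖ ^ 2 ≤ (1 + T) * τ * B ^ 2 := by
    have : τ + τ ^ 2 ≤ (1 + T) * τ := by nlinarith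
    have h0 : 0 ≤ τ + τ ^ 2 := by positivity
    exact mul_le_mul this hB (sq_nonneg _) (h0.trans this)
  have e9 : ‖z‖ ^ 2 / 2 ≤ τ * inner ℝ z d + (1 + τ) * (‖z'‖ ^ 2 / 2)
      + (1 + T) * τ * B ^ 2 / 2 := by
    rw [e4, mul_add] at e2
    linarith
  have := mul_le_mul_of_nonneg_left e9 hk
  linarith

theorem half_norm_sq_le_inner_sub {k : ℝ} (hk : 0 ≤ k) (z z' : H) :
    k / 2 * ‖z‖ ^ 2 ≤ k * inner ℝ (z - z') z + k / 2 * ‖z'‖ ^ 2 := by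
  have e1 : inner ℝ (z - z') z = ‖z‖ ^ 2 - inner ℝ z' z := by
    rw [inner_sub_left, real_inner_self_eq_norm_sq]
  have e2 : inner ℝ z' z ≤ (‖z'‖ ^ 2 + ‖z‖ ^ 2) / 2 := by
    nlinarith [real_inner_le_norm z' z, sq_nonneg (‖z'‖ - ‖z‖)]
  have := mul_le_mul_of_nonneg_left e2 hk
  rw [e1]
  linarith

/-- Completing the square; it lets a damping term `μ x²` absorb a linear residual. -/
theorem mul_le_mul_sq_add {μ C x : ℝ} (hμ : 0 < μ) :
    C * x ≤ μ * x ^ 2 + C ^ 2 / (4 * μ) := by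
  have h : 0 ≤ (2 * μ * x - C) ^ 2 / (4 * μ) := by positivity
  have : (2 * μ * x - C) ^ 2 / (4 * μ) = μ * x ^ 2 + C ^ 2 / (4 * μ) - C * x := by
    field_simp; ring
  linarith

/-- The energy of the errors at one time level. -/
def energy (c : Coeffs) (ξ Φ ϑ Du X Y Dw P : H) : ℝ :=
  c.ρ / 2 * ‖ξ‖ ^ 2 + c.ρ₁ / 2 * ‖Φ‖ ^ 2 + c.ρ₃ / 2 * ‖ϑ‖ ^ 2 + c.α / 2 * ‖Du‖ ^ 2
    + c.K / 2 * ‖X‖ ^ 2 + c.lam / 2 * ‖Y‖ ^ 2 + c.δ / 2 * ‖Dw‖ ^ 2 + c.b / 2 * ‖P‖ ^ 2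

/-- The constant in front of the residuals in the discrete energy inequality. -/
def stabilityConst (c : Coeffs) (T L C₁ C₂ : ℝ) : ℝ :=
  (c.α + c.K + 4 * L ^ 2 * c.lam + c.δ) / 2 * (1 + T) + C₁ ^ 2 / (4 * c.μ) + C₁ ^ 2 / (4 * c.γ)
    + C₂ ^ 2 / (4 * c.κ) + 2 * c.K ^ 2 * L ^ 2 / c.b

/-- The discrete energy inequality for one step of the scheme. -/
theorem energy_step_le {c : Coeffs} (hc : c.Admissible) {τ T L s C₁ C₂ : ℝ} (hτ : 0 < τ)
    (hT : τ ≤ T) (hL : 0 < L) (hs : 0 ≤ s)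
    {ξ ξ' Φ Φ' ϑ ϑ' Du Du' X X' Y Y' Dw Dw' P P' Dξ DΦ Dϑ f f' R R' ku kφ kw kY : H}
    (h₁ : c.ρ / τ * inner ℝ (ξ - ξ') ξ + c.α * inner ℝ Du Dξ - c.lam * inner ℝ Y ξ
      + c.μ * inner ℝ ξ ξ ≤ C₁ * (s * ‖ξ‖))
    (h₂ : c.ρ₁ / τ * inner ℝ (Φ - Φ') Φ + c.K * inner ℝ X DΦ + c.lam * inner ℝ Y Φ
      + c.γ * inner ℝ Φ Φ + c.β * inner ℝ Dϑ Φ ≤ C₁ * (s * ‖Φ‖))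
    (h₃ : c.ρ₃ / τ * inner ℝ (ϑ - ϑ') ϑ + c.δ * inner ℝ Dw Dϑ + c.β * inner ℝ DΦ ϑ
      + c.κ * inner ℝ Dϑ Dϑ ≤ C₂ * (s * ‖Dϑ‖))
    (h₄ : c.b * inner ℝ P (P - P') + c.K * inner ℝ X (f - f') = -(c.K * inner ℝ R (f - f')))
    (hu : Du - Du' = τ • (Dξ + ku)) (hw : Dw - Dw' = τ • (Dϑ + kw))
    (hX : X - X' = τ • (DΦ + kφ) + (f - f')) (hY : Y - Y' = τ • (Φ - ξ + kY))
    (hβ : inner ℝ Dϑ Φ + inner ℝ DΦ ϑ = 0)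
    (hku : ‖ku‖ ≤ s) (hkw : ‖kw‖ ≤ s) (hkφ : ‖kφ‖ ≤ s) (hkY : ‖kY‖ ≤ 2 * L * s)
    (hR : ‖R - R'‖ ≤ 2 * (τ * s)) (hf' : ‖f'‖ ≤ L * ‖P'‖) :
    energy c ξ Φ ϑ Du X Y Dw P + c.K * inner ℝ R f
      ≤ (1 + 2 * τ) * energy c ξ' Φ' ϑ' Du' X' Y' Dw' P' + c.K * inner ℝ R' f'
        + stabilityConst c T L C₁ C₂ * (τ * s ^ 2) := by
  obtain ⟨hρ, hα, hlam, hμ, hρ₁, hK, hγ, -, hb, hρ₃, hδ, hκ⟩ := hc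
  have a1 := half_norm_sq_le_inner hα.le hτ.le hT hu hku
  have a2 := half_norm_sq_le_inner hδ.le hτ.le hT hw hkw
  have a3 := half_norm_sq_le_inner hlam.le hτ.le hT hY hkY
  -- The increment of the error of `ψ` is counted as part of the velocity, so that its pairing with
  -- `X` matches the term `K (X, f − f')` of `h₄`.
  have hX' : X - X' = τ • ((DΦ + τ⁻¹ • (f - f')) + kφ) := by
    rw [hX, smul_add, smul_add, smul_add, smul_smul, mul_inv_cancel₀ hτ.ne', one_smul]
    abel
  have a4 := half_norm_sq_le_inner hK.le hτ.le hT hX' hkφ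
  have a5 := half_norm_sq_le_inner_sub hb.le P P'
  have a6 := half_norm_sq_le_inner_sub hρ.le ξ ξ'
  have a7 := half_norm_sq_le_inner_sub hρ₁.le Φ Φ'
  have a8 := half_norm_sq_le_inner_sub hρ₃.le ϑ ϑ'
  rw [inner_add_right, real_inner_smul_right, mul_add, ← mul_assoc τ, mul_inv_cancel₀ hτ.ne',
    one_mul] at a4
  rw [inner_sub_right] at a3
  rw [real_inner_comm] at a5
  simp only [real_inner_self_eq_norm_sq] at h₁ h₂ h₃
  have b1 := mul_le_mul_of_nonneg_left (h₁.trans ((mul_assoc _ _ _).symm.le.trans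
    (mul_le_mul_sq_add (C := C₁ * s) (x := ‖ξ‖) hμ))) hτ.le
  have b2 := mul_le_mul_of_nonneg_left (h₂.trans ((mul_assoc _ _ _).symm.le.trans
    (mul_le_mul_sq_add (C := C₁ * s) (x := ‖Φ‖) hγ))) hτ.le
  have b3 := mul_le_mul_of_nonneg_left (h₃.trans ((mul_assoc _ _ _).symm.le.trans
    (mul_le_mul_sq_add (C := C₂ * s) (x := ‖Dϑ‖) hκ))) hτ.le
  have d1 : τ * (c.ρ / τ * inner ℝ (ξ - ξ') ξ) = c.ρ * inner ℝ (ξ - ξ') ξ := by field_simp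
  have d2 : τ * (c.ρ₁ / τ * inner ℝ (Φ - Φ') Φ) = c.ρ₁ * inner ℝ (Φ - Φ') Φ := by field_simp
  have d3 : τ * (c.ρ₃ / τ * inner ℝ (ϑ - ϑ') ϑ) = c.ρ₃ * inner ℝ (ϑ - ϑ') ϑ := by field_simp
  -- Summation by parts in time: `(R, f)` and `(R', f')` telescope, and the increment `R − R'`
  -- supplies the factor `τ` that `f − f'` alone would not.
  have r1 : inner ℝ R (f - f') = inner ℝ R f - inner ℝ R' f' - inner ℝ (R - R') f' := by
    rw [inner_sub_right, inner_sub_left]; ring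
  have r2 : c.K * inner ℝ (R - R') f' ≤ τ * (c.b / 2 * ‖P'‖ ^ 2)
      + 2 * c.K ^ 2 * L ^ 2 / c.b * (τ * s ^ 2) := by
    have i1 : inner ℝ (R - R') f' ≤ 2 * (τ * s) * (L * ‖P'‖) :=
      (le_abs_self _).trans ((abs_real_inner_le_norm _ _).trans
        (mul_le_mul hR hf' (norm_nonneg _) (by positivity)))
    -- The weight `b / 2` makes the `P'` term equal to `τ` times its share of the old energy.
    have i2 := mul_le_mul_sq_add (μ := c.b / 2) (C := 2 * c.K * L * s) (x := ‖P'‖) (by positivity)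
    have i3 := mul_le_mul_of_nonneg_left i2 hτ.le
    have i4 := mul_le_mul_of_nonneg_left i1 hK.le
    have i5 : τ * ((2 * c.K * L * s) ^ 2 / (4 * (c.b / 2)))
        = 2 * c.K ^ 2 * L ^ 2 / c.b * (τ * s ^ 2) := by field_simp; ring
    rw [mul_add, i5] at i3
    linarith
  have hβ' : τ * (c.β * inner ℝ Dϑ Φ) + τ * (c.β * inner ℝ DΦ ϑ) = 0 := by
    linear_combination τ * c.β * hβ
  have q1 : (C₁ * s) ^ 2 / (4 * c.μ) = C₁ ^ 2 / (4 * c.μ) * s ^ 2 := by ring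
  have q2 : (C₁ * s) ^ 2 / (4 * c.γ) = C₁ ^ 2 / (4 * c.γ) * s ^ 2 := by ring
  have q3 : (C₂ * s) ^ 2 / (4 * c.κ) = C₂ ^ 2 / (4 * c.κ) * s ^ 2 := by ring
  rw [q1] at b1
  rw [q2] at b2
  rw [q3] at b3
  have n1 : 0 ≤ τ * (c.ρ / 2 * ‖ξ'‖ ^ 2) := by positivity
  have n2 : 0 ≤ τ * (c.ρ₁ / 2 * ‖Φ'‖ ^ 2) := by positivity
  have n3 : 0 ≤ τ * (c.ρ₃ / 2 * ‖ϑ'‖ ^ 2) := by positivity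
  have n4 : 0 ≤ τ * (c.α / 2 * ‖Du'‖ ^ 2) := by positivity
  have n5 : 0 ≤ τ * (c.K / 2 * ‖X'‖ ^ 2) := by positivity
  have n6 : 0 ≤ τ * (c.lam / 2 * ‖Y'‖ ^ 2) := by positivity
  have n7 : 0 ≤ τ * (c.δ / 2 * ‖Dw'‖ ^ 2) := by positivity
  have n8 : 0 ≤ τ * (c.b / 2 * ‖P'‖ ^ 2) := by positivity
  have hr : c.K * inner ℝ R (f - f')
      = c.K * (inner ℝ R f - inner ℝ R' f' - inner ℝ (R - R') f') := by rw [r1]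
  rw [energy, energy, stabilityConst]
  linarith

/-- A discrete Gronwall inequality for an energy `E` with a perturbation `B` that `E` controls. -/
theorem energy_le_exp {E B r : ℕ → ℝ} {τ q : ℝ} {N : ℕ} (hτ : 0 ≤ τ)
    (hstep : ∀ n < N, E (n + 1) + B (n + 1) ≤ (1 + 2 * τ) * E n + B n + r n)
    (hB : ∀ n ≤ N, |B n| ≤ E n / 2 + q) (hr : ∀ n, 0 ≤ r n) (hE0 : E 0 = 0) (hB0 : B 0 = 0) :
    ∀ n ≤ N, E n ≤ 2 * (Real.exp (4 * τ * n) * (q + ∑ i ∈ Finset.range n, r i)) := by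
  have hq : 0 ≤ q := by
    have := hB 0 (Nat.zero_le _)
    rw [hE0, hB0] at this
    simpa using this
  have key : ∀ n ≤ N, E n + B n + q
      ≤ Real.exp (4 * τ * n) * (q + ∑ i ∈ Finset.range n, r i) := by
    intro n
    induction n with
    | zero => intro _; simp [hE0, hB0]
    | succ n ih =>
      intro hn
      have h1 := ih (Nat.le_of_succ_le hn)
      have h2 := hstep n (Nat.lt_of_succ_le hn)
      have h3 := (abs_le.1 (hB n (Nat.le_of_succ_le hn))).1
      -- The lower bound for `B n` makes `E + B + q` at least `E / 2`, so the growth `2 τ E` becomes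
      -- at most `4 τ (E + B + q)`.
      have h4 : E n ≤ 2 * (E n + B n + q) := by linarith
      have h5 := mul_le_mul_of_nonneg_left h4 hτ
      have h6 : E (n + 1) + B (n + 1) + q ≤ (1 + 4 * τ) * (E n + B n + q) + r n := by linarith
      have h7 : 1 + 4 * τ ≤ Real.exp (4 * τ) := by
        linarith [Real.add_one_le_exp (4 * τ)]
      have h8 : Real.exp (4 * τ * (n + 1 : ℕ)) = Real.exp (4 * τ) * Real.exp (4 * τ * n) := by
        rw [← Real.exp_add]; congr 1; push_cast; ring
      have h9 : 1 ≤ Real.exp (4 * τ * (n + 1 : ℕ)) := Real.one_le_exp (by positivity)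
      have hS : 0 ≤ q + ∑ i ∈ Finset.range n, r i :=
        add_nonneg hq (Finset.sum_nonneg fun i _ => hr i)
      calc _ ≤ (1 + 4 * τ) * (E n + B n + q) + r n := h6
        _ ≤ (1 + 4 * τ) * (Real.exp (4 * τ * n) * (q + ∑ i ∈ Finset.range n, r i)) + r n := by
            gcongr
        _ ≤ Real.exp (4 * τ) * (Real.exp (4 * τ * n) * (q + ∑ i ∈ Finset.range n, r i))
            + Real.exp (4 * τ * (n + 1 : ℕ)) * r n := by
            refine add_le_add (mul_le_mul_of_nonneg_right h7 (by positivity)) ?_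
            exact le_mul_of_one_le_left (hr n) h9
        _ = _ := by rw [Finset.sum_range_succ, h8]; ring
  intro n hn
  have h3 := (abs_le.1 (hB n hn)).1
  have := key n hn
  linarith

end Stability

/-! ### Summing the squared residuals over the time steps. -/

section StepSums

/-- Cauchy–Schwarz on a step gives `a² ≤ τ b`, where `b` is the integral of `m²` over it. Hence `τ
a² ≤ τ² b` and `τ (h a / τ)² ≤ h² b`, and the integrals `b` add up: the factor `1 / τ` in the
residual does no harm. -/
theorem sum_stepSize_sq_le {T τ h : ℝ} {m : ℝ → ℝ} (hm : IsWeight T m) (hτ : 0 < τ) {N : ℕ}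
    (hN : N * τ = T) :
    ∀ n ≤ N, ∑ i ∈ Finset.range n,
        τ * stepSize h τ (∫ r in ((i : ℕ) * τ)..((i + 1 : ℕ) * τ), m r) ^ 2
      ≤ 3 * ((∫ r in (0 : ℝ)..(n * τ), m r ^ 2) + n * τ) * (h ^ 2 + τ ^ 2) := by
  intro n
  induction n with
  | zero => intro _; simp
  | succ n ih =>
    intro hn
    rw [Finset.sum_range_succ]
    refine (add_le_add_left (ih (Nat.le_of_succ_le hn)) _).trans ?_
    have h0 : 0 ≤ (n : ℝ) * τ := by positivity
    have h01 : (n : ℝ) * τ ≤ (n + 1 : ℕ) * τ := by push_cast; nlinarith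
    have h1 : ((n + 1 : ℕ) : ℝ) * τ ≤ T := by rw [← hN]; gcongr
    have hi := hm.integrableOn
    have hi2 : IntegrableOn (fun r => m r ^ 2) (Ioo 0 T) := hm.memLp.integrable_sq
    have hcs := sq_integral_le h01 (intervalIntegrable_of_Ioo hi h0 h01 h1)
      (intervalIntegrable_of_Ioo hi2 h0 h01 h1)
    have hadd := intervalIntegral.integral_add_adjacent_intervals
      (intervalIntegrable_of_Ioo hi2 le_rfl h0 (h01.trans h1))
      (intervalIntegrable_of_Ioo hi2 h0 h01 h1)
    rw [← hadd]
    have hlen : ((n + 1 : ℕ) : ℝ) * τ - n * τ = τ := by push_cast; ring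
    rw [hlen] at hcs
    set a := ∫ r in (n * τ)..((n + 1 : ℕ) * τ), m r
    set b := ∫ r in (n * τ)..((n + 1 : ℕ) * τ), m r ^ 2
    have hexp : τ * stepSize h τ a ^ 2 ≤ 3 * (τ * a ^ 2 + h ^ 2 * (a ^ 2 / τ) + τ * h ^ 2) := by
      have e : τ * (h * a / τ) ^ 2 = h ^ 2 * (a ^ 2 / τ) := by field_simp
      have : (a + h * a / τ + h) ^ 2 ≤ 3 * (a ^ 2 + (h * a / τ) ^ 2 + h ^ 2) := by
        nlinarith [sq_nonneg (a - h * a / τ), sq_nonneg (a - h), sq_nonneg (h * a / τ - h)]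
      have := mul_le_mul_of_nonneg_left this hτ.le
      rw [stepSize]
      linarith
    have h2 : a ^ 2 / τ ≤ b := by rw [div_le_iff₀ hτ]; linarith
    have h3 : τ * a ^ 2 ≤ τ ^ 2 * b := by nlinarith
    have h4 : h ^ 2 * (a ^ 2 / τ) ≤ h ^ 2 * b := by gcongr
    have h5 : 0 ≤ τ * τ ^ 2 := by positivity
    push_cast
    linarith

end StepSums

/-! ### The error estimate. -/

section ErrorEstimate

variable {L : ℝ}

theorem H10_eq_of_fn_eq (hL : 0 < L) {v w : H10 L} (h : fn v.1 = fn w.1) : v = w := by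
  refine H10_ext hL (sub_eq_zero.1 ?_)
  have hwd : IsWeakDeriv (fn (v - w : H10 L).1) (dx (v - w : H10 L).1) := (v - w).1.2
  rw [fn_coe_sub, h, sub_self, dx_coe_sub] at hwd
  set g := dx v.1 - dx w.1
  refine Lp.ext ?_
  have hz : ∀ᵐ t ∂(vol L), g t = 0 := by
    refine ae_eq_zero_of_forall_isTestFunction (integrableOn_coe g) fun ζ hζ => ?_
    have h1 := hwd ζ hζ
    have h2 : ∫ x, (0 : L2 L) x * deriv ζ x ∂(vol L) = 0 := by
      refine integral_eq_zero_of_ae ?_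
      filter_upwards [Lp.coeFn_zero ℝ 2 (vol L)] with x hx
      rw [hx]; simp
    rw [h2] at h1
    simp only [smul_eq_mul, mul_comm (ζ _)]
    linarith
  filter_upwards [hz, Lp.coeFn_zero ℝ 2 (vol L)] with x h1 h2
  rw [h1, h2]; rfl

theorem inner_dx_fn_add_inner_dx_fn (hL : 0 < L) (v w : H10 L) :
    inner ℝ (dx v.1) (fn w.1) + inner ℝ (dx w.1) (fn v.1) = 0 := by
  have h : inner ℝ (dx v.1) (fn w.1) = -inner ℝ (fn v.1) (dx w.1) :=
    IsWeakDeriv.inner_eq_neg hL v.1.2 w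
  rw [h, real_inner_comm (fn v.1)]
  ring

theorem norm_sq_add_le {H : Type*} [NormedAddCommGroup H] {z x y : H} {B : ℝ} (h : z = x + y)
    (hy : ‖y‖ ≤ B) : ‖z‖ ^ 2 ≤ 2 * ‖x‖ ^ 2 + 2 * B ^ 2 := by
  have h1 : ‖z‖ ≤ ‖x‖ + B := by rw [h]; exact (norm_add_le _ _).trans (by linarith)
  have h2 : ‖z‖ ^ 2 ≤ (‖x‖ + B) ^ 2 := by gcongr
  nlinarith [sq_nonneg (‖x‖ - B)]

theorem InFE.of_pos {M N : ℕ} {y : ℕ → H10 L} (h0 : InFE M (y 0))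
    (hy : ∀ n < N, InFE M (y (n + 1))) : ∀ n ≤ N, InFE M (y n) := by
  intro n hn
  cases n with
  | zero => exact h0
  | succ n => exact hy n hn

variable {c : Coeffs} {T A : ℝ} {m : ℝ → ℝ} {I : InitialData L}
  {u φ ψ w U V W : ℝ → H10 L} {uxx φxx ψxx wxx ξ Φ ϑ : ℝ → L2 L}
  {M N : ℕ} {uh φh ψh wh ξh Φh ϑh : ℕ → H10 L}

/-- The error with respect to the Ritz projection at the time level `n`. -/
def ritzError (M : ℕ) (τ : ℝ) (xh : ℕ → H10 L) (x : ℝ → H10 L) (n : ℕ) : H10 L :=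
  xh n - ritz M (x (n * τ))

/-- The energy of the error at the time level `n`. -/
def errorEnergy (c : Coeffs) (M : ℕ) (τ : ℝ) (uh φh ψh wh ξh Φh ϑh : ℕ → H10 L)
    (u φ ψ w U V W : ℝ → H10 L) (n : ℕ) : ℝ :=
  energy c (fn (ritzError M τ ξh U n).1) (fn (ritzError M τ Φh V n).1)
    (fn (ritzError M τ ϑh W n).1) (dx (ritzError M τ uh u n).1)
    (dx (ritzError M τ φh φ n).1 + fn (ritzError M τ ψh ψ n).1)
    (fn (ritzError M τ φh φ n).1 - fn (ritzError M τ uh u n).1)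
    (dx (ritzError M τ wh w n).1) (dx (ritzError M τ ψh ψ n).1)

/-- The residual of the equation for `ψ` at the time `t`. -/
def residualψ (M : ℕ) (φ ψ : ℝ → H10 L) (t : ℝ) : L2 L :=
  dx (ritz M (φ t)).1 - dx (φ t).1 + (fn (ritz M (ψ t)).1 - fn (ψ t).1)

/-- The discrete initial data are the Ritz projections of the exact ones. For velocities the exact
initial value is prescribed only in `L²`, so the lift to `H¹₀` is identified through
`H10_eq_of_fn_eq`. -/
theorem IsSmoothSolution.ritzError_zero (hL : 0 < L) (hM : 0 < M)
    (S : IsSmoothSolution c T A m I u φ ψ w U V W uxx φxx ψxx wxx ξ Φ ϑ) (hT : 0 < T) {τ : ℝ}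
    (D : IsDiscreteSolution c I M N τ uh φh ψh wh ξh Φh ϑh) :
    ritzError M τ uh u 0 = 0 ∧ ritzError M τ φh φ 0 = 0 ∧ ritzError M τ ψh ψ 0 = 0 ∧
      ritzError M τ wh w 0 = 0 ∧ ritzError M τ ξh U 0 = 0 ∧ ritzError M τ Φh V 0 = 0 ∧
      ritzError M τ ϑh W 0 = 0 := by
  have h0 : (0 : ℝ) ∈ Icc 0 T := left_mem_Icc.2 hT.le
  have key : ∀ {xh : ℕ → H10 L} {x : ℝ → H10 L} {η : H10 L}, IsProj M η (xh 0) → x 0 = η →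
      ritzError M τ xh x 0 = 0 := by
    intro xh x η hp hx
    rw [ritzError, Nat.cast_zero, zero_mul, hx, hp.eq_ritz hL hM, sub_self]
  refine ⟨key D.init_u S.sol.init_u, key D.init_φ S.sol.init_φ, key D.init_ψ S.sol.init_ψ,
    key D.init_w S.sol.init_w, key D.init_ξ (H10_eq_of_fn_eq hL ?_),
    key D.init_Φ (H10_eq_of_fn_eq hL ?_), key D.init_ϑ (H10_eq_of_fn_eq hL ?_)⟩
  · rw [S.vel_u.fn_eq 0 h0, S.sol.init_ξ]
  · rw [S.vel_φ.fn_eq 0 h0, S.sol.init_Φ]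
  · rw [S.vel_w.fn_eq 0 h0, S.sol.init_ϑ]

theorem IsSmoothSolution.errorEnergy_step_le (hL : 0 < L) (hM : 0 < M) (hc : c.Admissible)
    (S : IsSmoothSolution c T A m I u φ ψ w U V W uxx φxx ψxx wxx ξ Φ ϑ) {τ : ℝ} (hτ : 0 < τ)
    (hN : N * τ = T) (D : IsDiscreteSolution c I M N τ uh φh ψh wh ξh Φh ϑh) {n : ℕ}
    (hn : n < N) :
    errorEnergy c M τ uh φh ψh wh ξh Φh ϑh u φ ψ w U V W (n + 1)
      + c.K * inner ℝ (residualψ M φ ψ ((n + 1 : ℕ) * τ)) (fn (ritzError M τ ψh ψ (n + 1)).1)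
      ≤ (1 + 2 * τ) * errorEnergy c M τ uh φh ψh wh ξh Φh ϑh u φ ψ w U V W n
        + c.K * inner ℝ (residualψ M φ ψ (n * τ)) (fn (ritzError M τ ψh ψ n).1)
        + stabilityConst c T L (residualConst c A) (residualConst c A * (1 + L))
          * (τ * stepSize (L / M) τ (∫ r in (n * τ)..((n + 1 : ℕ) * τ), m r) ^ 2) := by
  have hM' : (0 : ℝ) < M := by exact_mod_cast hM
  have hh : 0 < L / M := by positivity
  have h0 : 0 ≤ (n : ℝ) * τ := by positivity
  have h01 : (n : ℝ) * τ < (n + 1 : ℕ) * τ := by push_cast; nlinarith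
  have h1 : ((n + 1 : ℕ) : ℝ) * τ ≤ T := by
    rw [← hN]; exact mul_le_mul_of_nonneg_right (by exact_mod_cast hn) hτ.le
  have hlen : ((n + 1 : ℕ) : ℝ) * τ - n * τ = τ := by push_cast; ring
  have hTτ : τ ≤ T := by linarith
  have hs₁ : ((n + 1 : ℕ) : ℝ) * τ ∈ Icc 0 T := ⟨h0.trans h01.le, h1⟩
  have ha : 0 ≤ ∫ r in (n * τ)..((n + 1 : ℕ) * τ), m r :=
    intervalIntegral.integral_nonneg h01.le fun r _ => S.weight.nonneg r
  have D' : IsDiscreteSolution c I M N (((n + 1 : ℕ) : ℝ) * τ - n * τ) uh φh ψh wh ξh Φh ϑh := by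
    rwa [hlen]
  have mU := InFE.of_pos D.init_ξ.1 D.mem_ξ
  have mV := InFE.of_pos D.init_Φ.1 D.mem_Φ
  have mW := InFE.of_pos D.init_ϑ.1 D.mem_ϑ
  have mψ := InFE.of_pos D.init_ψ.1 D.mem_ψ
  have hmem : ∀ {y : ℕ → H10 L} (x : ℝ → H10 L), (∀ k ≤ N, InFE M (y k)) → ∀ k ≤ N,
      InFE M (ritzError M τ y x k) := fun x hy k hk => InFE.sub hL hM (hy k hk) (inFE_ritz hL hM _)
  have g1 := residual_u_le hL hM hc S D' hn h0 h01 h1 (hmem U mU (n + 1) hn)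
  have g2 := residual_φ_le hL hM hc S D' hn h0 h01 h1 (hmem V mV (n + 1) hn)
  have g3 := residual_w_le hL hM hc S D' hn h0 h01 h1 (hmem W mW (n + 1) hn)
  -- The equation is used at the new level only and tested with the increment: at level zero the
  -- discrete `ψ` is a projection, for which no discrete equation is imposed.
  have g4 := residual_ψ_eq hL hM S D hn hs₁
    (InFE.sub hL hM (hmem ψ mψ (n + 1) hn) (hmem ψ mψ n hn.le))
  have k1 := step_error_eq hL hM (p := u) (P := U) h01 hlen (D.step_u n hn)
  have k2 := step_error_eq hL hM (p := φ) (P := V) h01 hlen (D.step_φ n hn)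
  have k3 := step_error_eq hL hM (p := w) (P := W) h01 hlen (D.step_w n hn)
  have d1 := norm_dx_defect_le hL hM S.weight S.vel_u h0 h01 h1
  have d2 := norm_dx_defect_le hL hM S.weight S.vel_φ h0 h01 h1
  have d3 := norm_dx_defect_le hL hM S.weight S.vel_w h0 h01 h1
  have f1 := norm_fn_le_mul_norm_dx hL (defect M u U (n * τ) ((n + 1 : ℕ) * τ))
  have f2 := norm_fn_le_mul_norm_dx hL (defect M φ V (n * τ) ((n + 1 : ℕ) * τ))
  have R1 := norm_dx_ritz_sub_sub_le hL hM S.weight S.curve_φ h0 h01 h1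
  have R2 := norm_fn_ritz_sub_sub_le hL hM S.weight S.curve_ψ.modulus h0 h01 h1
  rw [hlen] at g1 g2 g3
  set a := ∫ r in (n * τ)..((n + 1 : ℕ) * τ), m r
  set s := stepSize (L / M) τ a with hs
  have hha : 0 ≤ L / M * a / τ := by positivity
  have hs2 : a ≤ s := by rw [hs, stepSize]; linarith
  have hs0 : 0 ≤ s := ha.trans hs2
  -- The term `h a / τ` in `s` is what makes the increments of the `ψ` residual of size `τ s`.
  have hs3 : L / M * a ≤ τ * s := by
    rw [← div_le_iff₀' hτ, hs, stepSize]; linarith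
  refine energy_step_le hc hτ hTτ hL hs0 g1 g2 g3 ?_ (congrArg (fun v : H10 L => dx v.1) k1)
    (congrArg (fun v : H10 L => dx v.1) k3) (kφ := dx (defect M φ V (n * τ) ((n + 1 : ℕ) * τ)).1)
    (kY := fn (defect M φ V (n * τ) ((n + 1 : ℕ) * τ)).1
      - fn (defect M u U (n * τ) ((n + 1 : ℕ) * τ)).1)
    ?_ ?_ (inner_dx_fn_add_inner_dx_fn hL _ _) (d1.trans hs2) (d3.trans hs2) (d2.trans hs2)
    ?_ ?_ (norm_fn_le_mul_norm_dx hL _)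
  · exact g4
  · have := congrArg (fun v : H10 L => dx v.1) k2
    simp only [dx_coe_sub, dx_coe_smul, dx_coe_add] at this
    simp only [ritzError, dx_coe_sub, fn_coe_sub]
    rw [← this]
    abel
  · have e1 := congrArg (fun v : H10 L => fn v.1) k1
    have e2 := congrArg (fun v : H10 L => fn v.1) k2
    simp only [fn_coe_sub, fn_coe_smul, fn_coe_add] at e1 e2
    simp only [ritzError, fn_coe_sub]
    rw [sub_sub_sub_comm, e1, e2, ← smul_sub]
    congr 1
    abel
  · refine (norm_sub_le _ _).trans ?_
    have : L * a ≤ L * s := by gcongr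
    have := mul_le_mul_of_nonneg_left d1 hL.le
    have := mul_le_mul_of_nonneg_left d2 hL.le
    linarith
  · have : residualψ M φ ψ ((n + 1 : ℕ) * τ) - residualψ M φ ψ (n * τ)
        = (dx (ritz M (φ ((n + 1 : ℕ) * τ))).1 - dx (φ ((n + 1 : ℕ) * τ)).1
            - (dx (ritz M (φ (n * τ))).1 - dx (φ (n * τ)).1))
          + (fn (ritz M (ψ ((n + 1 : ℕ) * τ))).1 - fn (ψ ((n + 1 : ℕ) * τ)).1
            - (fn (ritz M (ψ (n * τ))).1 - fn (ψ (n * τ)).1)) := by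
      rw [residualψ, residualψ]; abel
    rw [this]
    refine (norm_add_le _ _).trans ?_
    linarith

theorem IsSmoothSolution.norm_residualψ_le (hL : 0 < L) (hM : 0 < M)
    (S : IsSmoothSolution c T A m I u φ ψ w U V W uxx φxx ψxx wxx ξ Φ ϑ) {t : ℝ}
    (ht : t ∈ Icc 0 T) : ‖residualψ M φ ψ t‖ ≤ 2 * (L / M * A) := by
  have hM' : (0 : ℝ) < M := by exact_mod_cast hM
  have h1 : ‖dx (ritz M (φ t)).1 - dx (φ t).1‖ ≤ L / M * A :=
    (norm_dx_ritz_sub_le_of_isWeakDeriv hL hM (φ t) (S.curve_φ.weak t ht)).trans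
      (mul_le_mul_of_nonneg_left (S.curve_φ.norm_le t ht) (by positivity))
  have h2 := norm_fn_ritz_sub_le_of_le hL hM (S.curve_ψ.norm_dx_le t ht) le_rfl
  refine (norm_add_le _ _).trans ?_
  linarith

theorem energy_lower_bounds {H : Type*} [NormedAddCommGroup H] [InnerProductSpace ℝ H]
    {c : Coeffs} (hc : c.Admissible) (ξ Φ ϑ Du X Y Dw P : H) :
    0 ≤ energy c ξ Φ ϑ Du X Y Dw P ∧ c.b / 2 * ‖P‖ ^ 2 ≤ energy c ξ Φ ϑ Du X Y Dw P ∧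
      ‖ξ‖ ^ 2 + ‖Du‖ ^ 2 + ‖Y‖ ^ 2 + ‖Φ‖ ^ 2 + ‖X‖ ^ 2 + ‖P‖ ^ 2 + ‖ϑ‖ ^ 2 + ‖Dw‖ ^ 2
        ≤ 2 * (1 / c.ρ + 1 / c.ρ₁ + 1 / c.ρ₃ + 1 / c.α + 1 / c.K + 1 / c.lam + 1 / c.δ + 1 / c.b)
          * energy c ξ Φ ϑ Du X Y Dw P := by
  obtain ⟨hρ, hα, hlam, -, hρ₁, hK, -, -, hb, hρ₃, hδ, -⟩ := hc
  have n1 : 0 ≤ c.ρ / 2 * ‖ξ‖ ^ 2 := by positivity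
  have n2 : 0 ≤ c.ρ₁ / 2 * ‖Φ‖ ^ 2 := by positivity
  have n3 : 0 ≤ c.ρ₃ / 2 * ‖ϑ‖ ^ 2 := by positivity
  have n4 : 0 ≤ c.α / 2 * ‖Du‖ ^ 2 := by positivity
  have n5 : 0 ≤ c.K / 2 * ‖X‖ ^ 2 := by positivity
  have n6 : 0 ≤ c.lam / 2 * ‖Y‖ ^ 2 := by positivity
  have n7 : 0 ≤ c.δ / 2 * ‖Dw‖ ^ 2 := by positivity
  have n8 : 0 ≤ c.b / 2 * ‖P‖ ^ 2 := by positivity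
  have key : ∀ {k x : ℝ}, 0 < k → k / 2 * x ≤ energy c ξ Φ ϑ Du X Y Dw P →
      x ≤ 2 * (1 / k) * energy c ξ Φ ϑ Du X Y Dw P := by
    intro k x hk h
    rw [mul_one_div, div_mul_eq_mul_div, le_div_iff₀ hk]
    linarith
  refine ⟨by rw [energy]; linarith, by rw [energy]; linarith, ?_⟩
  have m1 := key (x := ‖ξ‖ ^ 2) hρ (by rw [energy]; linarith)
  have m2 := key (x := ‖Φ‖ ^ 2) hρ₁ (by rw [energy]; linarith)
  have m3 := key (x := ‖ϑ‖ ^ 2) hρ₃ (by rw [energy]; linarith)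
  have m4 := key (x := ‖Du‖ ^ 2) hα (by rw [energy]; linarith)
  have m5 := key (x := ‖X‖ ^ 2) hK (by rw [energy]; linarith)
  have m6 := key (x := ‖Y‖ ^ 2) hlam (by rw [energy]; linarith)
  have m7 := key (x := ‖Dw‖ ^ 2) hδ (by rw [energy]; linarith)
  have m8 := key (x := ‖P‖ ^ 2) hb (by rw [energy]; linarith)
  linarith

theorem IsSmoothSolution.abs_perturbation_le (hL : 0 < L) (hM : 0 < M) (hc : c.Admissible)
    (S : IsSmoothSolution c T A m I u φ ψ w U V W uxx φxx ψxx wxx ξ Φ ϑ) {τ : ℝ} {n : ℕ}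
    (ht : n * τ ∈ Icc 0 T) :
    |c.K * inner ℝ (residualψ M φ ψ (n * τ)) (fn (ritzError M τ ψh ψ n).1)|
      ≤ errorEnergy c M τ uh φh ψh wh ξh Φh ϑh u φ ψ w U V W n / 2
        + 4 * c.K ^ 2 * A ^ 2 * L ^ 2 / c.b * (L / M) ^ 2 := by
  have hM' : (0 : ℝ) < M := by exact_mod_cast hM
  have hA := S.A_nonneg
  have hb := hc.b_pos
  have h1 := S.norm_residualψ_le hL hM ht
  have h2 := norm_fn_le_mul_norm_dx hL (ritzError M τ ψh ψ n)
  have h3 := abs_mul_le_mul hc.K_pos.le ((abs_real_inner_le_norm _ _).trans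
    (mul_le_mul h1 h2 (norm_nonneg _) (by positivity)))
  -- The weight `b / 4` is half the coefficient of the `ψ` term in the energy, whence `E / 2`.
  have h4 := mul_le_mul_sq_add (μ := c.b / 4) (C := c.K * (2 * (L / M * A)) * L)
    (x := ‖dx (ritzError M τ ψh ψ n).1‖) (by positivity)
  have h5 : (c.K * (2 * (L / M * A)) * L) ^ 2 / (4 * (c.b / 4))
      = 4 * c.K ^ 2 * A ^ 2 * L ^ 2 / c.b * (L / M) ^ 2 := by
    field_simp; ring
  have h6 := (energy_lower_bounds hc (fn (ritzError M τ ξh U n).1)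
    (fn (ritzError M τ Φh V n).1) (fn (ritzError M τ ϑh W n).1) (dx (ritzError M τ uh u n).1)
    (dx (ritzError M τ φh φ n).1 + fn (ritzError M τ ψh ψ n).1)
    (fn (ritzError M τ φh φ n).1 - fn (ritzError M τ uh u n).1)
    (dx (ritzError M τ wh w n).1) (dx (ritzError M τ ψh ψ n).1)).2.1
  rw [h5] at h4
  rw [errorEnergy]
  linarith

/-- Each error is a Ritz error plus a projection error. Six projection errors are at most `h A` and
two are at most `2 h A`, so `28 = 6 · 2 + 2 · 8`. -/
theorem IsSmoothSolution.sqError_le_errorEnergy (hL : 0 < L) (hM : 0 < M) (hc : c.Admissible)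
    (S : IsSmoothSolution c T A m I u φ ψ w U V W uxx φxx ψxx wxx ξ Φ ϑ) {τ : ℝ} {n : ℕ}
    (ht : n * τ ∈ Icc 0 T) :
    sqError (uh n) (φh n) (ψh n) (wh n) (ξh n) (Φh n) (ϑh n) (u (n * τ)) (φ (n * τ)) (ψ (n * τ))
        (w (n * τ)) (ξ (n * τ)) (Φ (n * τ)) (ϑ (n * τ))
      ≤ 4 * (1 / c.ρ + 1 / c.ρ₁ + 1 / c.ρ₃ + 1 / c.α + 1 / c.K + 1 / c.lam + 1 / c.δ + 1 / c.b)
          * errorEnergy c M τ uh φh ψh wh ξh Φh ϑh u φ ψ w U V W n + 28 * A ^ 2 * (L / M) ^ 2 := by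
  have hM' : (0 : ℝ) < M := by exact_mod_cast hM
  have hA := S.A_nonneg
  have hH2 : ∀ {x : ℝ → H10 L} {xxx : ℝ → L2 L}, IsH2Curve T A m x xxx →
      ‖dx (ritz M (x (n * τ))).1 - dx (x (n * τ)).1‖ ≤ L / M * A := fun h =>
    (norm_dx_ritz_sub_le_of_isWeakDeriv hL hM _ (h.weak _ ht)).trans
      (mul_le_mul_of_nonneg_left (h.norm_le _ ht) (by positivity))
  have hvel : ∀ {xh : ℕ → H10 L} {x X : ℝ → H10 L} {X' : ℝ → L2 L}, IsVelocity T A m x X X' →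
      ‖fn (xh n).1 - X' (n * τ)‖ ^ 2
        ≤ 2 * ‖fn (ritzError M τ xh X n).1‖ ^ 2 + 2 * (L / M * A) ^ 2 := fun h =>
    norm_sq_add_le (by rw [ritzError, fn_coe_sub, ← h.fn_eq _ ht]; abel)
      (norm_fn_ritz_sub_le_of_le hL hM (h.norm_dx_le _ ht) le_rfl)
  have hdx : ∀ {xh : ℕ → H10 L} {x : ℝ → H10 L} {xxx : ℝ → L2 L}, IsH2Curve T A m x xxx →
      ‖dx (xh n).1 - dx (x (n * τ)).1‖ ^ 2
        ≤ 2 * ‖dx (ritzError M τ xh x n).1‖ ^ 2 + 2 * (L / M * A) ^ 2 := fun h =>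
    norm_sq_add_le (by rw [ritzError, dx_coe_sub]; abel) (hH2 h)
  have e1 := hvel (xh := ξh) S.vel_u
  have e2 := hdx (xh := uh) S.curve_u
  have e3 : ‖fn (φh n).1 - fn (uh n).1 - (fn (φ (n * τ)).1 - fn (u (n * τ)).1)‖ ^ 2
      ≤ 2 * ‖fn (ritzError M τ φh φ n).1 - fn (ritzError M τ uh u n).1‖ ^ 2
        + 2 * (L / M * A + L / M * A) ^ 2 := by
    refine norm_sq_add_le (y := fn (ritz M (φ (n * τ))).1 - fn (φ (n * τ)).1
      - (fn (ritz M (u (n * τ))).1 - fn (u (n * τ)).1))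
      (by rw [ritzError, ritzError, fn_coe_sub, fn_coe_sub]; abel) ?_
    exact (norm_sub_le _ _).trans (add_le_add
      (norm_fn_ritz_sub_le_of_le hL hM (S.curve_φ.norm_dx_le _ ht) le_rfl)
      (norm_fn_ritz_sub_le_of_le hL hM (S.curve_u.norm_dx_le _ ht) le_rfl))
  have e4 := hvel (xh := Φh) S.vel_φ
  have e5 : ‖dx (φh n).1 + fn (ψh n).1 - (dx (φ (n * τ)).1 + fn (ψ (n * τ)).1)‖ ^ 2
      ≤ 2 * ‖dx (ritzError M τ φh φ n).1 + fn (ritzError M τ ψh ψ n).1‖ ^ 2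
        + 2 * (2 * (L / M * A)) ^ 2 :=
    norm_sq_add_le (y := residualψ M φ ψ (n * τ))
      (by rw [ritzError, ritzError, fn_coe_sub, dx_coe_sub, residualψ]; abel)
      (S.norm_residualψ_le hL hM ht)
  have e6 := hdx (xh := ψh) S.curve_ψ
  have e7 := hvel (xh := ϑh) S.vel_w
  have e8 := hdx (xh := wh) S.curve_w
  have h6 := (energy_lower_bounds hc (fn (ritzError M τ ξh U n).1)
    (fn (ritzError M τ Φh V n).1) (fn (ritzError M τ ϑh W n).1) (dx (ritzError M τ uh u n).1)
    (dx (ritzError M τ φh φ n).1 + fn (ritzError M τ ψh ψ n).1)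
    (fn (ritzError M τ φh φ n).1 - fn (ritzError M τ uh u n).1)
    (dx (ritzError M τ wh w n).1) (dx (ritzError M τ ψh ψ n).1)).2.2
  rw [sqError, errorEnergy]
  linarith

/-- The error estimate, for an exact solution of sufficient regularity. -/
theorem IsSmoothSolution.exists_sqError_le (hL : 0 < L) (hT : 0 < T) (hc : c.Admissible)
    (S : IsSmoothSolution c T A m I u φ ψ w U V W uxx φxx ψxx wxx ξ Φ ϑ) :
    ∃ C : ℝ, 0 < C ∧ ∀ M N : ℕ, 0 < M → 0 < N →
      ∀ uh φh ψh wh ξh Φh ϑh : ℕ → H10 L,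
        IsDiscreteSolution c I M N (T / N) uh φh ψh wh ξh Φh ϑh →
        ∀ n ≤ N,
          sqError (uh n) (φh n) (ψh n) (wh n) (ξh n) (Φh n) (ϑh n)
              (u (n * (T / N))) (φ (n * (T / N))) (ψ (n * (T / N))) (w (n * (T / N)))
              (ξ (n * (T / N))) (Φ (n * (T / N))) (ϑ (n * (T / N)))
            ≤ C * ((L / M) ^ 2 + (T / N) ^ 2) := by
  have hA := S.A_nonneg
  set J := ∫ r in (0 : ℝ)..T, m r ^ 2 with hJ
  have hJ0 : 0 ≤ J := intervalIntegral.integral_nonneg hT.le fun r _ => sq_nonneg _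
  set Q := stabilityConst c T L (residualConst c A) (residualConst c A * (1 + L)) with hQ
  have hQ0 : 0 ≤ Q := by
    obtain ⟨hρ, hα, hlam, hμ, hρ₁, hK, hγ, -, hb, hρ₃, hδ, hκ⟩ := hc
    rw [hQ, stabilityConst]; positivity
  set q := 4 * c.K ^ 2 * A ^ 2 * L ^ 2 / c.b with hq
  have hq0 : 0 ≤ q := by have := hc.b_pos; positivity
  set k := 4 * (1 / c.ρ + 1 / c.ρ₁ + 1 / c.ρ₃ + 1 / c.α + 1 / c.K + 1 / c.lam + 1 / c.δ + 1 / c.b)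
    with hk
  have hk0 : 0 < k := by
    obtain ⟨hρ, hα, hlam, hμ, hρ₁, hK, hγ, -, hb, hρ₃, hδ, hκ⟩ := hc
    positivity
  -- Gronwall gives the exponential at `n τ ≤ T`; `q` comes from the perturbation, `Q · 3 (J + T)`
  -- from the summed residuals, `28 A²` from the projection errors, and `+ 1` ensures positivity.
  refine ⟨k * (2 * (Real.exp (4 * T) * (q + Q * (3 * (J + T))))) + 28 * A ^ 2 + 1,
    by positivity, ?_⟩
  intro M N hM hN uh φh ψh wh ξh Φh ϑh D n hn
  have hM' : (0 : ℝ) < M := by exact_mod_cast hM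
  have hN' : (0 : ℝ) < N := by exact_mod_cast hN
  set τ := T / N with hτd
  have hτ : 0 < τ := by positivity
  have hNτ : N * τ = T := by rw [hτd]; field_simp
  have htime : ∀ k ≤ N, (k : ℝ) * τ ∈ Icc 0 T := fun k hk =>
    ⟨by positivity, by rw [← hNτ]; gcongr⟩
  set h := L / M with hh
  obtain ⟨z1, z2, z3, z4, z5, z6, z7⟩ := S.ritzError_zero hL hM hT D
  have hsum := sum_stepSize_sq_le (h := h) S.weight hτ hNτ n hn
  have hE := energy_le_exp (E := errorEnergy c M τ uh φh ψh wh ξh Φh ϑh u φ ψ w U V W)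
    (B := fun n => c.K * inner ℝ (residualψ M φ ψ (n * τ)) (fn (ritzError M τ ψh ψ n).1))
    (r := fun n => Q * (τ * stepSize h τ (∫ r in (n * τ)..((n + 1 : ℕ) * τ), m r) ^ 2))
    (q := q * h ^ 2) hτ.le (fun n hn => S.errorEnergy_step_le hL hM hc hτ hNτ D hn)
    (fun n hn => S.abs_perturbation_le hL hM hc (htime n hn)) (fun n => by positivity)
    (by simp only [errorEnergy, z1, z2, z3, z4, z5, z6, z7]; simp [energy, fn, dx])
    (by simp only [z3]; simp [fn]) n hn
  rw [← Finset.mul_sum] at hE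
  have hmono : ∫ r in (0 : ℝ)..(n * τ), m r ^ 2 ≤ J := by
    have hi2 : IntegrableOn (fun r => m r ^ 2) (Ioo 0 T) := S.weight.memLp.integrable_sq
    have hn' := htime n hn
    have := intervalIntegral.integral_add_adjacent_intervals
      (intervalIntegrable_of_Ioo hi2 le_rfl hn'.1 hn'.2)
      (intervalIntegrable_of_Ioo hi2 hn'.1 hn'.2 le_rfl)
    have h2 : 0 ≤ ∫ r in (n * τ)..T, m r ^ 2 :=
      intervalIntegral.integral_nonneg hn'.2 fun r _ => sq_nonneg _
    linarith
  have hexp : Real.exp (4 * τ * n) ≤ Real.exp (4 * T) := by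
    refine Real.exp_le_exp.2 ?_
    have := (htime n hn).2
    linarith
  have hE' : errorEnergy c M τ uh φh ψh wh ξh Φh ϑh u φ ψ w U V W n
      ≤ 2 * (Real.exp (4 * T) * (q + Q * (3 * (J + T)))) * (h ^ 2 + τ ^ 2) := by
    have i1 : q * h ^ 2 ≤ q * (h ^ 2 + τ ^ 2) := by
      gcongr; exact le_add_of_nonneg_right (sq_nonneg τ)
    have i2 : Q * (3 * ((∫ r in (0 : ℝ)..(n * τ), m r ^ 2) + n * τ) * (h ^ 2 + τ ^ 2))
        ≤ Q * (3 * (J + T) * (h ^ 2 + τ ^ 2)) := by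
      have := (htime n hn).2
      gcongr
    have i3 := mul_le_mul_of_nonneg_left hsum hQ0
    have i4 : q * h ^ 2 + Q * ∑ i ∈ Finset.range n,
        τ * stepSize h τ (∫ r in ((i : ℕ) * τ)..((i + 1 : ℕ) * τ), m r) ^ 2
        ≤ (q + Q * (3 * (J + T))) * (h ^ 2 + τ ^ 2) :=
      (add_le_add i1 (i3.trans i2)).trans_eq (by ring)
    refine hE.trans ?_
    have i5 := mul_le_mul hexp i4 (by positivity) (Real.exp_pos _).le
    exact (mul_le_mul_of_nonneg_left i5 zero_le_two).trans_eq (by ring)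
  have hfin := S.sqError_le_errorEnergy (uh := uh) (φh := φh) (ψh := ψh) (wh := wh) (ξh := ξh)
    (Φh := Φh) (ϑh := ϑh) hL hM hc (htime n hn)
  refine hfin.trans ?_
  have j1 := mul_le_mul_of_nonneg_left hE' hk0.le
  have j2 : 28 * A ^ 2 * h ^ 2 ≤ 28 * A ^ 2 * (h ^ 2 + τ ^ 2) := by
    gcongr; exact le_add_of_nonneg_right (sq_nonneg τ)
  have j3 : 0 ≤ h ^ 2 + τ ^ 2 := by positivity
  refine (add_le_add j1 j2).trans ?_
  rw [add_mul, add_mul, one_mul, mul_assoc k]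
  exact le_add_of_nonneg_right j3

/-- Adding the seven bounds and the seven weights gives one pair `A`, `m` that serves all curves at
once. -/
theorem exists_isSmoothSolution (hL : 0 < L) (hT : 0 < T)
    (hsol : IsWeakSolution c T I u φ ψ w ξ Φ ϑ)
    (hu : IsRegularCurve T u) (hφ : IsRegularCurve T φ) (hw : IsRegularCurve T w)
    (hψ : MemTimeSobolevH2 T 1 2 (fun t => (ψ t : H1 L))) :
    ∃ (A : ℝ) (m : ℝ → ℝ) (U V W : ℝ → H10 L) (uxx φxx ψxx wxx : ℝ → L2 L),
      IsSmoothSolution c T A m I u φ ψ w U V W uxx φxx ψxx wxx ξ Φ ϑ := by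
  obtain ⟨A1, m1, uxx, hA1, hm1, h1⟩ := exists_isH2Curve hT hsol.curve_u.cont le_top hu.w1H2
  obtain ⟨A2, m2, φxx, hA2, hm2, h2⟩ := exists_isH2Curve hT hsol.curve_φ.cont le_top hφ.w1H2
  obtain ⟨A3, m3, ψxx, hA3, hm3, h3⟩ := exists_isH2Curve hT hsol.curve_ψ le_rfl hψ
  obtain ⟨A4, m4, wxx, hA4, hm4, h4⟩ := exists_isH2Curve hT hsol.curve_w.cont le_top hw.w1H2
  obtain ⟨A5, m5, U, hA5, hm5, h5⟩ := exists_isVelocity hL hT hsol.curve_u hu.h2H1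
  obtain ⟨A6, m6, V, hA6, hm6, h6⟩ := exists_isVelocity hL hT hsol.curve_φ hφ.h2H1
  obtain ⟨A7, m7, W, hA7, hm7, h7⟩ := exists_isVelocity hL hT hsol.curve_w hw.h2H1
  have hm := (((((hm1.add hm2).add hm3).add hm4).add hm5).add hm6).add hm7
  have hle : ∀ t, (0 ≤ m1 t ∧ 0 ≤ m2 t ∧ 0 ≤ m3 t ∧ 0 ≤ m4 t) ∧ 0 ≤ m5 t ∧ 0 ≤ m6 t ∧ 0 ≤ m7 t :=
    fun t => ⟨⟨hm1.nonneg t, hm2.nonneg t, hm3.nonneg t, hm4.nonneg t⟩, hm5.nonneg t,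
      hm6.nonneg t, hm7.nonneg t⟩
  refine ⟨A1 + A2 + A3 + A4 + A5 + A6 + A7, _, U, V, W, uxx, φxx, ψxx, wxx, hsol, by positivity, hm,
    h1.mono (by linarith) hm1 hm fun t => ?_, h2.mono (by linarith) hm2 hm fun t => ?_,
    h3.mono (by linarith) hm3 hm fun t => ?_, h4.mono (by linarith) hm4 hm fun t => ?_,
    h5.mono (by linarith) hm5 hm fun t => ?_, h6.mono (by linarith) hm6 hm fun t => ?_,
    h7.mono (by linarith) hm7 hm fun t => ?_⟩
  all_goals
    obtain ⟨⟨n1, n2, n3, n4⟩, n5, n6, n7⟩ := hle t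
    linarith

end ErrorEstimate

end ShearBeam

end

theorem mainTheorem4 (L T : ℝ) (hL : 0 < L) (hT : 0 < T)
    (c : Coeffs) (hc : c.Admissible) (I : InitialData L)
    (u φ ψ w : ℝ → H10 L) (ξ Φ ϑ : ℝ → L2 L)
    (hsol : IsWeakSolution c T I u φ ψ w ξ Φ ϑ)
    (hu : IsRegularCurve T u) (hφ : IsRegularCurve T φ) (hw : IsRegularCurve T w)
    (hψ : MemTimeSobolevH2 T 1 2 (fun t => (ψ t : H1 L))) :
    ∃ C : ℝ, 0 < C ∧ ∀ M N : ℕ, 0 < M → 0 < N →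
      ∀ uh φh ψh wh ξh Φh ϑh : ℕ → H10 L,
        IsDiscreteSolution c I M N (T / N) uh φh ψh wh ξh Φh ϑh →
        ∀ n ≤ N,
          sqError (uh n) (φh n) (ψh n) (wh n) (ξh n) (Φh n) (ϑh n)
              (u (n * (T / N))) (φ (n * (T / N))) (ψ (n * (T / N))) (w (n * (T / N)))
              (ξ (n * (T / N))) (Φ (n * (T / N))) (ϑ (n * (T / N)))
            ≤ C * ((L / M) ^ 2 + (T / N) ^ 2) := by
  obtain ⟨A, m, U, V, W, uxx, φxx, ψxx, wxx, S⟩ :=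
    exists_isSmoothSolution hL hT hsol hu hφ hw hψ
  exact S.exists_sqError_le hL hT hc
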